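/- **Setting.** Fix the numbers $K$ of queues and $\tau$ of allocation periods. Units have i.i.d. data $O_i=(A_i,X_i,Y_i^0,Y_i^1)\sim P$, with arrival time $A\in[0,\tau]$ whose distribution has no atoms, covariates $X\in\mathbb R^d$ and real potential outcomes $Y^0,Y^1$. Independently across units, and given $O_i$, unit $i$ is put into queue $Q_i\in\{1,\dots,K\}$ with $\mathbb P(Q_i=k\mid O_i)=\theta_k(X_i)$, where $\theta(x)=(\theta_1(x),\dots,\theta_K(x))$ is a fixed measurable map into the simplex $\Delta_K$. In the experiment with $n$ units, $b_{t,n}\in\mathbb N$ treatments are available at the end of period $t\in\{1,\dots,\tau\}$; they are given to the units that have arrived by time $t$ and are not yet treated, in order of the queue index (lowest first) and, within a queue, in order of arrival, until the budget $b_{t,n}$ is exhausted or nobody is waiting. Untreated units remain eligible. Let $Z_i\in\{0,1\}$ say whether unit $i$ is treated by the end of period $\tau$, let $Y_i=Y_i^{Z_i}$, and write $\pi_n(x)=\mathbb P(Z_i=1\mid X_i=x)$ for the propensity score in the experiment with $n$ units, $\pi(x;\theta)=\lim_{n\to\infty}\pi_n(x)$, and $\mu_z(x)=\mathbb E(Y\mid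 Z=z,X=x)$. **Assumptions.** 1. (Exogenous arrivals) $A$ and $(Y^0,Y^1)$ are conditionally independent given $X$. 2. (Positivity) There are $\gamma>0$ and $n_0\in\mathbb N$ such that $\gamma\le\pi_n(X)\le1-\gamma$ almost surely for every $n\ge n_0$. 3. (Fixed queue proportions) $\mathbb E\{\theta(X)\}=p\in\Delta_K$. 4. (Stable, non-negligible budget) For some $\beta\in(0,1)$, $\max_{1\le t\le\tau}\bigl|\tfrac1n\sum_{s\le t}b_{s,n}-\beta\,\mathbb P(A\le t)\bigr|\to0$ as $n\to\infty$. 5. (Independent arrivals) $A$ and $X$ are independent. 6. There is $m<\infty$ with $\mathbb E\{(Y^1)^2+(Y^0)^2\}\le m$. 7. $\widehat\mu_0,\widehat\mu_1$ (which may depend on $n$) are constructed from a sample $\mathcal D$ independent of the experiment, and $\|\widehat\mu_z-\mu_z\|_{L_2(P_X)}=o_{\mathbb P}(1)$ for $z\in\{0,1\}$, where $P_X$ is the law of $X$. Let $$\widehat\psi^{\mathrm{DR}}_{\mathrm{ATE}}=\frac1n\sum_{i=1}^n\Bigl[\widehat\mu_1(X_i)-\widehat\mu_0(X_i)+\frac{Z_i}{\pi_n(X_i)}\{Y_i-\widehat\mu_1(X_i)\}-\frac{1-Z_i}{1-\pi_n(X_i)}\{Y_i-\widehat\mu_0(X_i)\}\Bigr].$$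 **Theorem 5.** The limit $\pi(x;\theta)$ exists for $P_X$-almost every $x$. For $z\in\{0,1\}$, let $\mu_z$ and $\mathrm{Var}(Y\mid Z=z,X)$ be computed in the experiment of any fixed size at least $n_0$. Then the expectations and variances on the right-hand side below are finite, and, conditionally on $\mathcal D$, with convergence in probability with respect to $\mathcal D$, $\widehat\psi^{\mathrm{DR}}_{\mathrm{ATE}}$ has a finite variance with probability tending to one and $$n\,\mathrm{Var}\bigl(\widehat\psi^{\mathrm{DR}}_{\mathrm{ATE}}\mid\mathcal D\bigr)\;\longrightarrow\;\mathbb E\Bigl\{\frac{\mathrm{Var}(Y\mid Z=1,X)}{\pi(X;\theta)}+\frac{\mathrm{Var}(Y\mid Z=0,X)}{1-\pi(X;\theta)}\Bigr\}+\mathrm{Var}\bigl(\mu_1(X)-\mu_0(X)\bigr)\qquad(n\to\infty).$$ In particular, the right-hand side does not depend on the size of the experiment in which the conditional moments are computed. -/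

import Mathlib

open MeasureTheory ProbabilityTheory Filter Topology

/-! Tiered priority queues: the allocation rule, the sampling model, and the doubly robust
estimator of the average treatment effect. -/

namespace QueueDesign

/-! ### The allocation rule

Units are numbered `0, …, n - 1`; unit `i` has arrival time `a i` and queue `q i`, where queues
with a lower index have higher priority. At the end of period `t = 1, 2, …` there are `c t`
treatment slots. -/

section Allocation

variable {K : ℕ}

/-- Unit `j` is served before unit `i`: it is in a queue of higher priority, or in the same queue
with an earlier arrival time. (Equal arrival times, which have probability zero below, are
ordered by the number of the unit.) -/
def Precedes (a : ℕ → ℝ) (q : ℕ → Fin K) (j i : ℕ) : Prop :=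
  q j < q i ∨ (q j = q i ∧ (a j < a i ∨ (a j = a i ∧ j < i)))

open Classical in
/-- The units that have arrived by time `t` and do not belong to the set `S` of treated units. -/
noncomputable def waiting (n : ℕ) (a : ℕ → ℝ) (t : ℕ) (S : Finset ℕ) : Finset ℕ :=
  (Finset.range n).filter fun i => a i ≤ (t : ℝ) ∧ i ∉ S

open Classical in
/-- The units that have been treated by the end of period `t`: in each period the waiting units
are treated in the order of priority until the slots of that period are exhausted, that is, a
waiting unit is treated when fewer than `c t` waiting units precede it. -/
noncomputable def treatedBy (n : ℕ) (c : ℕ → ℕ) (a : ℕ → ℝ) (q : ℕ → Fin K) : ℕ → Finset ℕ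
  | 0 => ∅
  | t + 1 =>
    treatedBy n c a q t ∪
      (waiting n a (t + 1) (treatedBy n c a q t)).filter fun i =>
        ((waiting n a (t + 1) (treatedBy n c a q t)).filter fun j => Precedes a q j i).card
          < c (t + 1)

end Allocation

/-! ### The sampling model -/

/-- The data of a unit: the arrival time `A`, the covariates `X ∈ ℝ^d`, and the potential outcomes
`Y⁰` (at `false`) and `Y¹` (at `true`). -/
abbrev Obs (d : ℕ) : Type := ℝ × EuclideanSpace ℝ (Fin d) × (Bool → ℝ)

/-- The arrival time `A`. -/
def arr {d : ℕ} (o : Obs d) : ℝ := o.1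

/-- The covariates `X`. -/
def cov {d : ℕ} (o : Obs d) : EuclideanSpace ℝ (Fin d) := o.2.1

/-- The potential outcomes `(Y⁰, Y¹)`. -/
def pot {d : ℕ} (o : Obs d) : Bool → ℝ := o.2.2

lemma measurable_arr {d : ℕ} : Measurable (arr (d := d)) := measurable_fst

lemma measurable_cov {d : ℕ} : Measurable (cov (d := d)) := measurable_fst.comp measurable_snd

lemma measurable_pot {d : ℕ} : Measurable (pot (d := d)) := measurable_snd.comp measurable_snd

section Model

variable {d K : ℕ} (P : Measure (Obs d)) (θ : Kernel (EuclideanSpace ℝ (Fin d)) (Fin K))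

/-- The law of the covariates. -/
noncomputable def covLaw : Measure (EuclideanSpace ℝ (Fin d)) := P.map cov

/-- The joint law of the data of a unit and its queue: given the data, the queue `k` is drawn with
probability `θ_k(X)`. -/
noncomputable def unitLaw : Measure (Obs d × Fin K) := P ⊗ₘ (θ.comap cov measurable_cov)

/-- Independent and identically distributed units; the experiment of size `n` consists of the
first `n` of them. -/
noncomputable def sampleLaw : Measure (ℕ → Obs d × Fin K) := Measure.infinitePi fun _ => unitLaw P θ

instance [IsProbabilityMeasure P] [IsMarkovKernel θ] : IsProbabilityMeasure (unitLaw P θ) := by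
  unfold unitLaw; infer_instance

instance [IsProbabilityMeasure P] [IsMarkovKernel θ] : IsProbabilityMeasure (sampleLaw P θ) := by
  unfold sampleLaw; infer_instance

open Classical in
/-- The terminal treatment status of unit `i` in the experiment of size `n` with `τ` allocation
periods, where `b n t` is the budget of period `t`. -/
noncomputable def treat (τ : ℕ) (b : ℕ → ℕ → ℕ) (n i : ℕ) (ω : ℕ → Obs d × Fin K) : Bool :=
  decide (i ∈ treatedBy n (b n) (fun j => arr (ω j).1) (fun j => (ω j).2) τ)

/-- The observed outcome `Y = Y^Z` of unit `i`. -/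
noncomputable def outcome (τ : ℕ) (b : ℕ → ℕ → ℕ) (n i : ℕ) (ω : ℕ → Obs d × Fin K) : ℝ :=
  pot (ω i).1 (treat τ b n i ω)

variable [IsProbabilityMeasure P] [IsMarkovKernel θ] (τ : ℕ) (b : ℕ → ℕ → ℕ)

/-- The propensity score `π_n(x) = ℙ(Z = 1 ∣ X = x)` of a unit in the experiment of size `n`.
The units are exchangeable, so it is defined by means of the first one. -/
noncomputable def propensity (n : ℕ) (x : EuclideanSpace ℝ (Fin d)) : ℝ :=
  (condDistrib (fun ω => treat τ b n 0 ω) (fun ω => cov (ω 0).1) (sampleLaw P θ) x).real {true}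

/-- The asymptotic propensity score `π(x) = lim π_n(x)`. -/
noncomputable def asympPropensity (x : EuclideanSpace ℝ (Fin d)) : ℝ :=
  limUnder atTop fun n => propensity P θ τ b n x

/-- The conditional law of the observed outcome `Y` given `Z = z` and `X = x` in the experiment of
size `n`. -/
noncomputable def outcomeLaw (n : ℕ) (z : Bool) (x : EuclideanSpace ℝ (Fin d)) : Measure ℝ :=
  condDistrib (fun ω => outcome τ b n 0 ω) (fun ω => (treat τ b n 0 ω, cov (ω 0).1))
    (sampleLaw P θ) (z, x)

/-- The outcome regression `μ_z(x) = 𝔼(Y ∣ Z = z, X = x)`. -/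
noncomputable def outcomeMean (n : ℕ) (z : Bool) (x : EuclideanSpace ℝ (Fin d)) : ℝ :=
  ∫ y, y ∂(outcomeLaw P θ τ b n z x)

/-- The conditional variance `Var(Y ∣ Z = z, X = x)`. -/
noncomputable def outcomeVar (n : ℕ) (z : Bool) (x : EuclideanSpace ℝ (Fin d)) : ℝ :=
  Var[id; outcomeLaw P θ τ b n z x]

/-- The doubly robust estimator of the average treatment effect from the first `n` units, with the
fitted outcome regressions `μhat false` and `μhat true`. -/
noncomputable def drEstimator (n : ℕ) (μhat : Bool → EuclideanSpace ℝ (Fin d) → ℝ)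
    (ω : ℕ → Obs d × Fin K) : ℝ :=
  (1 / (n : ℝ)) * ∑ i ∈ Finset.range n,
    let X := cov (ω i).1
    let Y := outcome τ b n i ω
    let Z : ℝ := if treat τ b n i ω then 1 else 0
    let e := propensity P θ τ b n X
    (μhat true X - μhat false X + Z / e * (Y - μhat true X)
      - (1 - Z) / (1 - e) * (Y - μhat false X))

/-- The integrand of the first term of the efficiency bound:
`Var(Y ∣ Z = 1, X = x) / π(x) + Var(Y ∣ Z = 0, X = x) / (1 - π(x))`. -/
noncomputable def weightedVar (m : ℕ) (x : EuclideanSpace ℝ (Fin d)) : ℝ :=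
  outcomeVar P θ τ b m true x / asympPropensity P θ τ b x
    + outcomeVar P θ τ b m false x / (1 - asympPropensity P θ τ b x)

/-- The conditional effect `μ_1(x) - μ_0(x)`. -/
noncomputable def condEffect (m : ℕ) (x : EuclideanSpace ℝ (Fin d)) : ℝ :=
  outcomeMean P θ τ b m true x - outcomeMean P θ τ b m false x

/-- The efficiency bound for independent and identically distributed data, evaluated at the
asymptotic propensity score; the conditional moments of `Y` given `(Z, X)` are those of the
experiment of size `m`. -/
noncomputable def efficiencyBound (m : ℕ) : ℝ :=
  (∫ x, weightedVar P θ τ b m x ∂(covLaw P)) + Var[condEffect P θ τ b m; covLaw P]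

end Model

end QueueDesign

open QueueDesign

set_option linter.unusedSectionVars false

/-! The statuses of the units are dependent, because everybody competes for the same slots. Two
facts tame this dependence.

First, statuses are functions of arrival times and queues only. Exogeneity together with
independence of `A` and `X` makes `A` independent of `(X, Y⁰, Y¹)` (`indepFun_arr_cov_pot`), and the
queue is drawn given `X`. Hence, given all arrival times and queues, the pairs of covariates and
potential outcomes are independent across units, each with a law that depends on its own queue only.
A function of one unit that is centred given its arrival time and queue is therefore orthogonal to
anything built from the arrivals, the queues and the other units (`integral_mul_centred_mul`). The
same fact shows that `π_n(x)` is a mixture `∑ θ_k(x) r_{n,k}` of treatment rates of queues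
(`propensity_ae_eq`), and that under positivity `Y` given `Z = z`, `X = x` has the law of `Y^z`
given `X = x`, whatever the size of the experiment (`outcomeLaw_eq_potLaw`).

Second, lower priority never disturbs higher priority, so the number treated in the first `k` queues
follows an autonomous recursion (`treatedCount_succ`). That recursion is nonexpansive in the arrival
counts, so their fluctuations of order `√n` pass to the treated counts without amplification
(`integral_sq_treatedCount_sub_le`). Its deterministic version, divided by `n`, converges under the
budget condition, and so do the rates `r_{n,k}` (`tendsto_queueRate`).

With `m_z(x) = 𝔼(Y^z ∣ X = x)`, the estimator minus the effect is `1/n` times the sum of two terms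
(`drEstimator_ae_eq`). The leading one consists of centred effects and weighted residuals `Y^z -
m_z(X)`, which are pairwise orthogonal; its second moment is exactly `n` times `leadingVar`. The
other one is `∑ (Z_i - π_n(X_i)) g(X_i)`, where `g` collects the errors of the fitted regressions.
To bound its second moment by a constant times `n ‖g‖²` (`integral_sq_sum_status_sub_score_le`), `Z
- π_n(X)` is split at the rate of the queue and `g` at its mean in the queue: one part is i.i.d. and
centred, one is orthogonal by the first fact, and one involves only the counts of treated units in
the queues, which concentrate by the second fact.

Since the fitted regressions are independent of the experiment, conditioning on them means holding
them fixed. Their consistency makes `‖g‖` small, and dominated convergence takes `leadingVar` to the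
bound. -/

namespace QueueDesign

/-! ### Combinatorics of the allocation rule -/

section Allocation

variable {K : ℕ}

lemma Precedes.trans {a : ℕ → ℝ} {q : ℕ → Fin K} {i j l : ℕ} (h : Precedes a q i j)
    (h' : Precedes a q j l) : Precedes a q i l := by
  unfold Precedes at *
  rcases h with h | ⟨h, h1 | ⟨h1, h2⟩⟩ <;> rcases h' with g | ⟨g, g1 | ⟨g1, g2⟩⟩
  · exact Or.inl (h.trans g)
  · exact Or.inl (g ▸ h)
  · exact Or.inl (g ▸ h)
  · exact Or.inl (h ▸ g)
  · exact Or.inr ⟨h.trans g, Or.inl (h1.trans g1)⟩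
  · exact Or.inr ⟨h.trans g, Or.inl (g1 ▸ h1)⟩
  · exact Or.inl (h ▸ g)
  · exact Or.inr ⟨h.trans g, Or.inl (h1 ▸ g1)⟩
  · exact Or.inr ⟨h.trans g, Or.inr ⟨h1.trans g1, h2.trans g2⟩⟩

lemma Precedes.irrefl (a : ℕ → ℝ) (q : ℕ → Fin K) (i : ℕ) : ¬ Precedes a q i i := by
  simp [Precedes]

lemma Precedes.total (a : ℕ → ℝ) (q : ℕ → Fin K) {i j : ℕ} (h : i ≠ j) :
    Precedes a q i j ∨ Precedes a q j i := by
  unfold Precedes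
  rcases lt_trichotomy (q i) (q j) with h1 | h1 | h1 <;>
  rcases lt_trichotomy (a i) (a j) with h2 | h2 | h2 <;>
  rcases lt_or_gt_of_ne h with h3 | h3 <;> simp [h1, h2, h3]

open Classical in
/-- In a finite set that is strictly and totally ordered by `r`, exactly `min c #L` elements have
fewer than `c` predecessors. -/
lemma card_filter_rank_lt {r : ℕ → ℕ → Prop} (h_trans : ∀ i j l, r i j → r j l → r i l)
    (h_irrefl : ∀ i, ¬ r i i) (h_total : ∀ i j, i ≠ j → r i j ∨ r j i) (L : Finset ℕ) (c : ℕ) :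
    (L.filter fun i => (L.filter fun j => r j i).card < c).card = min c L.card := by
  set rk : ℕ → ℕ := fun i => (L.filter fun j => r j i).card
  have h_lt : ∀ i ∈ L, ∀ j ∈ L, r i j → rk i < rk j := by
    intro i hi j hj hij
    apply Finset.card_lt_card
    rw [Finset.ssubset_iff_of_subset]
    · exact ⟨i, by simp [hi, hij], by simp [h_irrefl]⟩
    · intro l hl
      simp only [Finset.mem_filter] at hl ⊢
      exact ⟨hl.1, h_trans _ _ _ hl.2 hij⟩
  have h_inj : Set.InjOn rk L := by
    intro i hi j hj hij
    by_contra hne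
    rcases h_total i j hne with h | h
    · exact absurd hij (h_lt i hi j hj h).ne
    · exact absurd hij (h_lt j hj i hi h).ne'
  -- An injective map from `L` into the `#L` possible ranks attains each of them.
  have h_img : L.image rk = Finset.range L.card := by
    apply Finset.eq_of_subset_of_card_le
    · intro m hm
      obtain ⟨i, hi, rfl⟩ := Finset.mem_image.1 hm
      apply Finset.mem_range.2
      apply Finset.card_lt_card
      rw [Finset.ssubset_iff_of_subset (Finset.filter_subset _ _)]
      exact ⟨i, hi, by simp [h_irrefl]⟩
    · rw [Finset.card_image_of_injOn h_inj, Finset.card_range]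
  have h_inj' : Set.InjOn rk (L.filter fun i => rk i < c) := h_inj.mono fun x hx => (Finset.mem_filter.1 hx).1
  rw [← Finset.card_image_of_injOn h_inj']
  have : (L.filter fun i => rk i < c).image rk = (L.image rk).filter fun m => m < c := by
    ext m; simp only [Finset.mem_image, Finset.mem_filter]
    constructor
    · rintro ⟨i, ⟨hi, hc⟩, rfl⟩; exact ⟨⟨i, hi, rfl⟩, hc⟩
    · rintro ⟨⟨i, hi, rfl⟩, hc⟩; exact ⟨i, ⟨hi, hc⟩, rfl⟩
  rw [this, h_img]
  have : (Finset.range L.card).filter (fun m => m < c) = Finset.range (min c L.card) := by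
    ext m; simp [and_comm]
  rw [this, Finset.card_range]

lemma treatedBy_subset (n : ℕ) (c : ℕ → ℕ) (a : ℕ → ℝ) (q : ℕ → Fin K) (t : ℕ) {i : ℕ}
    (hi : i ∈ treatedBy n c a q t) : i < n ∧ a i ≤ t := by
  induction t with
  | zero => simp [treatedBy] at hi
  | succ t ih =>
    rcases Finset.mem_union.1 hi with h | h
    · refine ⟨(ih h).1, (ih h).2.trans ?_⟩
      push_cast; linarith
    · have := Finset.mem_filter.1 (Finset.mem_filter.1 h).1
      exact ⟨Finset.mem_range.1 this.1, this.2.1⟩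

open Classical in
/-- The number of units in the first `k` queues that have been treated by the end of period `t`. -/
noncomputable def treatedCount (n : ℕ) (c : ℕ → ℕ) (a : ℕ → ℝ) (q : ℕ → Fin K) (k t : ℕ) : ℕ :=
  ((treatedBy n c a q t).filter fun i => (q i : ℕ) < k).card

open Classical in
/-- The number of units in the first `k` queues that have arrived by time `t`. -/
noncomputable def arrivedCount (n : ℕ) (a : ℕ → ℝ) (q : ℕ → Fin K) (k t : ℕ) : ℕ :=
  ((Finset.range n).filter fun i => a i ≤ (t : ℝ) ∧ (q i : ℕ) < k).card

lemma treatedCount_zero (n : ℕ) (c : ℕ → ℕ) (a : ℕ → ℝ) (q : ℕ → Fin K) (k : ℕ) :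
    treatedCount n c a q k 0 = 0 := by
  simp [treatedCount, treatedBy]

/-- Units outside the first `k` queues precede none inside them, so the first `k` queues are served
as if the others did not exist: all of their waiting units are treated, or the whole budget of the
period goes to them. For a single queue there is no such recursion. -/
lemma treatedCount_succ (n : ℕ) (c : ℕ → ℕ) (a : ℕ → ℝ) (q : ℕ → Fin K) (k t : ℕ) :
    treatedCount n c a q k (t + 1)
      = min (arrivedCount n a q k (t + 1)) (treatedCount n c a q k t + c (t + 1)) := by
  classical
  set S := treatedBy n c a q t with hS
  set W := waiting n a (t + 1) S with hW
  set L := W.filter fun i => (q i : ℕ) < k with hL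
  have hSL : Disjoint (S.filter fun i => (q i : ℕ) < k) L := by
    rw [Finset.disjoint_left]
    intro i hi hi'
    simp only [hL, hW, waiting, Finset.mem_filter] at hi hi'
    exact hi'.1.2.2 hi.1
  have h_arr : arrivedCount n a q k (t + 1)
      = (S.filter fun i => (q i : ℕ) < k).card + L.card := by
    rw [← Finset.card_union_of_disjoint hSL, arrivedCount]
    congr 1
    ext i
    simp only [hL, hW, waiting, Finset.mem_union, Finset.mem_filter, Finset.mem_range]
    constructor
    · rintro ⟨h1, h2, h3⟩
      by_cases h : i ∈ S
      · exact Or.inl ⟨h, h3⟩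
      · exact Or.inr ⟨⟨h1, h2, h⟩, h3⟩
    · rintro (⟨h1, h3⟩ | ⟨⟨h1, h2, -⟩, h3⟩)
      · have := treatedBy_subset n c a q t h1
        refine ⟨this.1, this.2.trans ?_, h3⟩
        push_cast; linarith
      · exact ⟨h1, h2, h3⟩
  have h_new : treatedCount n c a q k (t + 1) = (S.filter fun i => (q i : ℕ) < k).card
      + (L.filter fun i => (L.filter fun j => Precedes a q j i).card < c (t + 1)).card := by
    rw [← Finset.card_union_of_disjoint, treatedCount]
    · congr 1
      ext i
      simp only [treatedBy, ← hS, ← hW, Finset.mem_union, Finset.mem_filter, hL]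
      -- A unit that precedes a member of the first `k` queues belongs to them too, so ranks
      -- computed in `W` and in `L` agree.
      have key : (q i : ℕ) < k → (W.filter fun j => Precedes a q j i)
          = ((W.filter fun i => (q i : ℕ) < k).filter fun j => Precedes a q j i) := by
        intro hk
        ext j
        simp only [Finset.mem_filter]
        constructor
        · rintro ⟨h1, h2⟩
          refine ⟨⟨h1, ?_⟩, h2⟩
          rcases h2 with h | ⟨h, -⟩
          · exact lt_trans (Fin.lt_def.1 h) hk
          · rw [h]; exact hk
        · rintro ⟨⟨h1, -⟩, h2⟩; exact ⟨h1, h2⟩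
      constructor
      · rintro ⟨h | h, hk⟩
        · exact Or.inl ⟨h, hk⟩
        · rw [key hk] at h
          exact Or.inr ⟨⟨h.1, hk⟩, h.2⟩
      · rintro (⟨h, hk⟩ | ⟨⟨h, hk⟩, h2⟩)
        · exact ⟨Or.inl h, hk⟩
        · rw [← key hk] at h2
          exact ⟨Or.inr ⟨h, h2⟩, hk⟩
    · exact hSL.mono_right (Finset.filter_subset _ _)
  have h_rank := card_filter_rank_lt (r := Precedes a q) (fun _ _ _ => Precedes.trans)
    (Precedes.irrefl a q) (fun i j => Precedes.total a q) L (c (t + 1))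
  rw [h_new, h_arr, h_rank]
  simp only [treatedCount, ← hS]
  omega

/-- The allocation does not depend on the numbering of the units when the arrival times are
distinct. -/
lemma mem_treatedBy_comp_perm (n : ℕ) (c : ℕ → ℕ) (a : ℕ → ℝ) (q : ℕ → Fin K)
    (σ : Equiv.Perm ℕ) (hσ : ∀ i, σ i < n ↔ i < n)
    (ha : ∀ i < n, ∀ j < n, a i = a j → i = j) (t i : ℕ) :
    i ∈ treatedBy n c (a ∘ σ) (q ∘ σ) t ↔ σ i ∈ treatedBy n c a q t := by
  classical
  induction t generalizing i with
  | zero => simp [treatedBy]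
  | succ t ih =>
    set S := treatedBy n c a q t with hS
    set S' := treatedBy n c (a ∘ σ) (q ∘ σ) t with hS'
    have hw : ∀ i, i ∈ waiting n (a ∘ σ) (t + 1) S' ↔ σ i ∈ waiting n a (t + 1) S := by
      intro i
      simp [waiting, hσ, ih]
    simp only [treatedBy, ← hS, ← hS', Finset.mem_union, ih, Finset.mem_filter, hw]
    refine or_congr Iff.rfl (and_congr_right fun hi => ?_)
    suffices h : ((waiting n (a ∘ σ) (t + 1) S').filter fun j =>
        Precedes (a ∘ σ) (q ∘ σ) j i).card
        = ((waiting n a (t + 1) S).filter fun j => Precedes a q j (σ i)).card by rw [h]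
    refine Finset.card_equiv σ fun j => ?_
    simp only [Finset.mem_filter, hw]
    refine and_congr_right fun hj => ?_
    have hin : σ i < n := by simp [waiting] at hi; exact hi.1
    have hjn : σ j < n := by simp [waiting] at hj; exact hj.1
    by_cases hij : j = i
    · simp [hij, Precedes.irrefl]
    -- Without ties the comparison of unit numbers, the only part of `Precedes` that `σ` does not
    -- respect, is never reached.
    · have : a (σ j) ≠ a (σ i) := fun h => hij (σ.injective (ha _ hjn _ hin h))
      simp [Precedes, this]

lemma measurableSet_mem_treatedBy (n : ℕ) (c : ℕ → ℕ) (t i : ℕ) :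
    MeasurableSet {u : ℕ → ℝ × Fin K |
      i ∈ treatedBy n c (fun j => (u j).1) (fun j => (u j).2) t} := by
  classical
  induction t generalizing i with
  | zero => simp [treatedBy]
  | succ t ih =>
    have hw : ∀ i, MeasurableSet {u : ℕ → ℝ × Fin K |
        i ∈ waiting n (fun j => (u j).1) (t + 1)
          (treatedBy n c (fun j => (u j).1) (fun j => (u j).2) t)} := by
      intro i
      simp only [waiting, Finset.mem_filter, Finset.mem_range]
      have h : MeasurableSet {u : ℕ → ℝ × Fin K | (u i).1 ≤ ((t + 1 : ℕ) : ℝ)} :=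
        measurableSet_le (by fun_prop) measurable_const
      exact (MeasurableSet.const _).inter (h.inter (ih i).compl)
    have hp : ∀ i j, MeasurableSet {u : ℕ → ℝ × Fin K |
        Precedes (fun j => (u j).1) (fun j => (u j).2) j i} := by
      intro i j
      unfold Precedes
      have hq : ∀ j, Measurable fun u : ℕ → ℝ × Fin K => (u j).2 := fun j => by fun_prop
      have ha : ∀ j, Measurable fun u : ℕ → ℝ × Fin K => (u j).1 := fun j => by fun_prop
      refine (measurableSet_lt (hq j) (hq i)).union
        ((measurableSet_eq_fun (hq j) (hq i)).inter
          ((measurableSet_lt (ha j) (ha i)).union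
            ((measurableSet_eq_fun (ha j) (ha i)).inter (MeasurableSet.const _))))
    simp only [treatedBy, Finset.mem_union, Finset.mem_filter]
    refine (ih i).union ((hw i).inter ?_)
    have hc : Measurable fun u : ℕ → ℝ × Fin K =>
        ∑ j ∈ Finset.range n, if (j ∈ waiting n (fun j => (u j).1) (t + 1)
          (treatedBy n c (fun j => (u j).1) (fun j => (u j).2) t)) ∧
          Precedes (fun j => (u j).1) (fun j => (u j).2) j i then 1 else 0 := by
      refine Finset.measurable_sum _ fun j _ => Measurable.ite ((hw j).inter (hp i j)) ?_ ?_ <;>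
        exact measurable_const
    have := measurableSet_lt hc (measurable_const (a := c (t + 1)))
    have h_card : ∀ u : ℕ → ℝ × Fin K, ((waiting n (fun j => (u j).1) (t + 1)
        (treatedBy n c (fun j => (u j).1) (fun j => (u j).2) t)).filter fun j =>
          Precedes (fun j => (u j).1) (fun j => (u j).2) j i).card
        = ∑ j ∈ Finset.range n, if (j ∈ waiting n (fun j => (u j).1) (t + 1)
          (treatedBy n c (fun j => (u j).1) (fun j => (u j).2) t)) ∧
          Precedes (fun j => (u j).1) (fun j => (u j).2) j i then 1 else 0 := by
      intro u
      rw [Finset.card_eq_sum_ones, ← Finset.sum_filter]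
      refine Finset.sum_congr ?_ fun _ _ => rfl
      ext j
      simp only [Finset.mem_filter, Finset.mem_range]
      refine ⟨fun h => ⟨?_, h⟩, fun h => h.2⟩
      exact Finset.mem_range.1 (Finset.mem_filter.1 h.1).1
    simp only [← h_card] at this
    exact this

end Allocation

/-! ### The fluid approximation -/

/-- The recursion that the numbers of treated units in the first queues follow: by the end of
period `t`, at most `N t` units can be treated, and the budget of the period is `c t`. -/
noncomputable def fluid (N c : ℕ → ℝ) : ℕ → ℝ
  | 0 => 0
  | t + 1 => min (N (t + 1)) (fluid N c t + c (t + 1))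

/-- The minimum is nonexpansive for the maximum norm and the common budget cancels, so each step
replaces the error by at most the larger of the old error and the new arrival error. Bounding the
square of a maximum by the sum of squares gives a form that can be integrated. -/
lemma fluid_sub_sq_le (N N' c : ℕ → ℝ) (t : ℕ) :
    (fluid N c t - fluid N' c t) ^ 2 ≤ ∑ s ∈ Finset.range t, (N (s + 1) - N' (s + 1)) ^ 2 := by
  induction t with
  | zero => simp [fluid]
  | succ t ih =>
    rw [Finset.sum_range_succ]
    have h1 : 0 ≤ ∑ s ∈ Finset.range t, (N (s + 1) - N' (s + 1)) ^ 2 :=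
      Finset.sum_nonneg fun _ _ => sq_nonneg _
    have h2 := abs_min_sub_min_le_max (N (t + 1)) (fluid N c t + c (t + 1)) (N' (t + 1))
      (fluid N' c t + c (t + 1))
    rw [add_sub_add_right_eq_sub] at h2
    simp only [fluid]
    rw [← sq_abs]
    rcases le_total |N (t + 1) - N' (t + 1)| |fluid N c t - fluid N' c t| with h | h
    · rw [max_eq_right h] at h2
      have := pow_le_pow_left₀ (abs_nonneg _) h2 2
      rw [sq_abs (fluid N c t - fluid N' c t)] at this
      nlinarith [sq_nonneg (N (t + 1) - N' (t + 1))]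
    · rw [max_eq_left h] at h2
      have := pow_le_pow_left₀ (abs_nonneg _) h2 2
      rw [sq_abs (N (t + 1) - N' (t + 1))] at this
      linarith

lemma treatedCount_eq_fluid {K : ℕ} (n : ℕ) (c : ℕ → ℕ) (a : ℕ → ℝ) (q : ℕ → Fin K) (k t : ℕ) :
    (treatedCount n c a q k t : ℝ)
      = fluid (fun s => (arrivedCount n a q k s : ℝ)) (fun s => (c s : ℝ)) t := by
  induction t with
  | zero => simp [treatedCount_zero, fluid]
  | succ t ih => rw [treatedCount_succ, fluid, ← ih]; push_cast; rfl

/-- With cumulative budgets asymptotic to `n β F`, the fluid with arrivals `n p F` serves the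
proportion `min p β` of the arrivals. -/
lemma tendsto_fluid_div (τ : ℕ) (F : ℕ → ℝ) (hF0 : F 0 = 0) (hF : Monotone F) (p β : ℝ)
    (c : ℕ → ℕ → ℝ)
    (hc : ∀ t ≤ τ, Tendsto (fun n : ℕ => (∑ s ∈ Finset.Icc 1 t, c n s) / n) atTop (𝓝 (β * F t)))
    (t : ℕ) (ht : t ≤ τ) :
    Tendsto (fun n : ℕ => fluid (fun s => n * (p * F s)) (c n) t / n) atTop
      (𝓝 (min p β * F t)) := by
  have hF0' : ∀ t, 0 ≤ F t := fun t => hF0 ▸ hF (Nat.zero_le t)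
  induction t with
  | zero => simp [fluid, hF0]
  | succ t ih =>
    have h1 := (hc (t + 1) ht).sub (hc t (by omega))
    have h2 : Tendsto (fun n : ℕ => c n (t + 1) / n) atTop (𝓝 (β * F (t + 1) - β * F t)) := by
      refine h1.congr fun n => ?_
      rw [Finset.sum_Icc_succ_top (by omega)]
      ring
    have h3 := (tendsto_const_nhds (x := p * F (t + 1))).min ((ih (by omega)).add h2)
    -- If `p ≤ β` the arrivals bind in every period, otherwise the budget does; the proportion
    -- served is therefore the same in all periods.
    have h4 : min (p * F (t + 1)) (min p β * F t + (β * F (t + 1) - β * F t))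
        = min p β * F (t + 1) := by
      have := hF (Nat.le_succ t)
      have h5 := hF0' t
      rcases le_total p β with h | h
      · rw [min_eq_left h, min_eq_left]
        nlinarith
      · rw [min_eq_right h, min_eq_right]
        · ring
        · nlinarith [hF0' (t + 1)]
    rw [h4] at h3
    refine h3.congr' ?_
    filter_upwards [eventually_gt_atTop 0] with n hn
    have hn' : (0 : ℝ) < n := by exact_mod_cast hn
    rw [fluid, ← min_div_div_right hn'.le, add_div, mul_div_cancel_left₀ _ hn'.ne']

/-! ### Products of copies of one law -/

section InfinitePi

variable {Ω : Type*} [MeasurableSpace Ω] (Q : Measure Ω) [IsProbabilityMeasure Q]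

/-- Resampling one coordinate preserves the law of an i.i.d. sequence. -/
lemma map_update_prod_infinitePi (i : ℕ) :
    (Q.prod (Measure.infinitePi fun _ : ℕ => Q)).map (fun z => Function.update z.2 i z.1)
      = Measure.infinitePi fun _ : ℕ => Q := by
  have hm : Measurable fun z : Ω × (ℕ → Ω) => Function.update z.2 i z.1 := by
    rw [measurable_pi_iff]
    intro j
    by_cases h : j = i
    · subst h; simpa using measurable_fst
    · simp only [Function.update_of_ne h]; fun_prop
  refine Measure.eq_infinitePi _ fun s t ht => ?_
  have hs : MeasurableSet (Set.pi (s : Set ℕ) t) :=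
    MeasurableSet.pi s.countable_toSet fun j _ => ht j
  rw [Measure.map_apply hm hs]
  by_cases hi : i ∈ s
  · have : (fun z : Ω × (ℕ → Ω) => Function.update z.2 i z.1) ⁻¹' (Set.pi s t)
        = t i ×ˢ (Set.pi (s.erase i) t) := by
      ext z
      simp only [Set.mem_preimage, Set.mem_pi, Set.mem_prod, Finset.mem_coe, Finset.mem_erase]
      constructor
      · intro h
        refine ⟨by simpa using h i hi, fun j hj => ?_⟩
        simpa [hj.1] using h j hj.2
      · rintro ⟨h1, h2⟩ j hj
        by_cases hji : j = i
        · subst hji; simpa using h1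
        · simpa [hji] using h2 j ⟨hji, hj⟩
    rw [this, Measure.prod_prod, Measure.infinitePi_pi _ fun j _ => ht j,
      Finset.mul_prod_erase s (fun j => Q (t j)) hi]
  · have : (fun z : Ω × (ℕ → Ω) => Function.update z.2 i z.1) ⁻¹' (Set.pi s t)
        = Set.univ ×ˢ (Set.pi s t) := by
      ext z
      simp only [Set.mem_preimage, Set.mem_pi, Set.mem_prod, Finset.mem_coe, Set.mem_univ, true_and]
      refine forall₂_congr fun j hj => ?_
      have : j ≠ i := fun h => hi (h ▸ hj)
      simp [this]
    rw [this, Measure.prod_prod, Measure.infinitePi_pi _ fun j _ => ht j]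
    simp

lemma measurePreserving_update_infinitePi (i : ℕ) :
    MeasurePreserving (fun z : Ω × (ℕ → Ω) => Function.update z.2 i z.1)
      (Q.prod (Measure.infinitePi fun _ : ℕ => Q)) (Measure.infinitePi fun _ : ℕ => Q) := by
  refine ⟨?_, map_update_prod_infinitePi Q i⟩
  rw [measurable_pi_iff]
  intro j
  by_cases h : j = i
  · subst h; simpa using measurable_fst
  · simp only [Function.update_of_ne h]; fun_prop

lemma integral_infinitePi_eq_integral_update {F : (ℕ → Ω) → ℝ} (i : ℕ)
    (hF : Integrable F (Measure.infinitePi fun _ : ℕ => Q)) :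
    ∫ ω, F ω ∂(Measure.infinitePi fun _ : ℕ => Q)
      = ∫ ω, ∫ y, F (Function.update ω i y) ∂Q ∂(Measure.infinitePi fun _ : ℕ => Q) := by
  have hp := measurePreserving_update_infinitePi Q i
  have h1 : ∫ ω, F ω ∂(Measure.infinitePi fun _ : ℕ => Q)
      = ∫ z, F (Function.update z.2 i z.1) ∂(Q.prod (Measure.infinitePi fun _ : ℕ => Q)) := by
    have hF' := hF.aestronglyMeasurable
    nth_rewrite 1 [← hp.map_eq] at hF' ⊢
    rw [integral_map hp.measurable.aemeasurable hF']
  rw [h1, integral_prod_symm]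
  exact hp.integrable_comp_of_integrable hF

/-- Fubini after resampling coordinate `i`. A non-integrable `F` has Bochner integral zero by
convention, which spares the orthogonality relations below any integrability conditions. -/
lemma integral_infinitePi_eq_zero {F : (ℕ → Ω) → ℝ} (i : ℕ)
    (hF : ∀ ω, ∫ y, F (Function.update ω i y) ∂Q = 0) :
    ∫ ω, F ω ∂(Measure.infinitePi fun _ : ℕ => Q) = 0 := by
  by_cases h : Integrable F (Measure.infinitePi fun _ : ℕ => Q)
  · rw [integral_infinitePi_eq_integral_update Q i h]
    simp [hF]
  · exact integral_undef h

lemma measurePreserving_comp_perm_infinitePi (σ : Equiv.Perm ℕ) :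
    MeasurePreserving (fun ω : ℕ → Ω => ω ∘ σ)
      (Measure.infinitePi fun _ : ℕ => Q) (Measure.infinitePi fun _ : ℕ => Q) := by
  have hm : Measurable (fun ω : ℕ → Ω => ω ∘ σ) := by
    rw [measurable_pi_iff]; intro j; exact measurable_pi_apply (σ j)
  exact ⟨hm, Measure.map_infinitePi_infinitePi_of_inj (P := fun _ : ℕ => Q) σ.injective⟩

/-- After resampling coordinate `i` with the others fixed, a tie asks `f` to hit a given value,
which is a null event. -/
lemma ae_infinitePi_ne {f : Ω → ℝ} (hf : Measurable f) (h : ∀ s, Q {y | f y = s} = 0) :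
    ∀ᵐ ω ∂(Measure.infinitePi fun _ : ℕ => Q), ∀ i j, f (ω i) = f (ω j) → i = j := by
  rw [ae_all_iff]; intro i
  rw [ae_all_iff]; intro j
  by_cases hij : i = j
  · simp [hij]
  have hs : MeasurableSet {ω : ℕ → Ω | f (ω i) = f (ω j)} :=
    measurableSet_eq_fun (hf.comp (measurable_pi_apply i)) (hf.comp (measurable_pi_apply j))
  have hp := measurePreserving_update_infinitePi Q i
  have h0 : (Measure.infinitePi fun _ : ℕ => Q) {ω : ℕ → Ω | f (ω i) = f (ω j)} = 0 := by
    rw [← hp.measure_preimage hs.nullMeasurableSet, Measure.prod_apply_symm (hp.measurable hs)]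
    rw [lintegral_eq_zero_iff']
    · refine Eventually.of_forall fun ω => ?_
      simp only [Set.preimage, Set.mem_ofPred_eq, Function.update_self,
        Function.update_of_ne (Ne.symm hij), Pi.zero_apply]
      exact h _
    · exact (measurable_measure_prodMk_right (hp.measurable hs)).aemeasurable
  have : ∀ᵐ ω ∂(Measure.infinitePi fun _ : ℕ => Q), ¬ f (ω i) = f (ω j) := by
    rw [ae_iff]; simpa using h0
  filter_upwards [this] with ω hω h'
  exact absurd h' hω

end InfinitePi

/-! ### Orthogonal families -/

lemma integral_comp_of_measurePreserving {α β : Type*} [MeasurableSpace α] [MeasurableSpace β]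
    {μ : Measure α} {ν : Measure β} {f : α → β} (hf : MeasurePreserving f μ ν) {g : β → ℝ}
    (hg : AEStronglyMeasurable g ν) : ∫ x, g (f x) ∂μ = ∫ y, g y ∂ν := by
  rw [← hf.map_eq] at hg
  rw [← integral_map hf.measurable.aemeasurable hg, hf.map_eq]

lemma integral_sq_sum_of_orthogonal {Ω ι : Type*} [MeasurableSpace Ω] {μ : Measure Ω}
    (s : Finset ι) (e : ι → Ω → ℝ) (he : ∀ i ∈ s, MemLp (e i) 2 μ)
    (h : ∀ i ∈ s, ∀ j ∈ s, i ≠ j → ∫ ω, e i ω * e j ω ∂μ = 0) :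
    ∫ ω, (∑ i ∈ s, e i ω) ^ 2 ∂μ = ∑ i ∈ s, ∫ ω, (e i ω) ^ 2 ∂μ := by
  have hint : ∀ i ∈ s, ∀ j ∈ s, Integrable (fun ω => e i ω * e j ω) μ :=
    fun i hi j hj => (he i hi).integrable_mul (he j hj)
  simp_rw [pow_two, Finset.sum_mul_sum]
  rw [integral_finsetSum _ fun i hi => integrable_finsetSum _ fun j hj => hint i hi j hj]
  refine Finset.sum_congr rfl fun i hi => ?_
  rw [integral_finsetSum _ fun j hj => hint i hi j hj,
    Finset.sum_eq_single i (fun j hj hij => h i hi j hj hij.symm) (fun h => absurd hi h)]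

/-! ### The law of a unit -/

section Unit

variable {d K : ℕ} {P : Measure (Obs d)}

lemma measurable_pot_apply (z : Bool) : Measurable fun o : Obs d => pot o z :=
  (measurable_pi_apply z).comp measurable_pot

lemma integral_cov {h : EuclideanSpace ℝ (Fin d) → ℝ} (hm : Measurable h) :
    ∫ x, h x ∂(covLaw P) = ∫ o, h (cov o) ∂P :=
  integral_map measurable_cov.aemeasurable hm.aestronglyMeasurable

lemma memLp_pot (hY : ∃ m : ℝ, ∫⁻ o, ENNReal.ofReal (pot o true ^ 2 + pot o false ^ 2) ∂P
      ≤ ENNReal.ofReal m) (z : Bool) : MemLp (fun o => pot o z) 2 P := by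
  obtain ⟨m, hm⟩ := hY
  rw [memLp_two_iff_integrable_sq (measurable_pot_apply z).aestronglyMeasurable]
  refine ⟨((measurable_pot_apply z).pow_const 2).aestronglyMeasurable, ?_⟩
  rw [hasFiniteIntegral_iff_ofReal (Eventually.of_forall fun o => sq_nonneg _)]
  refine lt_of_le_of_lt (lintegral_mono fun o => ENNReal.ofReal_le_ofReal ?_)
    (hm.trans_lt ENNReal.ofReal_lt_top)
  cases z
  · nlinarith [sq_nonneg (pot o true)]
  · nlinarith [sq_nonneg (pot o false)]

variable (θ : Kernel (EuclideanSpace ℝ (Fin d)) (Fin K))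

lemma measurable_queueProb (k : Fin K) :
    Measurable fun x : EuclideanSpace ℝ (Fin d) => (θ x).real {k} :=
  (θ.measurable_coe (measurableSet_singleton k)).ennreal_toReal

lemma queueProb_nonneg (k : Fin K) (x : EuclideanSpace ℝ (Fin d)) : 0 ≤ (θ x).real {k} :=
  measureReal_nonneg

variable [IsProbabilityMeasure P]

instance : IsProbabilityMeasure (covLaw P) := by
  unfold covLaw; exact Measure.isProbabilityMeasure_map measurable_cov.aemeasurable

/-- Arrivals that are exogenous and independent of the covariates are independent of the
covariates and the potential outcomes jointly. -/
lemma indepFun_arr_cov_pot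
    (h_exo : CondIndepFun (MeasurableSpace.comap cov inferInstance) measurable_cov.comap_le
      arr pot P)
    (h_indep : IndepFun arr cov P) :
    IndepFun (arr (d := d)) (fun o : Obs d => o.2) P := by
  have h1 : condDistrib arr (fun o => (cov o, pot o)) P
      =ᵐ[P.map fun o => (cov o, pot o)] (condDistrib arr cov P).prodMkRight _ :=
    (condIndepFun_iff_condDistrib_prod_ae_eq_prodMkRight measurable_arr measurable_pot
      measurable_cov).1 h_exo.symm
  have h2 : condDistrib arr cov P =ᵐ[P.map cov] Kernel.const _ (P.map arr) := by
    have : IsProbabilityMeasure (P.map (arr (d := d))) :=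
      Measure.isProbabilityMeasure_map measurable_arr.aemeasurable
    refine condDistrib_ae_eq_of_measure_eq_compProd _ measurable_arr.aemeasurable ?_
    rw [Measure.compProd_const]
    exact (indepFun_iff_map_prod_eq_prod_map_map measurable_cov.aemeasurable
      measurable_arr.aemeasurable).1 h_indep.symm
  -- Exogeneity removes the potential outcomes from the conditioning, independence then removes the
  -- covariates: what is left is the unconditional law of `A`.
  have h3 : condDistrib arr (fun o => (cov o, pot o)) P
      =ᵐ[P.map fun o => (cov o, pot o)] Kernel.const _ (P.map arr) := by
    have hq : Measure.QuasiMeasurePreserving Prod.fst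
        (P.map fun o : Obs d => (cov o, pot o)) (P.map cov) := by
      refine ⟨measurable_fst, ?_⟩
      rw [Measure.map_map measurable_fst (measurable_cov.prodMk measurable_pot)]
      exact Measure.AbsolutelyContinuous.rfl
    filter_upwards [h1, hq.ae_eq_comp h2] with y hy hy2
    rw [hy, Kernel.prodMkRight_apply]
    simpa using hy2
  have : IsProbabilityMeasure (P.map (arr (d := d))) :=
    Measure.isProbabilityMeasure_map measurable_arr.aemeasurable
  have h4 := (condDistrib_ae_eq_iff_measure_eq_compProd (μ := P)
    (fun o : Obs d => (cov o, pot o)) measurable_arr.aemeasurable _).1 h3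
  rw [Measure.compProd_const] at h4
  exact ((indepFun_iff_map_prod_eq_prod_map_map
    (measurable_cov.prodMk measurable_pot).aemeasurable measurable_arr.aemeasurable).2 h4).symm

variable [IsMarkovKernel θ]

lemma measurePreserving_fst_unitLaw :
    MeasurePreserving (Prod.fst : Obs d × Fin K → Obs d) (unitLaw P θ) P :=
  ⟨measurable_fst, by unfold unitLaw; exact Measure.fst_compProd _ _⟩

lemma queueProb_le_one (k : Fin K) (x : EuclideanSpace ℝ (Fin d)) : (θ x).real {k} ≤ 1 :=
  measureReal_le_one

lemma sum_queueProb (x : EuclideanSpace ℝ (Fin d)) : ∑ k, (θ x).real {k} = 1 := by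
  rw [sum_measureReal_singleton]; simp

variable {θ}

lemma integrable_queueProb_mul {f : Obs d → ℝ} (hf : Integrable f P) (k : Fin K) :
    Integrable (fun o => (θ (cov o)).real {k} * f o) P := by
  refine hf.bdd_mul (c := 1)
    ((measurable_queueProb θ k).comp measurable_cov).aestronglyMeasurable
    (Eventually.of_forall fun o => ?_)
  rw [Real.norm_of_nonneg (queueProb_nonneg θ k _)]
  exact queueProb_le_one θ k _

lemma integral_unitLaw {H : Obs d × Fin K → ℝ} (hH : Integrable H (unitLaw P θ)) :
    Integrable (fun o => ∑ k, (θ (cov o)).real {k} * H (o, k)) P ∧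
    ∫ y, H y ∂(unitLaw P θ) = ∫ o, ∑ k, (θ (cov o)).real {k} * H (o, k) ∂P := by
  unfold unitLaw at *
  have h1 : Integrable (fun o => ∫ k, H (o, k) ∂(θ.comap cov measurable_cov o)) P :=
    hH.integral_compProd
  rw [Measure.integral_compProd hH]
  have : ∀ o : Obs d, ∫ k, H (o, k) ∂(θ.comap cov measurable_cov o)
      = ∑ k, (θ (cov o)).real {k} * H (o, k) := by
    intro o
    rw [integral_fintype Integrable.of_finite]
    simp [Kernel.comap_apply]
  simp_rw [this] at h1 ⊢
  exact ⟨h1, trivial⟩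

/-! ### Functions centred given the arrival time and the queue -/

/-- A function of the data and the queue of a unit that has mean zero given its arrival time and
its queue. -/
def Centred (P : Measure (Obs d)) (θ : Kernel (EuclideanSpace ℝ (Fin d)) (Fin K))
    (ξ : Obs d × Fin K → ℝ) : Prop :=
  ∀ f : ℝ × Fin K → ℝ, Measurable f → (∃ C, ∀ u, |f u| ≤ C) →
    ∫ y, f (arr y.1, y.2) * ξ y ∂(unitLaw P θ) = 0

lemma integrable_of_queue {η : Fin K → EuclideanSpace ℝ (Fin d) × (Bool → ℝ) → ℝ}
    (hη : ∀ k, Integrable (fun o : Obs d => η k o.2) P) :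
    Integrable (fun y => η y.2 y.1.2) (unitLaw P θ) := by
  have : (fun y : Obs d × Fin K => η y.2 y.1.2)
      = fun y => ∑ k, Set.indicator {y : Obs d × Fin K | y.2 = k} (fun y => η k y.1.2) y := by
    funext y
    rw [Finset.sum_eq_single y.2]
    · simp
    · intro k _ hk; simp [Set.indicator, hk.symm]
    · simp
  rw [this]
  refine integrable_finsetSum _ fun k _ => Integrable.indicator ?_ ?_
  · exact (measurePreserving_fst_unitLaw θ).integrable_comp_of_integrable (hη k)
  · exact measurable_snd (measurableSet_singleton k)

/-- On queue `k` the integral against a test function is that of `f(A, k) · θ_k(X) η_k(X, Y)`. Since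
`A` is independent of `(X, Y)`, it factors, and the second factor vanishes by hypothesis. -/
lemma centred_of_queue (hA : IndepFun (arr (d := d)) (fun o : Obs d => o.2) P)
    {η : Fin K → EuclideanSpace ℝ (Fin d) × (Bool → ℝ) → ℝ}
    (hη : ∀ k, Integrable (fun o : Obs d => η k o.2) P)
    (h0 : ∀ k, ∫ o, (θ (cov o)).real {k} * η k o.2 ∂P = 0) :
    Centred P θ fun y => η y.2 y.1.2 := by
  rintro f hf ⟨C, hC⟩
  have hfm : Measurable fun y : Obs d × Fin K => f (arr y.1, y.2) :=
    hf.comp ((measurable_arr.comp measurable_fst).prodMk measurable_snd)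
  have hint : Integrable (fun y => f (arr y.1, y.2) * η y.2 y.1.2) (unitLaw P θ) :=
    (integrable_of_queue hη).bdd_mul (c := C) hfm.aestronglyMeasurable
      (Eventually.of_forall fun y => hC _)
  rw [(integral_unitLaw hint).2]
  have hfk : ∀ k, Measurable fun s => f (s, k) := fun k => hf.comp (by fun_prop)
  have hint' : ∀ k, Integrable (fun o : Obs d => f (arr o, k) * ((θ (cov o)).real {k} * η k o.2)) P :=
    fun k => (integrable_queueProb_mul (hη k) k).bdd_mul (c := C)
      ((hfk k).comp measurable_arr).aestronglyMeasurable (Eventually.of_forall fun y => hC _)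
  have : ∀ o : Obs d, ∑ k, (θ (cov o)).real {k} * (f (arr o, k) * η k o.2)
      = ∑ k, f (arr o, k) * ((θ (cov o)).real {k} * η k o.2) :=
    fun o => Finset.sum_congr rfl fun k _ => by ring
  simp_rw [this]
  rw [integral_finsetSum _ fun k _ => hint' k]
  refine Finset.sum_eq_zero fun k _ => ?_
  -- Integrability of `η k` is known only after composition with the projection. As `P` is the
  -- product of its marginals, a section at almost any arrival time is measurable for the law of
  -- `(X, Y)`.
  have hV : AEStronglyMeasurable (fun v : EuclideanSpace ℝ (Fin d) × (Bool → ℝ) =>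
      (θ v.1).real {k} * η k v) (P.map fun o : Obs d => o.2) := by
    refine AEStronglyMeasurable.mul
      ((measurable_queueProb θ k).comp measurable_fst).aestronglyMeasurable ?_
    have h3 := (hη k).aestronglyMeasurable
    have hprod := (indepFun_iff_map_prod_eq_prod_map_map measurable_arr.aemeasurable
      measurable_snd.aemeasurable).1 hA
    have hid : P = (P.map arr).prod (P.map fun o : Obs d => o.2) := by
      rw [← hprod]; exact (Measure.map_id).symm
    rw [hid] at h3
    have : IsProbabilityMeasure (P.map (arr (d := d))) :=
      Measure.isProbabilityMeasure_map measurable_arr.aemeasurable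
    have : IsProbabilityMeasure (P.map (fun o : Obs d => o.2)) :=
      Measure.isProbabilityMeasure_map measurable_snd.aemeasurable
    obtain ⟨s, hs⟩ := (h3.prodMk_left).exists
    exact hs
  have hind := (hA.comp₀ measurable_arr.aemeasurable measurable_snd.aemeasurable
    (φ := fun s => f (s, k)) (ψ := fun v => (θ v.1).real {k} * η k v)
    (hfk k).aemeasurable hV.aemeasurable)
  have := hind.integral_fun_mul_eq_mul_integral
    ((hfk k).comp measurable_arr).aestronglyMeasurable
    (integrable_queueProb_mul (hη k) k).aestronglyMeasurable
  simp only [Function.comp_apply] at this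
  refine Eq.trans this ?_
  have h00 := h0 k
  rw [show (∫ o : Obs d, (θ o.2.1).real {k} * η k o.2 ∂P) = 0 from h00, mul_zero]

/-! ### Conditional moments of the potential outcomes -/

/-- The conditional law of a potential outcome given the covariates. -/
noncomputable def potLaw (P : Measure (Obs d)) [IsProbabilityMeasure P] (z : Bool) :
    Kernel (EuclideanSpace ℝ (Fin d)) ℝ := condDistrib (fun o => pot o z) cov P

instance (z : Bool) : IsMarkovKernel (potLaw P z) := by unfold potLaw; infer_instance

/-- The regression function of a potential outcome. -/
noncomputable def potMean (P : Measure (Obs d)) [IsProbabilityMeasure P] (z : Bool)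
    (x : EuclideanSpace ℝ (Fin d)) : ℝ := ∫ y, y ∂(potLaw P z x)

/-- The conditional variance of a potential outcome. -/
noncomputable def potVar (P : Measure (Obs d)) [IsProbabilityMeasure P] (z : Bool)
    (x : EuclideanSpace ℝ (Fin d)) : ℝ := Var[id; potLaw P z x]

lemma measurable_potMean (z : Bool) : Measurable (potMean P z) := by
  have : StronglyMeasurable fun z : EuclideanSpace ℝ (Fin d) × ℝ => z.2 :=
    measurable_snd.stronglyMeasurable
  exact (this.integral_condDistrib (X := cov) (Y := fun o : Obs d => pot o z) (μ := P)).measurable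

lemma potVar_eq (z : Bool) (x : EuclideanSpace ℝ (Fin d)) :
    potVar P z x = ∫ y, (y - potMean P z x) ^ 2 ∂(potLaw P z x) := by
  unfold potVar
  rw [variance_eq_integral measurable_id.aemeasurable]
  rfl

lemma potVar_nonneg (z : Bool) (x : EuclideanSpace ℝ (Fin d)) : 0 ≤ potVar P z x :=
  variance_nonneg _ _

lemma measurable_potVar (z : Bool) : Measurable (potVar P z) := by
  have : StronglyMeasurable fun w : EuclideanSpace ℝ (Fin d) × ℝ => (w.2 - potMean P z w.1) ^ 2 :=
    ((measurable_snd.sub ((measurable_potMean z).comp measurable_fst)).pow_const 2).stronglyMeasurable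
  have h := (this.integral_condDistrib (X := cov) (Y := fun o : Obs d => pot o z) (μ := P)).measurable
  convert h using 2 with x
  exact potVar_eq z x

lemma covLaw_compProd_potLaw (z : Bool) :
    covLaw P ⊗ₘ potLaw P z = P.map fun o => (cov o, pot o z) :=
  compProd_map_condDistrib (measurable_pot_apply z).aemeasurable

lemma integral_cov_pot (z : Bool) {h : EuclideanSpace ℝ (Fin d) × ℝ → ℝ} (hm : Measurable h)
    (hi : Integrable (fun o => h (cov o, pot o z)) P) :
    Integrable (fun x => ∫ y, h (x, y) ∂(potLaw P z x)) (covLaw P) ∧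
    ∫ o, h (cov o, pot o z) ∂P = ∫ x, ∫ y, h (x, y) ∂(potLaw P z x) ∂(covLaw P) := by
  have hp : Measurable fun o : Obs d => (cov o, pot o z) :=
    measurable_cov.prodMk (measurable_pot_apply z)
  have hi' : Integrable h (covLaw P ⊗ₘ potLaw P z) := by
    rw [covLaw_compProd_potLaw, integrable_map_measure hm.aestronglyMeasurable hp.aemeasurable]
    exact hi
  refine ⟨hi'.integral_compProd, ?_⟩
  rw [← Measure.integral_compProd hi', covLaw_compProd_potLaw,
    integral_map hp.aemeasurable hm.aestronglyMeasurable]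

lemma memLp_potMean {z : Bool} (hz : MemLp (fun o => pot o z) 2 P) :
    MemLp (potMean P z) 2 (covLaw P) := by
  have h1 := condExp_ae_eq_integral_condDistrib' (X := cov) measurable_cov
    (hz.integrable (by norm_num))
  have h2 : MemLp (P[fun o => pot o z | MeasurableSpace.comap cov inferInstance]) 2 P :=
    hz.condExp one_le_two
  unfold covLaw
  rw [memLp_map_measure_iff (measurable_potMean z).aestronglyMeasurable measurable_cov.aemeasurable]
  exact (memLp_congr_ae h1).1 h2

lemma memLp_residual {z : Bool} (hz : MemLp (fun o => pot o z) 2 P) :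
    MemLp (fun o => pot o z - potMean P z (cov o)) 2 P :=
  hz.sub ((memLp_map_measure_iff (measurable_potMean z).aestronglyMeasurable
    measurable_cov.aemeasurable).1 (memLp_potMean hz))

lemma ae_integrable_potLaw {z : Bool} (hz : MemLp (fun o => pot o z) 2 P) :
    ∀ᵐ x ∂(covLaw P), Integrable (fun y => y) (potLaw P z x) := by
  have hi : Integrable (fun w : EuclideanSpace ℝ (Fin d) × ℝ => w.2) (covLaw P ⊗ₘ potLaw P z) := by
    rw [covLaw_compProd_potLaw, integrable_map_measure measurable_snd.aestronglyMeasurable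
      (measurable_cov.prodMk (measurable_pot_apply z)).aemeasurable]
    exact hz.integrable (by norm_num)
  exact hi.ae_of_compProd

/-- Given `X` the residual has mean zero. No bound on `f` is needed, a non-integrable product having
integral zero by convention. -/
lemma integral_mul_residual {z : Bool} (hz : MemLp (fun o => pot o z) 2 P)
    {f : EuclideanSpace ℝ (Fin d) → ℝ} (hf : Measurable f) :
    ∫ o, f (cov o) * (pot o z - potMean P z (cov o)) ∂P = 0 := by
  by_cases hi : Integrable (fun o => f (cov o) * (pot o z - potMean P z (cov o))) P
  · have hm : Measurable fun w : EuclideanSpace ℝ (Fin d) × ℝ => f w.1 * (w.2 - potMean P z w.1) :=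
      (hf.comp measurable_fst).mul
        (measurable_snd.sub ((measurable_potMean z).comp measurable_fst))
    rw [(integral_cov_pot z hm hi).2]
    refine integral_eq_zero_of_ae ?_
    filter_upwards [ae_integrable_potLaw hz] with x hx
    simp only [Pi.zero_apply]
    rw [integral_const_mul, integral_sub hx (integrable_const _)]
    simp [potMean]
  · exact integral_undef hi

lemma integrable_potVar {z : Bool} (hz : MemLp (fun o => pot o z) 2 P) :
    Integrable (potVar P z) (covLaw P) := by
  have hm : Measurable fun w : EuclideanSpace ℝ (Fin d) × ℝ => (w.2 - potMean P z w.1) ^ 2 :=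
    (measurable_snd.sub ((measurable_potMean z).comp measurable_fst)).pow_const 2
  have h := (integral_cov_pot z hm (memLp_residual hz).integrable_sq).1
  simp_rw [← potVar_eq] at h
  exact h

lemma integral_mul_residual_sq {z : Bool} (hz : MemLp (fun o => pot o z) 2 P)
    {f : EuclideanSpace ℝ (Fin d) → ℝ} (hf : Measurable f) {C : ℝ} (hC : ∀ᵐ x ∂(covLaw P), |f x| ≤ C) :
    ∫ o, f (cov o) * (pot o z - potMean P z (cov o)) ^ 2 ∂P
      = ∫ x, f x * potVar P z x ∂(covLaw P) := by
  have hm : Measurable fun w : EuclideanSpace ℝ (Fin d) × ℝ =>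
      f w.1 * (w.2 - potMean P z w.1) ^ 2 :=
    (hf.comp measurable_fst).mul
      ((measurable_snd.sub ((measurable_potMean z).comp measurable_fst)).pow_const 2)
  have h := (integral_cov_pot z hm ((memLp_residual hz).integrable_sq.bdd_mul (c := C)
    (hf.comp measurable_cov).aestronglyMeasurable
    (ae_of_ae_map measurable_cov.aemeasurable hC))).2
  simp only at h
  rw [h]
  refine integral_congr_ae (Eventually.of_forall fun x => ?_)
  simp only
  rw [integral_const_mul, ← potVar_eq]

end Unit

/-! ### Treatment status and its dependence on arrivals and queues -/

section Status

variable {d K : ℕ}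

/-- The arrival times and queues of all units. -/
def arrivals (ω : ℕ → Obs d × Fin K) : ℕ → ℝ × Fin K := fun j => (arr (ω j).1, (ω j).2)

open Classical in
/-- The indicator that unit `i` has status `z` at the end of the experiment, as a function of the
arrival times and the queues. -/
noncomputable def status (τ : ℕ) (b : ℕ → ℕ → ℕ) (n : ℕ) (z : Bool) (i : ℕ)
    (u : ℕ → ℝ × Fin K) : ℝ :=
  if decide (i ∈ treatedBy n (b n) (fun j => (u j).1) (fun j => (u j).2) τ) = z then 1 else 0

lemma status_arrivals (τ : ℕ) (b : ℕ → ℕ → ℕ) (n : ℕ) (z : Bool) (i : ℕ)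
    (ω : ℕ → Obs d × Fin K) :
    status τ b n z i (arrivals ω) = if treat τ b n i ω = z then 1 else 0 := rfl

lemma measurable_decide_mem_treatedBy (τ : ℕ) (b : ℕ → ℕ → ℕ) (n i : ℕ) :
    open Classical in Measurable fun u : ℕ → ℝ × Fin K =>
      decide (i ∈ treatedBy n (b n) (fun j => (u j).1) (fun j => (u j).2) τ) := by
  classical
  refine measurable_to_bool ?_
  have := measurableSet_mem_treatedBy (K := K) n (b n) τ i
  convert this using 1
  ext u
  simp

lemma measurable_status (τ : ℕ) (b : ℕ → ℕ → ℕ) (n : ℕ) (z : Bool) (i : ℕ) :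
    Measurable (status (K := K) τ b n z i) :=
  Measurable.ite (measurable_decide_mem_treatedBy τ b n i (measurableSet_singleton z))
    measurable_const measurable_const

lemma measurable_arrivals : Measurable (arrivals (d := d) (K := K)) := by
  rw [measurable_pi_iff]
  intro j
  exact (measurable_arr.comp (measurable_fst.comp (measurable_pi_apply j))).prodMk
    (measurable_snd.comp (measurable_pi_apply j))

lemma measurable_treat (τ : ℕ) (b : ℕ → ℕ → ℕ) (n i : ℕ) :
    Measurable (treat (d := d) (K := K) τ b n i) :=
  (measurable_decide_mem_treatedBy τ b n i).comp measurable_arrivals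

lemma status_nonneg (τ : ℕ) (b : ℕ → ℕ → ℕ) (n : ℕ) (z : Bool) (i : ℕ) (u : ℕ → ℝ × Fin K) :
    0 ≤ status τ b n z i u := by
  unfold status; split_ifs <;> norm_num

lemma status_le_one (τ : ℕ) (b : ℕ → ℕ → ℕ) (n : ℕ) (z : Bool) (i : ℕ) (u : ℕ → ℝ × Fin K) :
    status τ b n z i u ≤ 1 := by
  unfold status; split_ifs <;> norm_num

lemma abs_status_le_one (τ : ℕ) (b : ℕ → ℕ → ℕ) (n : ℕ) (z : Bool) (i : ℕ)
    (u : ℕ → ℝ × Fin K) : |status τ b n z i u| ≤ 1 := by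
  rw [abs_of_nonneg (status_nonneg ..)]; exact status_le_one ..

lemma status_false (τ : ℕ) (b : ℕ → ℕ → ℕ) (n i : ℕ) (u : ℕ → ℝ × Fin K) :
    status τ b n false i u = 1 - status τ b n true i u := by
  classical
  unfold status
  cases decide (i ∈ treatedBy n (b n) (fun j => (u j).1) (fun j => (u j).2) τ) <;> simp

lemma status_mul_self (τ : ℕ) (b : ℕ → ℕ → ℕ) (n : ℕ) (z : Bool) (i : ℕ)
    (u : ℕ → ℝ × Fin K) : status τ b n z i u * status τ b n z i u = status τ b n z i u := by
  unfold status; split_ifs <;> norm_num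

lemma status_mul_status_of_ne (τ : ℕ) (b : ℕ → ℕ → ℕ) (n : ℕ) {z z' : Bool} (h : z ≠ z') (i : ℕ)
    (u : ℕ → ℝ × Fin K) : status τ b n z i u * status τ b n z' i u = 0 := by
  have h1 := status_mul_self τ b n true i u
  cases z <;> cases z' <;> first | exact absurd rfl h | (rw [status_false]; linarith)

lemma arrivals_update (ω : ℕ → Obs d × Fin K) (i : ℕ) (y : Obs d × Fin K) :
    arrivals (Function.update ω i y) = Function.update (arrivals ω) i (arr y.1, y.2) := by
  funext j
  by_cases h : j = i
  · subst h; simp [arrivals]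
  · simp [arrivals, h]

end Status

/-! ### The i.i.d. sample: resampling one unit and exchangeability -/

section Sample

variable {d K : ℕ} {P : Measure (Obs d)} [IsProbabilityMeasure P]
  {θ : Kernel (EuclideanSpace ℝ (Fin d)) (Fin K)} [IsMarkovKernel θ]

lemma measurePreserving_eval_sampleLaw (i : ℕ) :
    MeasurePreserving (fun ω : ℕ → Obs d × Fin K => ω i) (sampleLaw P θ) (unitLaw P θ) := by
  unfold sampleLaw
  exact measurePreserving_eval_infinitePi (fun _ : ℕ => unitLaw P θ) i

lemma measurePreserving_obs_sampleLaw (i : ℕ) :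
    MeasurePreserving (fun ω : ℕ → Obs d × Fin K => (ω i).1) (sampleLaw P θ) P :=
  (measurePreserving_fst_unitLaw θ).comp (measurePreserving_eval_sampleLaw i)

lemma measurePreserving_cov_sampleLaw (i : ℕ) :
    MeasurePreserving (fun ω : ℕ → Obs d × Fin K => cov (ω i).1) (sampleLaw P θ) (covLaw P) :=
  (MeasurePreserving.mk (μb := covLaw P) measurable_cov rfl).comp
    (measurePreserving_obs_sampleLaw i)

/-- A function of the data of unit `i` that is centred given its arrival time and queue is
orthogonal to all functions of the arrivals and of the data of the other units. -/
lemma integral_mul_centred_mul {c : (ℕ → ℝ × Fin K) → ℝ} (hc : Measurable c)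
    (hb : ∃ C, ∀ u, |c u| ≤ C) {ξ : Obs d × Fin K → ℝ} (hξ : Centred P θ ξ) (i : ℕ)
    {H : (ℕ → Obs d × Fin K) → ℝ} (hH : ∀ ω y, H (Function.update ω i y) = H ω) :
    ∫ ω, c (arrivals ω) * ξ (ω i) * H ω ∂(sampleLaw P θ) = 0 := by
  obtain ⟨C, hC⟩ := hb
  -- With the other units fixed, `c` is a bounded function of the arrival time and queue of unit `i`
  -- alone, and `H` is a constant.
  refine integral_infinitePi_eq_zero (unitLaw P θ) i fun ω => ?_
  simp only [arrivals_update, Function.update_self, hH]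
  rw [integral_mul_const]
  rw [hξ (fun u => c (Function.update (arrivals ω) i u))
    (hc.comp (measurable_update (arrivals ω))) ⟨C, fun u => hC _⟩, zero_mul]

lemma integral_mul_centred {c : (ℕ → ℝ × Fin K) → ℝ} (hc : Measurable c)
    (hb : ∃ C, ∀ u, |c u| ≤ C) {ξ : Obs d × Fin K → ℝ} (hξ : Centred P θ ξ) (i : ℕ) :
    ∫ ω, c (arrivals ω) * ξ (ω i) ∂(sampleLaw P θ) = 0 := by
  simpa using integral_mul_centred_mul hc hb hξ i (H := fun _ => 1) (fun _ _ => rfl)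

/-- The units are exchangeable. -/
lemma integral_status_exchange (hA_cont : ∀ s : ℝ, P {o | arr o = s} = 0) (τ : ℕ)
    (b : ℕ → ℕ → ℕ) {n i : ℕ} (hi : i < n) (z : Bool) (G : Obs d × Fin K → ℝ) :
    ∫ ω, status τ b n z i (arrivals ω) * G (ω i) ∂(sampleLaw P θ)
      = ∫ ω, status τ b n z 0 (arrivals ω) * G (ω 0) ∂(sampleLaw P θ) := by
  classical
  -- The swap preserves the sampling law and the set of the first `n` units. Ties in the arrival
  -- times are almost surely absent, so it carries the status of unit `i` to unit `0`.
  set σ : Equiv.Perm ℕ := Equiv.swap 0 i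
  have hσ : ∀ j, σ j < n ↔ j < n := by
    intro j
    simp only [σ, Equiv.swap_apply_def]
    split_ifs <;> omega
  have hp : MeasurePreserving (fun ω : ℕ → Obs d × Fin K => ω ∘ σ) (sampleLaw P θ)
      (sampleLaw P θ) := measurePreserving_comp_perm_infinitePi (unitLaw P θ) σ
  have hinv : Function.Involutive (fun ω : ℕ → Obs d × Fin K => ω ∘ σ) := by
    intro ω; funext j; simp [σ]
  have hemb : MeasurableEmbedding (fun ω : ℕ → Obs d × Fin K => ω ∘ σ) :=
    (MeasurableEquiv.ofInvolutive _ hinv hp.measurable).measurableEmbedding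
  refine Eq.trans ?_ (hp.integral_comp hemb fun ω => status τ b n z 0 (arrivals ω) * G (ω 0))
  refine integral_congr_ae ?_
  have hne : ∀ᵐ ω ∂(sampleLaw P θ), ∀ i j, arr (ω i).1 = arr (ω j).1 → i = j := by
    refine ae_infinitePi_ne (unitLaw P θ) (f := fun y => arr y.1)
      (measurable_arr.comp measurable_fst) fun s => ?_
    have := (measurePreserving_fst_unitLaw (P := P) θ).measure_preimage
      (measurable_arr (measurableSet_singleton s)).nullMeasurableSet
    exact this.trans (hA_cont s)
  filter_upwards [hne] with ω hω
  have h1 := mem_treatedBy_comp_perm n (b n) (fun j => arr (ω j).1) (fun j => (ω j).2) σ hσ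
    (fun i _ j _ h => hω i j h) τ 0
  have h2 : σ 0 = i := by simp [σ]
  rw [h2] at h1
  have h3 : status τ b n z 0 (arrivals (ω ∘ σ)) = status τ b n z i (arrivals ω) := by
    unfold status
    congr 2
    exact decide_eq_decide.2 h1
  simp only [h3, Function.comp_apply, h2]

/-! ### Means and treatment rates within queues, and the mixture they form -/

variable (P θ) in
/-- The probability of queue `k`. -/
noncomputable def queueProb (k : Fin K) : ℝ := ∫ x, (θ x).real {k} ∂(covLaw P)

lemma queueProb_eq (k : Fin K) : queueProb P θ k = ∫ o, (θ (cov o)).real {k} ∂P :=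
  integral_cov (measurable_queueProb θ k)

variable (P θ) in
/-- The mean, given that a unit is in queue `k`, of a function of its covariates and potential
outcomes. -/
noncomputable def queueMean (G : EuclideanSpace ℝ (Fin d) × (Bool → ℝ) → ℝ) (k : Fin K) : ℝ :=
  (∫ o, (θ (cov o)).real {k} * G o.2 ∂P) / queueProb P θ k

/-- Queues of probability zero are covered: the quotient is then zero by convention, and `θ_k(X) =
0` almost surely. -/
lemma queueMean_mul_queueProb (G : EuclideanSpace ℝ (Fin d) × (Bool → ℝ) → ℝ) (k : Fin K) :
    queueMean P θ G k * queueProb P θ k = ∫ o, (θ (cov o)).real {k} * G o.2 ∂P := by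
  by_cases h : queueProb P θ k = 0
  · rw [h, mul_zero]
    rw [queueProb_eq, integral_eq_zero_iff_of_nonneg (fun o => queueProb_nonneg θ k _)] at h
    · symm
      refine integral_eq_zero_of_ae ?_
      filter_upwards [h] with o ho
      simp only [Pi.zero_apply] at ho ⊢
      rw [ho, zero_mul]
    · simpa using integrable_queueProb_mul (θ := θ) (integrable_const (μ := P) (1 : ℝ)) k
  · exact div_mul_cancel₀ _ h

/-- Centring at the mean of the queue. -/
lemma centred_sub_queueMean (hA : IndepFun (arr (d := d)) (fun o : Obs d => o.2) P)
    {G : EuclideanSpace ℝ (Fin d) × (Bool → ℝ) → ℝ} (hG : Integrable (fun o : Obs d => G o.2) P) :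
    Centred P θ fun y => G y.1.2 - queueMean P θ G y.2 := by
  refine centred_of_queue hA (η := fun k v => G v - queueMean P θ G k)
    (fun k => hG.sub (integrable_const _)) fun k => ?_
  simp_rw [mul_sub]
  rw [integral_sub (integrable_queueProb_mul hG k)
    (integrable_queueProb_mul (integrable_const _) k), integral_mul_const, ← queueProb_eq,
    ← queueMean_mul_queueProb]
  ring

variable (P θ) in
/-- The probability of treatment given that a unit is in queue `k`. -/
noncomputable def queueRate (τ : ℕ) (b : ℕ → ℕ → ℕ) (n : ℕ) (k : Fin K) : ℝ :=
  (∫ ω, status τ b n true 0 (arrivals ω) * (if (ω 0).2 = k then 1 else 0) ∂(sampleLaw P θ))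
    / queueProb P θ k

variable (P θ) in
/-- The propensity score, as a mixture of the probabilities of treatment in the queues. -/
noncomputable def queueScore (τ : ℕ) (b : ℕ → ℕ → ℕ) (n : ℕ) (x : EuclideanSpace ℝ (Fin d)) : ℝ :=
  ∑ k, (θ x).real {k} * queueRate P θ τ b n k

lemma measurable_queueScore (τ : ℕ) (b : ℕ → ℕ → ℕ) (n : ℕ) :
    Measurable (queueScore P θ τ b n) :=
  Finset.measurable_sum _ fun k _ => (measurable_queueProb θ k).mul_const _

lemma measurable_queueIndicator (i : ℕ) (k : Fin K) :
    Measurable fun u : ℕ → ℝ × Fin K => if (u i).2 = k then (1 : ℝ) else 0 :=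
  Measurable.ite ((measurable_snd.comp (measurable_pi_apply i)) (measurableSet_singleton k))
    measurable_const measurable_const

lemma integrable_bounded_arrivals {c : (ℕ → ℝ × Fin K) → ℝ} (hc : Measurable c)
    (hb : ∃ C, ∀ u, |c u| ≤ C) : Integrable (fun ω => c (arrivals ω)) (sampleLaw P θ) := by
  obtain ⟨C, hC⟩ := hb
  exact Integrable.of_bound (hc.comp measurable_arrivals).aestronglyMeasurable C
    (Eventually.of_forall fun ω => hC _)

lemma integral_queueIndicator (i : ℕ) (k : Fin K) :
    ∫ ω, (if (ω i).2 = k then (1 : ℝ) else 0) ∂(sampleLaw P θ) = queueProb P θ k := by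
  have hm : Measurable fun y : Obs d × Fin K => if y.2 = k then (1 : ℝ) else 0 :=
    Measurable.ite (measurable_snd (measurableSet_singleton k)) measurable_const measurable_const
  have h1 : ∫ ω, (if (ω i).2 = k then (1 : ℝ) else 0) ∂(sampleLaw P θ)
      = ∫ y, (if y.2 = k then (1 : ℝ) else 0) ∂(unitLaw P θ) :=
    integral_comp_of_measurePreserving (measurePreserving_eval_sampleLaw i)
      hm.aestronglyMeasurable
  rw [h1, (integral_unitLaw (Integrable.of_bound hm.aestronglyMeasurable 1
    (Eventually.of_forall fun y => by split_ifs <;> simp))).2, queueProb_eq]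
  simp

/-- For a null queue both sides vanish, the indicator on the right being almost surely zero. -/
lemma queueRate_mul_queueProb (τ : ℕ) (b : ℕ → ℕ → ℕ) (n : ℕ) (k : Fin K) :
    queueRate P θ τ b n k * queueProb P θ k
      = ∫ ω, status τ b n true 0 (arrivals ω) * (if (ω 0).2 = k then 1 else 0)
          ∂(sampleLaw P θ) := by
  by_cases h : queueProb P θ k = 0
  · rw [h, mul_zero]
    have h1 := integral_queueIndicator (P := P) (θ := θ) 0 k
    rw [h, integral_eq_zero_iff_of_nonneg (fun ω => by positivity)] at h1
    · symm
      refine integral_eq_zero_of_ae ?_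
      filter_upwards [h1] with ω hω
      simp only [Pi.zero_apply] at hω ⊢
      rw [hω, mul_zero]
    · exact integrable_bounded_arrivals (measurable_queueIndicator 0 k)
        ⟨1, fun u => by split_ifs <;> simp⟩
  · exact div_mul_cancel₀ _ h

lemma queueRate_nonneg (τ : ℕ) (b : ℕ → ℕ → ℕ) (n : ℕ) (k : Fin K) :
    0 ≤ queueRate P θ τ b n k := by
  refine div_nonneg (integral_nonneg fun ω => mul_nonneg (status_nonneg ..) (by positivity))
    (integral_nonneg fun x => queueProb_nonneg θ k x)

lemma queueRate_le_one (τ : ℕ) (b : ℕ → ℕ → ℕ) (n : ℕ) (k : Fin K) :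
    queueRate P θ τ b n k ≤ 1 := by
  refine div_le_one_of_le₀ ?_ (integral_nonneg fun x => queueProb_nonneg θ k x)
  rw [← integral_queueIndicator (P := P) (θ := θ) 0 k]
  have hi : Integrable (fun ω => if (ω 0).2 = k then (1 : ℝ) else 0) (sampleLaw P θ) :=
    integrable_bounded_arrivals (measurable_queueIndicator 0 k)
        ⟨1, fun u => by split_ifs <;> simp⟩
  refine integral_mono_of_nonneg
    (Eventually.of_forall fun ω => mul_nonneg (status_nonneg ..) (by positivity)) hi
    (Eventually.of_forall fun ω => mul_le_of_le_one_left (by positivity) (status_le_one ..))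

lemma queueScore_nonneg (τ : ℕ) (b : ℕ → ℕ → ℕ) (n : ℕ) (x : EuclideanSpace ℝ (Fin d)) :
    0 ≤ queueScore P θ τ b n x :=
  Finset.sum_nonneg fun k _ => mul_nonneg (queueProb_nonneg θ k x) (queueRate_nonneg τ b n k)

lemma queueScore_le_one (τ : ℕ) (b : ℕ → ℕ → ℕ) (n : ℕ) (x : EuclideanSpace ℝ (Fin d)) :
    queueScore P θ τ b n x ≤ 1 := by
  rw [← sum_queueProb θ x]
  exact Finset.sum_le_sum fun k _ =>
    mul_le_of_le_one_right (queueProb_nonneg θ k x) (queueRate_le_one τ b n k)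

lemma integrable_bounded_mul {c : (ℕ → ℝ × Fin K) → ℝ} (hc : Measurable c)
    (hb : ∃ C, ∀ u, |c u| ≤ C) {H : (ℕ → Obs d × Fin K) → ℝ} (hH : Integrable H (sampleLaw P θ)) :
    Integrable (fun ω => c (arrivals ω) * H ω) (sampleLaw P θ) := by
  obtain ⟨C, hC⟩ := hb
  exact hH.bdd_mul (c := C) (hc.comp measurable_arrivals).aestronglyMeasurable
    (Eventually.of_forall fun ω => hC _)

lemma sum_queue_indicator_mul (k : Fin K) (h : Fin K → ℝ) :
    ∑ l, h l * (if k = l then 1 else 0) = h k := by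
  simp

/-- Given its covariates and potential outcomes, the first unit is treated with probability
`queueScore`. -/
lemma integral_status_mul (hA : IndepFun (arr (d := d)) (fun o : Obs d => o.2) P) (τ : ℕ)
    (b : ℕ → ℕ → ℕ) (n : ℕ) {G : EuclideanSpace ℝ (Fin d) × (Bool → ℝ) → ℝ}
    (hG : Integrable (fun o : Obs d => G o.2) P) :
    ∫ ω, status τ b n true 0 (arrivals ω) * G (ω 0).1.2 ∂(sampleLaw P θ)
      = ∫ o, queueScore P θ τ b n (cov o) * G o.2 ∂P := by
  set S := status (K := K) τ b n true 0
  have hS : Measurable S := measurable_status ..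
  have hSb : ∃ C, ∀ u, |S u| ≤ C := ⟨1, abs_status_le_one τ b n true 0⟩
  have hGω : Integrable (fun ω : ℕ → Obs d × Fin K => G (ω 0).1.2) (sampleLaw P θ) :=
    (measurePreserving_obs_sampleLaw 0).integrable_comp_of_integrable hG
  have hind : ∀ k, Integrable
      (fun ω : ℕ → Obs d × Fin K => if (ω 0).2 = k then (1 : ℝ) else 0) (sampleLaw P θ) :=
    fun k => integrable_bounded_arrivals (measurable_queueIndicator 0 k)
      ⟨1, fun u => by split_ifs <;> simp⟩
  have hq : Integrable (fun ω : ℕ → Obs d × Fin K => queueMean P θ G (ω 0).2) (sampleLaw P θ) := by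
    have := integrable_finsetSum Finset.univ fun k _ => (hind k).const_mul (queueMean P θ G k)
    simpa using this
  -- The status depends on arrivals and queues only, so `G` may be replaced by its mean in the queue
  -- of the unit; the rest is a finite sum over queues.
  have h0 := integral_mul_centred (θ := θ) hS hSb (centred_sub_queueMean hA hG) 0
  have h1 : ∫ ω, S (arrivals ω) * G (ω 0).1.2 ∂(sampleLaw P θ)
      = ∫ ω, S (arrivals ω) * queueMean P θ G (ω 0).2 ∂(sampleLaw P θ) := by
    rw [← sub_eq_zero, ← integral_sub (integrable_bounded_mul hS hSb hGω)
      (integrable_bounded_mul hS hSb hq), ← h0]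
    simp_rw [mul_sub]
  have h2 : ∀ ω : ℕ → Obs d × Fin K, S (arrivals ω) * queueMean P θ G (ω 0).2
      = ∑ k, queueMean P θ G k * (S (arrivals ω) * (if (ω 0).2 = k then 1 else 0)) := by
    intro ω
    rw [← sum_queue_indicator_mul (ω 0).2 (queueMean P θ G), Finset.mul_sum]
    exact Finset.sum_congr rfl fun k _ => by ring
  rw [h1]
  simp_rw [h2]
  rw [integral_finsetSum _ fun k _ => (integrable_bounded_mul hS hSb (hind k)).const_mul _]
  unfold queueScore
  simp_rw [Finset.sum_mul]
  have h3 : ∀ k (o : Obs d), (θ (cov o)).real {k} * queueRate P θ τ b n k * G o.2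
      = queueRate P θ τ b n k * ((θ (cov o)).real {k} * G o.2) := fun k o => by ring
  simp_rw [h3]
  rw [integral_finsetSum _ fun k _ => (integrable_queueProb_mul hG k).const_mul _]
  refine Finset.sum_congr rfl fun k _ => ?_
  rw [integral_const_mul, integral_const_mul, ← queueRate_mul_queueProb, ← queueMean_mul_queueProb]
  ring

variable (P θ) in
/-- The probability of status `z` given the covariates. -/
noncomputable def statusScore (τ : ℕ) (b : ℕ → ℕ → ℕ) (n : ℕ) (z : Bool)
    (x : EuclideanSpace ℝ (Fin d)) : ℝ :=
  if z then queueScore P θ τ b n x else 1 - queueScore P θ τ b n x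

lemma measurable_statusScore (τ : ℕ) (b : ℕ → ℕ → ℕ) (n : ℕ) (z : Bool) :
    Measurable (statusScore P θ τ b n z) := by
  cases z
  · exact (measurable_queueScore τ b n).const_sub 1
  · exact measurable_queueScore τ b n

lemma abs_statusScore_le_one (τ : ℕ) (b : ℕ → ℕ → ℕ) (n : ℕ) (z : Bool)
    (x : EuclideanSpace ℝ (Fin d)) : |statusScore P θ τ b n z x| ≤ 1 := by
  have h1 := queueScore_nonneg (P := P) (θ := θ) τ b n x
  have h2 := queueScore_le_one (P := P) (θ := θ) τ b n x
  rw [abs_le]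
  cases z <;> simp only [statusScore] <;> constructor <;> simp <;> linarith

lemma integral_status_mul' (hA : IndepFun (arr (d := d)) (fun o : Obs d => o.2) P) (τ : ℕ)
    (b : ℕ → ℕ → ℕ) (n : ℕ) (z : Bool) {G : EuclideanSpace ℝ (Fin d) × (Bool → ℝ) → ℝ}
    (hG : Integrable (fun o : Obs d => G o.2) P) :
    ∫ ω, status τ b n z 0 (arrivals ω) * G (ω 0).1.2 ∂(sampleLaw P θ)
      = ∫ o, statusScore P θ τ b n z (cov o) * G o.2 ∂P := by
  cases z
  · have hp := measurePreserving_obs_sampleLaw (P := P) (θ := θ) 0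
    have hGω : Integrable (fun ω : ℕ → Obs d × Fin K => G (ω 0).1.2) (sampleLaw P θ) :=
      hp.integrable_comp_of_integrable hG
    have hGi : ∫ ω, G (ω 0).1.2 ∂(sampleLaw P θ) = ∫ o, G o.2 ∂P :=
      integral_comp_of_measurePreserving hp hG.aestronglyMeasurable
    have hQG : Integrable (fun o : Obs d => queueScore P θ τ b n (cov o) * G o.2) P :=
      hG.bdd_mul (c := 1) ((measurable_queueScore τ b n).comp measurable_cov).aestronglyMeasurable
        (Eventually.of_forall fun o => by
          rw [Real.norm_of_nonneg (queueScore_nonneg ..)]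
          exact queueScore_le_one ..)
    have h := integral_status_mul (θ := θ) hA τ b n hG
    simp only [statusScore, status_false, sub_mul, one_mul, Bool.false_eq_true, if_false]
    rw [integral_sub hGω (integrable_bounded_mul (measurable_status ..)
      ⟨1, abs_status_le_one τ b n true 0⟩ hGω), integral_sub hG hQG, h, hGi]
  · simpa [statusScore] using integral_status_mul hA τ b n hG

end Sample

/-! ### The propensity score and the law of the observed outcome -/

section Score

variable {d K : ℕ} {P : Measure (Obs d)} [IsProbabilityMeasure P]
  {θ : Kernel (EuclideanSpace ℝ (Fin d)) (Fin K)} [IsMarkovKernel θ]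

lemma abs_queueScore_le_one (τ : ℕ) (b : ℕ → ℕ → ℕ) (n : ℕ) (x : EuclideanSpace ℝ (Fin d)) :
    |queueScore P θ τ b n x| ≤ 1 := by
  rw [abs_of_nonneg (queueScore_nonneg ..)]; exact queueScore_le_one ..

lemma measurable_propensity (τ : ℕ) (b : ℕ → ℕ → ℕ) (n : ℕ) :
    Measurable (propensity P θ τ b n) :=
  (Kernel.measurable_coe _ (measurableSet_singleton true)).ennreal_toReal

/-- Both functions are tested on sets `C` of covariates: `integral_status_mul` with `G` the
indicator of `X ∈ C` evaluates the probability of being treated with covariates in `C`. -/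
lemma propensity_ae_eq (hA : IndepFun (arr (d := d)) (fun o : Obs d => o.2) P) (τ : ℕ)
    (b : ℕ → ℕ → ℕ) (n : ℕ) :
    propensity P θ τ b n =ᵐ[covLaw P] queueScore P θ τ b n := by
  have hX := measurePreserving_cov_sampleLaw (P := P) (θ := θ) 0
  have hT : Measurable fun ω : ℕ → Obs d × Fin K => treat τ b n 0 ω := measurable_treat τ b n 0
  have hprop : ∀ x, |propensity P θ τ b n x| ≤ 1 := fun x => by
    unfold propensity; rw [abs_of_nonneg measureReal_nonneg]; exact measureReal_le_one
  refine Integrable.ae_eq_of_forall_setIntegral_eq _ _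
    (Integrable.of_bound (measurable_propensity τ b n).aestronglyMeasurable 1
      (Eventually.of_forall hprop))
    (Integrable.of_bound (measurable_queueScore τ b n).aestronglyMeasurable 1
      (Eventually.of_forall (abs_queueScore_le_one τ b n))) fun C hC _ => ?_
  rw [← integral_indicator hC, ← integral_indicator hC]
  set h : EuclideanSpace ℝ (Fin d) × Bool → ℝ :=
    fun w => C.indicator 1 w.1 * if w.2 = true then 1 else 0 with hh
  have hhm : Measurable h := by
    refine ((measurable_one.indicator hC).comp measurable_fst).mul (Measurable.ite ?_ ?_ ?_)
    · exact measurable_snd (measurableSet_singleton true)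
    · exact measurable_const
    · exact measurable_const
  have hcd : covLaw P ⊗ₘ condDistrib (fun ω => treat τ b n 0 ω) (fun ω => cov (ω 0).1)
      (sampleLaw P θ) = (sampleLaw P θ).map fun ω => (cov (ω 0).1, treat τ b n 0 ω) := by
    rw [← compProd_map_condDistrib hT.aemeasurable, hX.map_eq]
  have hhi : Integrable h ((covLaw P) ⊗ₘ condDistrib (fun ω => treat τ b n 0 ω)
      (fun ω => cov (ω 0).1) (sampleLaw P θ)) := by
    refine Integrable.of_bound hhm.aestronglyMeasurable 1 (Eventually.of_forall fun w => ?_)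
    by_cases h1 : w.1 ∈ C <;> by_cases h2 : w.2 = true <;> simp [hh, h1, h2]
  have e1 := Measure.integral_compProd hhi
  rw [hcd, integral_map (hX.measurable.prodMk hT).aemeasurable hhm.aestronglyMeasurable] at e1
  have e2 := integral_status_mul (θ := θ) hA τ b n (G := fun v => C.indicator 1 v.1)
    ((integrable_const (1 : ℝ)).indicator (measurable_cov hC))
  have e3 : ∀ x, ∫ z, h (x, z) ∂(condDistrib (fun ω => treat τ b n 0 ω)
      (fun ω => cov (ω 0).1) (sampleLaw P θ) x) = C.indicator (propensity P θ τ b n) x := by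
    intro x
    simp only [hh]
    rw [integral_const_mul, integral_fintype Integrable.of_finite]
    by_cases hx : x ∈ C <;> simp [hx, propensity]
  simp_rw [e3] at e1
  rw [← e1]
  simp only [hh]
  calc _ = ∫ ω, status τ b n true 0 (arrivals ω) * C.indicator 1 (ω 0).1.2.1 ∂(sampleLaw P θ) := by
        refine integral_congr_ae (Eventually.of_forall fun ω => ?_)
        simp only [status_arrivals]
        rw [mul_comm]; rfl
    _ = _ := by
        rw [e2, integral_cov ((measurable_queueScore τ b n).indicator hC)]
        refine integral_congr_ae (Eventually.of_forall fun o => ?_)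
        by_cases hx : cov o ∈ C
        · have : o.2.1 ∈ C := hx
          simp [hx, this]
        · have : o.2.1 ∉ C := hx
          simp [hx, this]

variable (P) in
/-- The conditional law of the observed outcome given the status and the covariates. -/
noncomputable def statusPotLaw : Kernel (Bool × EuclideanSpace ℝ (Fin d)) ℝ where
  toFun w := potLaw P w.1 w.2
  measurable' := measurable_from_prod_countable_right fun z => (potLaw P z).measurable

instance : IsMarkovKernel (statusPotLaw P) :=
  ⟨fun w => inferInstanceAs (IsProbabilityMeasure (potLaw P w.1 w.2))⟩

lemma measurable_outcome (τ : ℕ) (b : ℕ → ℕ → ℕ) (n i : ℕ) :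
    Measurable (outcome (d := d) (K := K) τ b n i) := by
  have h : Measurable fun w : Bool × Obs d => pot w.2 w.1 :=
    measurable_from_prod_countable_right fun z => measurable_pot_apply z
  exact h.comp ((measurable_treat τ b n i).prodMk (measurable_fst.comp (measurable_pi_apply i)))

lemma apply_treat_eq_sum (τ : ℕ) (b : ℕ → ℕ → ℕ) (n i : ℕ) (ω : ℕ → Obs d × Fin K)
    (g : Bool → ℝ) :
    g (treat τ b n i ω) = ∑ z, status τ b n z i (arrivals ω) * g z := by
  simp [status_arrivals]

/-- Unconfoundedness: by `integral_status_mul'` the probability of a status given covariates and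
potential outcomes depends on the covariates alone, so observing status `z` does not change the law
of `Y^z` given `X`. -/
lemma outcomeLaw_ae_eq (hA : IndepFun (arr (d := d)) (fun o : Obs d => o.2) P) (τ : ℕ)
    (b : ℕ → ℕ → ℕ) (n : ℕ) :
    ∀ᵐ w ∂((sampleLaw P θ).map fun ω => (treat τ b n 0 ω, cov (ω 0).1)),
      outcomeLaw P θ τ b n w.1 w.2 = potLaw P w.1 w.2 := by
  have hX := measurePreserving_cov_sampleLaw (P := P) (θ := θ) 0
  have hT : Measurable fun ω : ℕ → Obs d × Fin K => treat τ b n 0 ω := measurable_treat τ b n 0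
  have hO : Measurable fun ω : ℕ → Obs d × Fin K => outcome τ b n 0 ω := measurable_outcome τ b n 0
  have hW : Measurable fun ω : ℕ → Obs d × Fin K => (treat τ b n 0 ω, cov (ω 0).1) :=
    hT.prodMk hX.measurable
  refine condDistrib_ae_eq_of_measure_eq_compProd (κ := statusPotLaw P) _ hO.aemeasurable ?_
  ext B hB
  rw [← measureReal_eq_measureReal_iff]
  have hind : Measurable (B.indicator (1 : (Bool × EuclideanSpace ℝ (Fin d)) × ℝ → ℝ)) :=
    measurable_one.indicator hB
  have hb : ∀ w, ‖B.indicator (1 : (Bool × EuclideanSpace ℝ (Fin d)) × ℝ → ℝ) w‖ ≤ 1 := by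
    intro w; by_cases h : w ∈ B <;> simp [h]
  have hg : ∀ z, Measurable fun w : EuclideanSpace ℝ (Fin d) × ℝ =>
      B.indicator (1 : (Bool × EuclideanSpace ℝ (Fin d)) × ℝ → ℝ) ((z, w.1), w.2) :=
    fun z => hind.comp (by fun_prop)
  rw [← integral_indicator_one hB, ← integral_indicator_one hB,
    integral_map (hW.prodMk hO).aemeasurable hind.aestronglyMeasurable,
    Measure.integral_compProd (Integrable.of_bound hind.aestronglyMeasurable 1
      (Eventually.of_forall hb))]
  have hinner : Measurable fun w : Bool × EuclideanSpace ℝ (Fin d) =>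
      ∫ y, B.indicator (1 : (Bool × EuclideanSpace ℝ (Fin d)) × ℝ → ℝ) (w, y)
        ∂(statusPotLaw P w) :=
    (hind.stronglyMeasurable.integral_kernel_prod_right' (κ := statusPotLaw P)).measurable
  rw [integral_map hW.aemeasurable hinner.aestronglyMeasurable]
  have hinnerb : ∀ w : Bool × EuclideanSpace ℝ (Fin d),
      ‖∫ y, B.indicator (1 : (Bool × EuclideanSpace ℝ (Fin d)) × ℝ → ℝ) (w, y)
        ∂(statusPotLaw P w)‖ ≤ 1 := fun w => by
    refine (norm_integral_le_of_norm_le_const (Eventually.of_forall fun y => hb (w, y))).trans ?_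
    simp
  set G : Bool → EuclideanSpace ℝ (Fin d) × (Bool → ℝ) → ℝ := fun z v =>
    B.indicator (1 : (Bool × EuclideanSpace ℝ (Fin d)) × ℝ → ℝ) ((z, v.1), v.2 z) with hG
  set g : Bool → EuclideanSpace ℝ (Fin d) × (Bool → ℝ) → ℝ := fun z v =>
    ∫ y, B.indicator (1 : (Bool × EuclideanSpace ℝ (Fin d)) × ℝ → ℝ) ((z, v.1), y)
      ∂(potLaw P z v.1) with hgdef
  have hGm : ∀ z, Measurable (G z) := fun z => hind.comp
    ((measurable_const.prodMk measurable_fst).prodMk ((measurable_pi_apply z).comp measurable_snd))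
  have hgm' : ∀ z, Measurable fun x => ∫ y, B.indicator
      (1 : (Bool × EuclideanSpace ℝ (Fin d)) × ℝ → ℝ) ((z, x), y) ∂(potLaw P z x) :=
    fun z => hinner.comp measurable_prodMk_left
  have hgm : ∀ z, Measurable (g z) := fun z => (hgm' z).comp measurable_fst
  have hGi : ∀ z, Integrable (fun o : Obs d => G z o.2) P := fun z =>
    Integrable.of_bound ((hGm z).comp measurable_snd).aestronglyMeasurable 1
      (Eventually.of_forall fun o => hb _)
  have hgi : ∀ z, Integrable (fun o : Obs d => g z o.2) P := fun z =>
    Integrable.of_bound ((hgm z).comp measurable_snd).aestronglyMeasurable 1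
      (Eventually.of_forall fun o => hinnerb (z, o.2.1))
  -- Used twice: for the indicator of `B` at the realised potential outcome, and for its conditional
  -- mean given `X`.
  have key : ∀ f : Bool → EuclideanSpace ℝ (Fin d) × (Bool → ℝ) → ℝ,
      (∀ z, Integrable (fun o : Obs d => f z o.2) P) →
      ∫ ω, f (treat τ b n 0 ω) (ω 0).1.2 ∂(sampleLaw P θ)
        = ∑ z, ∫ o, statusScore P θ τ b n z (cov o) * f z o.2 ∂P := by
    intro f hf
    have : ∀ ω : ℕ → Obs d × Fin K, f (treat τ b n 0 ω) (ω 0).1.2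
        = ∑ z, status τ b n z 0 (arrivals ω) * f z (ω 0).1.2 := fun ω =>
      apply_treat_eq_sum τ b n 0 ω fun z => f z (ω 0).1.2
    simp_rw [this]
    have hfi : ∀ z, Integrable (fun ω : ℕ → Obs d × Fin K => f z (ω 0).1.2) (sampleLaw P θ) :=
      fun z => (measurePreserving_obs_sampleLaw 0).integrable_comp_of_integrable (hf z)
    rw [integral_finsetSum _ fun z _ => integrable_bounded_mul (measurable_status ..)
      ⟨1, abs_status_le_one τ b n z 0⟩ (hfi z)]
    exact Finset.sum_congr rfl fun z _ => integral_status_mul' hA τ b n z (hf z)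
  refine (key G hGi).trans (Eq.trans ?_ (key g hgi).symm)
  refine Finset.sum_congr rfl fun z _ => ?_
  have hsm : Measurable fun w : EuclideanSpace ℝ (Fin d) × ℝ => statusScore P θ τ b n z w.1 *
      B.indicator (1 : (Bool × EuclideanSpace ℝ (Fin d)) × ℝ → ℝ) ((z, w.1), w.2) :=
    ((measurable_statusScore τ b n z).comp measurable_fst).mul (hg z)
  have h1 := (integral_cov_pot z hsm ((hGi z).bdd_mul (c := 1)
    ((measurable_statusScore τ b n z).comp measurable_cov).aestronglyMeasurable
    (Eventually.of_forall fun o => abs_statusScore_le_one ..))).2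
  refine Eq.trans h1 ?_
  simp_rw [integral_const_mul]
  exact integral_cov ((measurable_statusScore τ b n z).mul (hgm' z))

/-- Under positivity, the observed outcome has the conditional law of the potential outcome. -/
lemma outcomeLaw_eq_potLaw (hA : IndepFun (arr (d := d)) (fun o : Obs d => o.2) P) {τ : ℕ}
    {b : ℕ → ℕ → ℕ} {n : ℕ} {γ : ℝ} (hγ : 0 < γ)
    (h_pos : ∀ᵐ x ∂(covLaw P), γ ≤ propensity P θ τ b n x ∧ propensity P θ τ b n x ≤ 1 - γ)
    (z : Bool) : ∀ᵐ x ∂(covLaw P), outcomeLaw P θ τ b n z x = potLaw P z x := by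
  have hX := measurePreserving_cov_sampleLaw (P := P) (θ := θ) 0
  have hT : Measurable fun ω : ℕ → Obs d × Fin K => treat τ b n 0 ω := measurable_treat τ b n 0
  have hW : Measurable fun ω : ℕ → Obs d × Fin K => (treat τ b n 0 ω, cov (ω 0).1) :=
    hT.prodMk hX.measurable
  obtain ⟨N, hN, hNm, hN0⟩ := exists_measurable_superset_of_null
    (ae_iff.1 (outcomeLaw_ae_eq (P := P) (θ := θ) hA τ b n))
  -- `C` contains the covariates where the two laws differ. Having status `z` with covariates in `C`
  -- is a null event, and status `z` has conditional probability at least `γ`, so `C` is null.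
  set C : Set (EuclideanSpace ℝ (Fin d)) := {x | (z, x) ∈ N}
  have hC : MeasurableSet C := measurable_prodMk_left hNm
  rw [Measure.map_apply hW hNm] at hN0
  have h0 : ∫ ω, status τ b n z 0 (arrivals ω) * C.indicator 1 (ω 0).1.2.1 ∂(sampleLaw P θ)
      = 0 := by
    refine integral_eq_zero_of_ae ?_
    filter_upwards [measure_eq_zero_iff_ae_notMem.1 hN0] with ω hω
    simp only [status_arrivals, Pi.zero_apply]
    by_cases hz : treat τ b n 0 ω = z
    · have : (ω 0).1.2.1 ∉ C := by
        intro hc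
        apply hω
        change (treat τ b n 0 ω, cov (ω 0).1) ∈ N
        rw [hz]; exact hc
      simp [this]
    · simp [hz]
  rw [integral_status_mul' hA τ b n z (G := fun v => C.indicator 1 v.1)
    ((integrable_const (1 : ℝ)).indicator (measurable_cov hC))] at h0
  have h1 : ∫ x, statusScore P θ τ b n z x * C.indicator 1 x ∂(covLaw P) = 0 := by
    exact (integral_cov ((measurable_statusScore τ b n z).mul
      (measurable_one.indicator hC))).trans h0
  have hsc : ∀ᵐ x ∂(covLaw P), γ ≤ statusScore P θ τ b n z x := by
    filter_upwards [h_pos, propensity_ae_eq (θ := θ) hA τ b n] with x hx hx2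
    rw [hx2] at hx
    cases z
    · simp [statusScore]; linarith
    · simp [statusScore]; linarith
  rw [integral_eq_zero_iff_of_nonneg_ae] at h1
  · filter_upwards [h1, hsc] with x hx hx2
    by_contra hne
    have hxC : x ∈ C := hN hne
    have h2 : statusScore P θ τ b n z x = 0 := by simpa [hxC] using hx
    linarith
  · filter_upwards [hsc] with x hx
    exact mul_nonneg (hγ.le.trans hx) (Set.indicator_nonneg (by simp) _)
  · refine Integrable.bdd_mul (c := 1) ((integrable_const (1 : ℝ)).indicator hC)
      (measurable_statusScore τ b n z).aestronglyMeasurable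
      (Eventually.of_forall fun x => abs_statusScore_le_one ..)

end Score

/-! ### Concentration of the numbers of treated units -/

section Concentration

lemma sq_integral_le {Ω : Type*} [MeasurableSpace Ω] {μ : Measure Ω} [IsProbabilityMeasure μ]
    {X : Ω → ℝ} (hX : MemLp X 2 μ) : (∫ ω, X ω ∂μ) ^ 2 ≤ ∫ ω, X ω ^ 2 ∂μ := by
  have h := variance_nonneg X μ
  rw [variance_eq_sub hX] at h
  simpa using h

lemma integrable_indicator_one {Ω : Type*} [MeasurableSpace Ω] {μ : Measure Ω}
    [IsFiniteMeasure μ] {B : Set Ω} (hB : MeasurableSet B) :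
    Integrable (B.indicator (1 : Ω → ℝ)) μ :=
  (integrable_const (1 : ℝ)).indicator hB

variable {d K : ℕ} {P : Measure (Obs d)} [IsProbabilityMeasure P]
  {θ : Kernel (EuclideanSpace ℝ (Fin d)) (Fin K)} [IsMarkovKernel θ]

/-- Sums of centred functions of i.i.d. units. -/
lemma integral_sq_sum_iid {f : Obs d × Fin K → ℝ} (hf : MemLp f 2 (unitLaw P θ))
    (h0 : ∫ y, f y ∂(unitLaw P θ) = 0) (n : ℕ) :
    ∫ ω, (∑ i ∈ Finset.range n, f (ω i)) ^ 2 ∂(sampleLaw P θ)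
      = n * ∫ y, f y ^ 2 ∂(unitLaw P θ) := by
  have hp := fun i => measurePreserving_eval_sampleLaw (P := P) (θ := θ) i
  refine (integral_sq_sum_of_orthogonal (Finset.range n)
    (fun i (ω : ℕ → Obs d × Fin K) => f (ω i))
    (fun i _ => hf.comp_measurePreserving (hp i)) ?_).trans ?_
  rotate_left
  · have e : ∀ i, ∫ ω, f (ω i) ^ 2 ∂(sampleLaw P θ) = ∫ y, f y ^ 2 ∂(unitLaw P θ) := fun i =>
      integral_comp_of_measurePreserving (hp i) (hf.aestronglyMeasurable.pow 2)
    simp [e]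
  · intro i _ j _ hij
    refine integral_infinitePi_eq_zero (unitLaw P θ) i fun ω => ?_
    simp only [Function.update_self, Function.update_of_ne hij.symm]
    rw [integral_mul_const, h0, zero_mul]

/-- The centred indicators are i.i.d. and bounded by one; the resulting bound is uniform in `B`. -/
lemma integral_sq_count_sub_le {B : Set (Obs d × Fin K)} (hB : MeasurableSet B) (n : ℕ) :
    ∫ ω, (∑ i ∈ Finset.range n, B.indicator 1 (ω i) - n * (unitLaw P θ).real B) ^ 2
      ∂(sampleLaw P θ) ≤ (n : ℝ) := by
  set m := (unitLaw P θ).real B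
  have hm0 : 0 ≤ m := measureReal_nonneg
  have hm1 : m ≤ 1 := measureReal_le_one
  have hind : Measurable (B.indicator (1 : Obs d × Fin K → ℝ)) := measurable_one.indicator hB
  have hbd : ∀ y, ‖B.indicator (1 : Obs d × Fin K → ℝ) y - m‖ ≤ 1 := by
    intro y
    rw [Real.norm_eq_abs, abs_le]
    by_cases h : y ∈ B <;> simp [h] <;> constructor <;> linarith
  have hL : MemLp (fun y => B.indicator (1 : Obs d × Fin K → ℝ) y - m) 2 (unitLaw P θ) :=
    MemLp.of_bound (hind.sub_const m).aestronglyMeasurable 1 (Eventually.of_forall hbd)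
  have h0 : ∫ y, (B.indicator (1 : Obs d × Fin K → ℝ) y - m) ∂(unitLaw P θ) = 0 := by
    rw [integral_sub (integrable_indicator_one hB) (integrable_const _),
      integral_indicator_one hB]
    simp [m]
  have h := integral_sq_sum_iid hL h0 n
  have e : ∀ ω : ℕ → Obs d × Fin K, ∑ i ∈ Finset.range n, (B.indicator 1 (ω i) - m)
      = ∑ i ∈ Finset.range n, B.indicator 1 (ω i) - n * m := by
    intro ω; rw [Finset.sum_sub_distrib]; simp
  simp_rw [e] at h
  rw [h]
  refine mul_le_of_le_one_right (Nat.cast_nonneg n) ?_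
  have := integral_mono (μ := unitLaw P θ) hL.integrable_sq (integrable_const (1 : ℝ)) fun y => by
    have := hbd y
    rw [Real.norm_eq_abs] at this
    have h2 := pow_le_pow_left₀ (abs_nonneg _) this 2
    simpa using h2
  simpa using this

variable (P θ) in
/-- The probability of the first `k` queues. -/
noncomputable def queueProbBelow (k : ℕ) : ℝ := ∑ l : Fin K, if (l : ℕ) < k then queueProb P θ l else 0

/-- The queue depends on the data through `X`, hence is independent of `A`. So the first `k` queues
receive the same share of the arrivals at all times, the form of arrivals that `tendsto_fluid_div`
requires. -/
lemma unitLaw_arrived (hA : IndepFun (arr (d := d)) (fun o : Obs d => o.2) P) (s : ℝ) (k : ℕ) :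
    (unitLaw P θ).real {y | arr y.1 ≤ s ∧ (y.2 : ℕ) < k}
      = queueProbBelow P θ k * P.real {o | arr o ≤ s} := by
  classical
  have hs : MeasurableSet {o : Obs d | arr o ≤ s} := measurable_arr measurableSet_Iic
  have hB : MeasurableSet {y : Obs d × Fin K | arr y.1 ≤ s ∧ (y.2 : ℕ) < k} :=
    (measurable_fst hs).inter (measurable_snd (t := {l : Fin K | (l : ℕ) < k}) (Set.toFinite _).measurableSet)
  rw [← integral_indicator_one hB, (integral_unitLaw (integrable_indicator_one hB)).2]
  have e : ∀ o : Obs d, ∑ l, (θ (cov o)).real {l} *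
      ({y : Obs d × Fin K | arr y.1 ≤ s ∧ (y.2 : ℕ) < k}.indicator 1 (o, l) : ℝ)
      = ∑ l : Fin K, (if (l : ℕ) < k then 1 else 0) *
        ({o : Obs d | arr o ≤ s}.indicator 1 o * (θ (cov o)).real {l}) := by
    intro o
    refine Finset.sum_congr rfl fun l _ => ?_
    by_cases h1 : arr o ≤ s <;> by_cases h2 : (l : ℕ) < k <;> simp [h1, h2]
  have hi : ∀ l, Integrable (fun o : Obs d =>
      {o : Obs d | arr o ≤ s}.indicator (1 : Obs d → ℝ) o * (θ (cov o)).real {l}) P := by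
    intro l
    have := integrable_queueProb_mul (θ := θ) (integrable_indicator_one (μ := P) hs) l
    simpa [mul_comm, Pi.one_def] using this
  erw [integral_congr_ae (Eventually.of_forall e)]
  rw [integral_finsetSum _ fun l _ => (hi l).const_mul _]
  have e2 : ∀ l, ∫ o, {o : Obs d | arr o ≤ s}.indicator (1 : Obs d → ℝ) o * (θ (cov o)).real {l} ∂P
      = P.real {o | arr o ≤ s} * queueProb P θ l := by
    intro l
    have hind := hA.comp (φ := (Set.Iic s).indicator (1 : ℝ → ℝ))
      (ψ := fun v : EuclideanSpace ℝ (Fin d) × (Bool → ℝ) => (θ v.1).real {l})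
      (measurable_one.indicator measurableSet_Iic) ((measurable_queueProb θ l).comp measurable_fst)
    have := hind.integral_fun_mul_eq_mul_integral
      ((measurable_one.indicator measurableSet_Iic).comp measurable_arr).aestronglyMeasurable
      (((measurable_queueProb θ l).comp measurable_fst).comp measurable_snd).aestronglyMeasurable
    rw [queueProb_eq, ← integral_indicator_one hs]
    exact this
  simp_rw [integral_const_mul, e2]
  rw [queueProbBelow, Finset.sum_mul]
  refine Finset.sum_congr rfl fun l _ => ?_
  split_ifs <;> ring

lemma arrivedCount_eq_sum (n k t : ℕ) (ω : ℕ → Obs d × Fin K) :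
    (arrivedCount n (fun j => arr (ω j).1) (fun j => (ω j).2) k t : ℝ)
      = ∑ i ∈ Finset.range n, {y : Obs d × Fin K | arr y.1 ≤ (t : ℝ) ∧ (y.2 : ℕ) < k}.indicator 1
        (ω i) := by
  classical
  rw [arrivedCount, Finset.card_eq_sum_ones, Finset.sum_filter]
  push_cast
  refine Finset.sum_congr rfl fun i _ => ?_
  simp [Set.indicator_apply]

/-- The number of treated units in the first `k` queues, as a function of the arrivals. -/
lemma treatedCount_eq_sum (τ : ℕ) (b : ℕ → ℕ → ℕ) (n k : ℕ) (u : ℕ → ℝ × Fin K) :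
    (treatedCount n (b n) (fun j => (u j).1) (fun j => (u j).2) k τ : ℝ)
      = ∑ i ∈ Finset.range n, status τ b n true i u * if ((u i).2 : ℕ) < k then 1 else 0 := by
  classical
  have h : (treatedBy n (b n) (fun j => (u j).1) (fun j => (u j).2) τ).filter
        (fun i => ((u i).2 : ℕ) < k)
      = (Finset.range n).filter fun i =>
        i ∈ treatedBy n (b n) (fun j => (u j).1) (fun j => (u j).2) τ ∧ ((u i).2 : ℕ) < k := by
    ext i
    simp only [Finset.mem_filter, Finset.mem_range]
    exact ⟨fun h => ⟨(treatedBy_subset _ _ _ _ _ h.1).1, h⟩, fun h => h.2⟩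
  rw [treatedCount, h, Finset.card_eq_sum_ones, Finset.sum_filter]
  push_cast
  refine Finset.sum_congr rfl fun i _ => ?_
  unfold status
  by_cases h1 : i ∈ treatedBy n (b n) (fun j => (u j).1) (fun j => (u j).2) τ <;>
    by_cases h2 : ((u i).2 : ℕ) < k <;> simp [h1, h2]

/-- The deterministic approximation of the number of treated units in the first `k` queues. -/
noncomputable def fluidCount (P : Measure (Obs d)) (θ : Kernel (EuclideanSpace ℝ (Fin d)) (Fin K))
    (τ : ℕ) (b : ℕ → ℕ → ℕ) (n k : ℕ) : ℝ :=
  fluid (fun s => n * (queueProbBelow P θ k * P.real {o | arr o ≤ (s : ℝ)}))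
    (fun s => (b n s : ℝ)) τ

lemma measurable_treatedCount (τ : ℕ) (b : ℕ → ℕ → ℕ) (n k : ℕ) :
    Measurable fun u : ℕ → ℝ × Fin K =>
      (treatedCount n (b n) (fun j => (u j).1) (fun j => (u j).2) k τ : ℝ) := by
  simp_rw [treatedCount_eq_sum]
  refine Finset.measurable_sum _ fun i _ => (measurable_status ..).mul
    (Measurable.ite ?_ measurable_const measurable_const)
  have h : Measurable fun u : ℕ → ℝ × Fin K => (u i).2 :=
    measurable_snd.comp (measurable_pi_apply i)
  exact h (t := {l : Fin K | (l : ℕ) < k}) (Set.toFinite _).measurableSet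

lemma treatedCount_le (n : ℕ) (c : ℕ → ℕ) (a : ℕ → ℝ) (q : ℕ → Fin K) (k t : ℕ) :
    treatedCount n c a q k t ≤ n := by
  have : treatedCount n c a q k t ≤ (Finset.range n).card :=
    Finset.card_le_card fun i hi =>
      Finset.mem_range.2 (treatedBy_subset _ _ _ _ _ (Finset.mem_filter.1 hi).1).1
  simpa using this

lemma memLp_treatedCount (τ : ℕ) (b : ℕ → ℕ → ℕ) (n k : ℕ) :
    MemLp (fun ω : ℕ → Obs d × Fin K =>
      (treatedCount n (b n) (fun j => arr (ω j).1) (fun j => (ω j).2) k τ : ℝ)) 2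
      (sampleLaw P θ) := by
  refine MemLp.of_bound ((measurable_treatedCount τ b n k).comp
    measurable_arrivals).aestronglyMeasurable n (Eventually.of_forall fun ω => ?_)
  simpa using treatedCount_le _ _ _ _ _ _

/-- By `fluid_sub_sq_le` the error is dominated by the fluctuations of the arrival counts in the `τ`
periods, each with second moment at most `n`. The budgets are arbitrary here. -/
lemma integral_sq_treatedCount_sub_le (hA : IndepFun (arr (d := d)) (fun o : Obs d => o.2) P)
    (τ : ℕ) (b : ℕ → ℕ → ℕ) (n k : ℕ) :
    ∫ ω, ((treatedCount n (b n) (fun j => arr (ω j).1) (fun j => (ω j).2) k τ : ℝ)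
      - fluidCount P θ τ b n k) ^ 2 ∂(sampleLaw P θ) ≤ τ * n := by
  set B : ℕ → Set (Obs d × Fin K) := fun t => {y | arr y.1 ≤ (t : ℝ) ∧ (y.2 : ℕ) < k}
  have hB : ∀ t, MeasurableSet (B t) := fun t =>
    (measurable_fst (measurable_arr measurableSet_Iic)).inter
      (measurable_snd (t := {l : Fin K | (l : ℕ) < k}) (Set.toFinite _).measurableSet)
  have hpt : ∀ ω : ℕ → Obs d × Fin K,
      ((treatedCount n (b n) (fun j => arr (ω j).1) (fun j => (ω j).2) k τ : ℝ)
        - fluidCount P θ τ b n k) ^ 2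
      ≤ ∑ s ∈ Finset.range τ, (∑ i ∈ Finset.range n, (B (s + 1)).indicator 1 (ω i)
          - n * (unitLaw P θ).real (B (s + 1))) ^ 2 := by
    intro ω
    rw [treatedCount_eq_fluid, fluidCount]
    refine (fluid_sub_sq_le _ _ _ _).trans_eq (Finset.sum_congr rfl fun s _ => ?_)
    rw [arrivedCount_eq_sum, unitLaw_arrived hA]
  have hint : ∀ s ∈ Finset.range τ, Integrable (fun ω : ℕ → Obs d × Fin K =>
      (∑ i ∈ Finset.range n, (B (s + 1)).indicator 1 (ω i)
          - n * (unitLaw P θ).real (B (s + 1))) ^ 2) (sampleLaw P θ) := by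
    intro s _
    have : MemLp (fun ω : ℕ → Obs d × Fin K => ∑ i ∈ Finset.range n,
        (B (s + 1)).indicator (1 : Obs d × Fin K → ℝ) (ω i)
          - n * (unitLaw P θ).real (B (s + 1))) 2 (sampleLaw P θ) := by
      refine MemLp.sub (memLp_finsetSum _ fun i _ => ?_) (memLp_const _)
      refine MemLp.of_bound ((measurable_one.indicator (hB _)).comp
        (measurable_pi_apply i)).aestronglyMeasurable 1 (Eventually.of_forall fun ω => ?_)
      by_cases h : ω i ∈ B (s + 1) <;> simp [h]
    exact this.integrable_sq
  refine (integral_mono_of_nonneg (Eventually.of_forall fun ω => sq_nonneg _)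
    (integrable_finsetSum _ hint) (Eventually.of_forall hpt)).trans ?_
  rw [integral_finsetSum _ hint]
  refine (Finset.sum_le_sum fun s _ => integral_sq_count_sub_le (hB (s + 1)) n).trans_eq ?_
  simp

/-! ### Concentration within a single queue -/

/-- The number of treated units in queue `k`. -/
noncomputable def queueTreated (τ : ℕ) (b : ℕ → ℕ → ℕ) (n : ℕ) (k : Fin K)
    (u : ℕ → ℝ × Fin K) : ℝ :=
  ∑ i ∈ Finset.range n, status τ b n true i u * if (u i).2 = k then 1 else 0

/-- The number of units in queue `k`. -/
noncomputable def queueSize (n : ℕ) (k : Fin K) (u : ℕ → ℝ × Fin K) : ℝ :=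
  ∑ i ∈ Finset.range n, if (u i).2 = k then 1 else 0

lemma queueTreated_eq (τ : ℕ) (b : ℕ → ℕ → ℕ) (n : ℕ) (k : Fin K) (u : ℕ → ℝ × Fin K) :
    queueTreated τ b n k u
      = (treatedCount n (b n) (fun j => (u j).1) (fun j => (u j).2) (k + 1) τ : ℝ)
        - treatedCount n (b n) (fun j => (u j).1) (fun j => (u j).2) k τ := by
  rw [treatedCount_eq_sum, treatedCount_eq_sum, ← Finset.sum_sub_distrib, queueTreated]
  refine Finset.sum_congr rfl fun i _ => ?_
  rw [← mul_sub]
  congr 1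
  rcases lt_trichotomy ((u i).2 : ℕ) k with h | h | h
  · rw [if_neg (fun h' => by rw [h'] at h; exact lt_irrefl _ h), if_pos (by omega), if_pos h]; simp
  · rw [if_pos (Fin.ext h), if_pos (by omega), if_neg (by omega)]; simp
  · rw [if_neg (fun h' => by rw [h'] at h; exact lt_irrefl _ h), if_neg (by omega),
      if_neg (by omega)]; simp

lemma memLp_queueTreated (τ : ℕ) (b : ℕ → ℕ → ℕ) (n : ℕ) (k : Fin K) :
    MemLp (fun ω : ℕ → Obs d × Fin K => queueTreated τ b n k (arrivals ω)) 2
      (sampleLaw P θ) := by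
  simp_rw [queueTreated_eq]
  exact (memLp_treatedCount τ b n (k + 1)).sub (memLp_treatedCount τ b n k)

lemma memLp_queueSize (n : ℕ) (k : Fin K) :
    MemLp (fun ω : ℕ → Obs d × Fin K => queueSize n k (arrivals ω)) 2 (sampleLaw P θ) := by
  refine memLp_finsetSum _ fun i _ => ?_
  refine MemLp.of_bound ((measurable_queueIndicator i k).comp
    measurable_arrivals).aestronglyMeasurable 1 (Eventually.of_forall fun ω => ?_)
  change ‖if (ω i).2 = k then (1 : ℝ) else 0‖ ≤ 1
  split_ifs <;> simp

/-- The deterministic approximation of the number of treated units in queue `k`. -/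
noncomputable def fluidTreated (P : Measure (Obs d)) (θ : Kernel (EuclideanSpace ℝ (Fin d)) (Fin K))
    (τ : ℕ) (b : ℕ → ℕ → ℕ) (n : ℕ) (k : Fin K) : ℝ :=
  fluidCount P θ τ b n (k + 1) - fluidCount P θ τ b n k

/-- A single queue is the difference of two initial blocks; `(x - y)² ≤ 2x² + 2y²` accounts for the
factor four. -/
lemma integral_sq_queueTreated_sub_le (hA : IndepFun (arr (d := d)) (fun o : Obs d => o.2) P)
    (τ : ℕ) (b : ℕ → ℕ → ℕ) (n : ℕ) (k : Fin K) :
    ∫ ω, (queueTreated τ b n k (arrivals ω) - fluidTreated P θ τ b n k) ^ 2 ∂(sampleLaw P θ)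
      ≤ 4 * τ * n := by
  have h1 := integral_sq_treatedCount_sub_le (θ := θ) hA τ b n (k + 1)
  have h2 := integral_sq_treatedCount_sub_le (θ := θ) hA τ b n k
  have i1 := ((memLp_treatedCount (P := P) (θ := θ) τ b n (k + 1)).sub
    (memLp_const (fluidCount P θ τ b n (k + 1)))).integrable_sq
  have i2 := ((memLp_treatedCount (P := P) (θ := θ) τ b n k).sub
    (memLp_const (fluidCount P θ τ b n k))).integrable_sq
  have h3 := integral_mono_of_nonneg (μ := sampleLaw P θ)
    (f := fun ω => (queueTreated τ b n k (arrivals ω) - fluidTreated P θ τ b n k) ^ 2)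
    (Eventually.of_forall fun ω => sq_nonneg _) ((i1.const_mul 2).add (i2.const_mul 2))
    (Eventually.of_forall fun ω => by
      simp only [queueTreated_eq, fluidTreated, Pi.add_apply, Pi.sub_apply, arrivals]
      nlinarith [sq_nonneg ((treatedCount n (b n) (fun j => arr (ω j).1) (fun j => (ω j).2)
        (k + 1) τ : ℝ) - fluidCount P θ τ b n (k + 1)
        + (treatedCount n (b n) (fun j => arr (ω j).1) (fun j => (ω j).2) k τ
        - fluidCount P θ τ b n k))])
  refine h3.trans ?_
  rw [integral_add' (i1.const_mul 2) (i2.const_mul 2), integral_const_mul, integral_const_mul]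
  simp only [Pi.sub_apply]
  linarith

lemma integral_queueTreated (hA_cont : ∀ s : ℝ, P {o | arr o = s} = 0) (τ : ℕ)
    (b : ℕ → ℕ → ℕ) (n : ℕ) (k : Fin K) :
    ∫ ω, queueTreated τ b n k (arrivals ω) ∂(sampleLaw P θ)
      = n * (queueRate P θ τ b n k * queueProb P θ k) := by
  unfold queueTreated
  rw [integral_finsetSum]
  · refine (Finset.sum_congr rfl fun i hi => integral_status_exchange (θ := θ) hA_cont τ b
      (Finset.mem_range.1 hi) true fun y => if y.2 = k then 1 else 0).trans ?_
    rw [queueRate_mul_queueProb]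
    simp
  · intro i _
    exact integrable_bounded_mul (measurable_status ..) ⟨1, abs_status_le_one τ b n true i⟩
      (integrable_bounded_arrivals (measurable_queueIndicator i k)
        ⟨1, fun u => by split_ifs <;> simp⟩)

/-- By exchangeability the mean number treated is `n` times rate times queue probability, and the
squared bias of the fluid is at most its mean squared error. -/
lemma sq_queueRate_sub_le (hA : IndepFun (arr (d := d)) (fun o : Obs d => o.2) P)
    (hA_cont : ∀ s : ℝ, P {o | arr o = s} = 0) (τ : ℕ) (b : ℕ → ℕ → ℕ) (n : ℕ) (k : Fin K) :
    (n * (queueRate P θ τ b n k * queueProb P θ k) - fluidTreated P θ τ b n k) ^ 2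
      ≤ 4 * τ * n := by
  have hL := (memLp_queueTreated (P := P) (θ := θ) τ b n k).sub
    (memLp_const (fluidTreated P θ τ b n k))
  have h := sq_integral_le hL
  simp only [Pi.sub_apply] at h
  rw [integral_sub ((memLp_queueTreated τ b n k).integrable (by norm_num)) (integrable_const _),
    integral_queueTreated hA_cont] at h
  simp only [integral_const, probReal_univ, smul_eq_mul, one_mul] at h
  exact h.trans (integral_sq_queueTreated_sub_le hA τ b n k)

lemma integral_sq_queueSize_sub_le (n : ℕ) (k : Fin K) :
    ∫ ω, (queueSize n k (arrivals ω) - n * queueProb P θ k) ^ 2 ∂(sampleLaw P θ) ≤ (n : ℝ) := by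
  have hB : MeasurableSet {y : Obs d × Fin K | y.2 = k} :=
    measurable_snd (measurableSet_singleton k)
  have h := integral_sq_count_sub_le (P := P) (θ := θ) hB n
  have e : (unitLaw P θ).real {y : Obs d × Fin K | y.2 = k} = queueProb P θ k := by
    rw [← integral_indicator_one hB,
      ← integral_comp_of_measurePreserving (measurePreserving_eval_sampleLaw 0)
      (measurable_one.indicator hB).aestronglyMeasurable, ← integral_queueIndicator 0 k]
    exact integral_congr_ae (Eventually.of_forall fun ω => by simp [Set.indicator_apply])
  rw [e] at h
  simp only [Set.indicator_apply, Set.mem_ofPred_eq, Pi.one_apply] at h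
  exact h

/-- The number of treated units in a queue and the size of the queue fluctuate together. -/
lemma integral_sq_queueTreated_sub_queueSize_le
    (hA : IndepFun (arr (d := d)) (fun o : Obs d => o.2) P)
    (hA_cont : ∀ s : ℝ, P {o | arr o = s} = 0) (τ : ℕ) (b : ℕ → ℕ → ℕ) (n : ℕ) (k : Fin K) :
    ∫ ω, (queueTreated τ b n k (arrivals ω) - queueRate P θ τ b n k * queueSize n k (arrivals ω))
      ^ 2 ∂(sampleLaw P θ) ≤ (24 * τ + 3) * n := by
  set g := fluidTreated P θ τ b n k
  set r := queueRate P θ τ b n k with hr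
  set q := queueProb P θ k
  have hr0 : 0 ≤ r := queueRate_nonneg ..
  have hr1 : r ≤ 1 := queueRate_le_one ..
  have h1 := integral_sq_queueTreated_sub_le (θ := θ) hA τ b n k
  have h2 := integral_sq_queueSize_sub_le (P := P) (θ := θ) n k
  have h3 := sq_queueRate_sub_le (θ := θ) hA hA_cont τ b n k
  have i1 := ((memLp_queueTreated (P := P) (θ := θ) τ b n k).sub
    (memLp_const g)).integrable_sq
  have i2 := ((memLp_queueSize (P := P) (θ := θ) n k).sub
    (memLp_const (n * q))).integrable_sq
  have h4 := integral_mono_of_nonneg (μ := sampleLaw P θ)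
    (f := fun ω => (queueTreated τ b n k (arrivals ω) - r * queueSize n k (arrivals ω)) ^ 2)
    (Eventually.of_forall fun ω => sq_nonneg _)
    (((i1.const_mul 3).add (i2.const_mul 3)).add (integrable_const (3 * (n * (r * q) - g) ^ 2)))
    (Eventually.of_forall fun ω => by
      simp only [Pi.add_apply, Pi.sub_apply]
      set x := queueTreated τ b n k (arrivals ω)
      set y := queueSize n k (arrivals ω)
      -- Three deviations: treated count from fluid, queue size from its mean, and mean treated
      -- count from fluid. Their bounds `4τn`, `n` and `4τn`, each times three, add up to `(24τ +
      -- 3)n`.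
      have e1 : (x - r * y) ^ 2
          ≤ 3 * (x - g) ^ 2 + 3 * (r * (y - n * q)) ^ 2 + 3 * (n * (r * q) - g) ^ 2 := by
        nlinarith [sq_nonneg ((x - g) + r * (y - n * q)), sq_nonneg ((x - g) + (n * (r * q) - g)),
          sq_nonneg (r * (y - n * q) - (n * (r * q) - g))]
      have e2 : (r * (y - n * q)) ^ 2 ≤ (y - n * q) ^ 2 := by
        rw [mul_pow]
        exact mul_le_of_le_one_left (sq_nonneg _) (pow_le_one₀ hr0 hr1)
      linarith)
  refine h4.trans ?_
  rw [integral_add' ((i1.const_mul 3).add (i2.const_mul 3)) (integrable_const _),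
    integral_add' (i1.const_mul 3) (i2.const_mul 3), integral_const_mul, integral_const_mul]
  simp only [Pi.sub_apply, integral_const, probReal_univ, smul_eq_mul, one_mul]
  linarith

/-- The limit of the probability of treatment in queue `k`. -/
lemma tendsto_queueRate (hA : IndepFun (arr (d := d)) (fun o : Obs d => o.2) P)
    (hA_cont : ∀ s : ℝ, P {o | arr o = s} = 0) {τ : ℕ}
    (hA_range : ∀ᵐ o ∂P, arr o ∈ Set.Icc (0 : ℝ) τ) {b : ℕ → ℕ → ℕ} {β : ℝ}
    (h_budget : Tendsto
      (fun n : ℕ => ⨆ t : Set.Icc 1 τ,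
        |1 / (n : ℝ) * ∑ s ∈ Finset.Icc 1 (t : ℕ), (b n s : ℝ) - β * P.real {o | arr o ≤ (t : ℕ)}|)
      atTop (𝓝 0)) (k : Fin K) (hk : queueProb P θ k ≠ 0) :
    ∃ r, Tendsto (fun n => queueRate P θ τ b n k) atTop (𝓝 r) := by
  set F : ℕ → ℝ := fun t => P.real {o : Obs d | arr o ≤ (t : ℝ)} with hF
  have hF0 : F 0 = 0 := by
    simp only [hF, Nat.cast_zero]
    rw [measureReal_eq_zero_iff]
    refine measure_mono_null_ae ?_ (hA_cont 0)
    filter_upwards [hA_range] with o ho h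
    exact le_antisymm h ho.1
  have hFm : Monotone F := fun s t hst => measureReal_mono fun o (ho : arr o ≤ s) =>
    show arr o ≤ t from ho.trans (by exact_mod_cast hst)
  have hc : ∀ t ≤ τ, Tendsto (fun n : ℕ => (∑ s ∈ Finset.Icc 1 t, (b n s : ℝ)) / n) atTop
      (𝓝 (β * F t)) := by
    intro t ht
    -- The supremum in the budget condition starts at `t = 1`; at `t = 0` both sides vanish because
    -- arrival times have no atom at zero.
    rcases Nat.eq_zero_or_pos t with rfl | h0
    · simp [hF0]
    · rw [tendsto_iff_norm_sub_tendsto_zero]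
      refine squeeze_zero (fun n => norm_nonneg _) (fun n => ?_) h_budget
      have := le_ciSup (f := fun t : Set.Icc 1 τ =>
        |1 / (n : ℝ) * ∑ s ∈ Finset.Icc 1 (t : ℕ), (b n s : ℝ) - β * P.real {o | arr o ≤ (t : ℕ)}|)
        (Set.finite_range _).bddAbove ⟨t, h0, ht⟩
      refine le_trans (le_of_eq ?_) this
      rw [Real.norm_eq_abs]
      congr 2
      ring
  have hlim : ∀ k, ∃ l, Tendsto (fun n : ℕ => fluidCount P θ τ b n k / n) atTop (𝓝 l) :=
    fun k => ⟨_, tendsto_fluid_div τ F hF0 hFm (queueProbBelow P θ k) β _ hc τ le_rfl⟩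
  obtain ⟨l1, h1⟩ := hlim (k + 1)
  obtain ⟨l2, h2⟩ := hlim k
  have h3 : Tendsto (fun n : ℕ => queueRate P θ τ b n k * queueProb P θ k
      - fluidTreated P θ τ b n k / n) atTop (𝓝 0) := by
    rw [tendsto_zero_iff_norm_tendsto_zero]
    -- The bound `4τn` of `sq_queueRate_sub_le`, divided by `n²`.
    have h4 : Tendsto (fun n : ℕ => Real.sqrt (4 * τ / n)) atTop (𝓝 0) := by
      have := (Real.continuous_sqrt.tendsto 0).comp
        (tendsto_const_div_atTop_nhds_zero_nat (4 * (τ : ℝ)))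
      rw [Real.sqrt_zero] at this
      exact this
    refine squeeze_zero' (Eventually.of_forall fun n => norm_nonneg _) ?_ h4
    filter_upwards [eventually_gt_atTop 0] with n hn
    have hn' : (0 : ℝ) < n := by exact_mod_cast hn
    rw [Real.norm_eq_abs]
    refine Real.abs_le_sqrt ?_
    have h5 := sq_queueRate_sub_le (θ := θ) hA hA_cont τ b n k
    rw [le_div_iff₀ hn']
    have e : (n * (queueRate P θ τ b n k * queueProb P θ k) - fluidTreated P θ τ b n k)
        = n * (queueRate P θ τ b n k * queueProb P θ k - fluidTreated P θ τ b n k / n) := by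
      field_simp
    rw [e, mul_pow] at h5
    refine le_of_mul_le_mul_left ?_ hn'
    linarith
  have h6 := h3.add (h1.sub h2)
  refine ⟨(0 + (l1 - l2)) / queueProb P θ k, (h6.div_const (queueProb P θ k)).congr fun n => ?_⟩
  rw [fluidTreated]
  field_simp
  ring

end Concentration

section SecondMoments

variable {d K : ℕ} {P : Measure (Obs d)} [IsProbabilityMeasure P]
  {θ : Kernel (EuclideanSpace ℝ (Fin d)) (Fin K)} [IsMarkovKernel θ]

/-! ### The asymptotic propensity score -/

lemma queueProb_eq_zero_ae {k : Fin K} (hk : queueProb P θ k = 0) :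
    ∀ᵐ x ∂(covLaw P), (θ x).real {k} = 0 := by
  rw [queueProb, integral_eq_zero_iff_of_nonneg (fun x => queueProb_nonneg θ k x)] at hk
  · exact hk
  · exact Integrable.of_bound (measurable_queueProb θ k).aestronglyMeasurable 1
      (Eventually.of_forall fun x => by
        rw [Real.norm_of_nonneg (queueProb_nonneg θ k x)]; exact queueProb_le_one θ k x)

/-- The rate converges in every queue of positive probability; the remaining queues have weight
`θ_k(x) = 0` for almost every `x`. -/
lemma tendsto_propensity (hA : IndepFun (arr (d := d)) (fun o : Obs d => o.2) P)
    (hA_cont : ∀ s : ℝ, P {o | arr o = s} = 0) {τ : ℕ}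
    (hA_range : ∀ᵐ o ∂P, arr o ∈ Set.Icc (0 : ℝ) τ) {b : ℕ → ℕ → ℕ} {β : ℝ}
    (h_budget : Tendsto
      (fun n : ℕ => ⨆ t : Set.Icc 1 τ,
        |1 / (n : ℝ) * ∑ s ∈ Finset.Icc 1 (t : ℕ), (b n s : ℝ) - β * P.real {o | arr o ≤ (t : ℕ)}|)
      atTop (𝓝 0)) :
    ∀ᵐ x ∂(covLaw P),
      Tendsto (fun n => propensity P θ τ b n x) atTop (𝓝 (asympPropensity P θ τ b x)) := by
  have h1 : ∀ᵐ x ∂(covLaw P), ∀ k : Fin K,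
      ∃ r, Tendsto (fun n => (θ x).real {k} * queueRate P θ τ b n k) atTop (𝓝 r) := by
    rw [ae_all_iff]
    intro k
    by_cases hk : queueProb P θ k = 0
    · filter_upwards [queueProb_eq_zero_ae hk] with x hx
      exact ⟨0, by simp [hx]⟩
    · obtain ⟨r, hr⟩ := tendsto_queueRate (θ := θ) hA hA_cont hA_range h_budget k hk
      exact Eventually.of_forall fun x => ⟨_, hr.const_mul _⟩
  have h2 : ∀ᵐ x ∂(covLaw P), ∀ n, propensity P θ τ b n x = queueScore P θ τ b n x :=
    ae_all_iff.2 fun n => propensity_ae_eq hA τ b n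
  filter_upwards [h1, h2] with x hx hx2
  choose r hr using hx
  refine tendsto_nhds_limUnder ⟨∑ k, r k, ?_⟩
  simp_rw [hx2]
  exact tendsto_finsetSum _ fun k _ => hr k

/-! ### The contribution of the errors of the outcome regressions -/

lemma memLp_cov {g : EuclideanSpace ℝ (Fin d) → ℝ} (hg : MemLp g 2 (covLaw P)) :
    MemLp (fun o : Obs d => g (cov o)) 2 P :=
  hg.comp_measurePreserving (MeasurePreserving.mk (μb := covLaw P) measurable_cov rfl)

/-- Jensen and `θ_k ≤ 1`. For a null queue both sides are zero, since `1 / 0 = 0`. -/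
lemma sq_queueMean_le {g : EuclideanSpace ℝ (Fin d) → ℝ} (hg : MemLp g 2 (covLaw P)) (k : Fin K) :
    queueMean P θ (fun v => g v.1) k ^ 2 ≤ (1 / queueProb P θ k) ^ 2 * ∫ x, g x ^ 2 ∂(covLaw P) := by
  have hgP := memLp_cov hg
  have hq : Measurable fun o : Obs d => (θ (cov o)).real {k} :=
    (measurable_queueProb θ k).comp measurable_cov
  have hθ : ∀ o : Obs d, |(θ (cov o)).real {k} * g (cov o)| ≤ |g (cov o)| := fun o => by
    rw [abs_mul, abs_of_nonneg (queueProb_nonneg θ k _)]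
    exact mul_le_of_le_one_left (abs_nonneg _) (queueProb_le_one θ k _)
  have hL : MemLp (fun o : Obs d => (θ (cov o)).real {k} * g (cov o)) 2 P :=
    hgP.mono (hq.aestronglyMeasurable.mul hgP.aestronglyMeasurable) (Eventually.of_forall hθ)
  have h1 := sq_integral_le hL
  have h2 : ∫ o, ((θ (cov o)).real {k} * g (cov o)) ^ 2 ∂P ≤ ∫ o, g (cov o) ^ 2 ∂P :=
    integral_mono hL.integrable_sq hgP.integrable_sq fun o => sq_le_sq.2 (hθ o)
  have h3 : ∫ o, g (cov o) ^ 2 ∂P = ∫ x, g x ^ 2 ∂(covLaw P) :=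
    integral_comp_of_measurePreserving (MeasurePreserving.mk (μb := covLaw P) measurable_cov rfl)
      (hg.aestronglyMeasurable.pow 2)
  rw [queueMean, div_eq_mul_one_div, mul_pow, mul_comm]
  exact mul_le_mul_of_nonneg_left (h1.trans (h2.trans_eq h3)) (sq_nonneg _)

lemma memLp_bounded_arrivals_mul {c : (ℕ → ℝ × Fin K) → ℝ} (hc : Measurable c)
    (hb : ∀ u, |c u| ≤ 1) {H : (ℕ → Obs d × Fin K) → ℝ} (hH : MemLp H 2 (sampleLaw P θ)) :
    MemLp (fun ω => c (arrivals ω) * H ω) 2 (sampleLaw P θ) := by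
  refine hH.mono ((hc.comp measurable_arrivals).aestronglyMeasurable.mul hH.aestronglyMeasurable)
    (Eventually.of_forall fun ω => ?_)
  rw [norm_mul]
  exact mul_le_of_le_one_left (norm_nonneg _) (hb _)

lemma integral_sq_bounded_arrivals_mul_le {c : (ℕ → ℝ × Fin K) → ℝ} (hc : Measurable c)
    (hb : ∀ u, |c u| ≤ 1) {H : (ℕ → Obs d × Fin K) → ℝ} (hH : MemLp H 2 (sampleLaw P θ)) :
    ∫ ω, (c (arrivals ω) * H ω) ^ 2 ∂(sampleLaw P θ) ≤ ∫ ω, H ω ^ 2 ∂(sampleLaw P θ) :=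
  integral_mono (memLp_bounded_arrivals_mul hc hb hH).integrable_sq hH.integrable_sq fun ω => by
    rw [mul_pow]
    exact mul_le_of_le_one_left (sq_nonneg _) ((sq_le_one_iff_abs_le_one _).2 (hb _))

variable (P θ) in
/-- A bound for the mean squares of the queue means. -/
noncomputable def queueMeanConst : ℝ := ∑ k : Fin K, (1 / queueProb P θ k) ^ 2

lemma queueMeanConst_nonneg : 0 ≤ queueMeanConst P θ :=
  Finset.sum_nonneg fun _ _ => sq_nonneg _

lemma sq_queueMean_le' {g : EuclideanSpace ℝ (Fin d) → ℝ} (hg : MemLp g 2 (covLaw P)) (k : Fin K) :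
    queueMean P θ (fun v => g v.1) k ^ 2 ≤ queueMeanConst P θ * ∫ x, g x ^ 2 ∂(covLaw P) :=
  (sq_queueMean_le hg k).trans (mul_le_mul_of_nonneg_right
    (Finset.single_le_sum (f := fun k => (1 / queueProb P θ k) ^ 2) (fun _ _ => sq_nonneg _)
      (Finset.mem_univ k)) (integral_nonneg fun _ => sq_nonneg _))

lemma measurable_fin_snd (h : Fin K → ℝ) (i : ℕ) :
    Measurable fun u : ℕ → ℝ × Fin K => h (u i).2 :=
  (measurable_of_countable h).comp (measurable_snd.comp (measurable_pi_apply i))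

/-- Given `X`, the rate of the randomly drawn queue has mean `∑ θ_k(X) r_k`, which is the score. The
summands are thus i.i.d. and centred, and their first factor is at most one in absolute value. -/
lemma integral_sq_sum_queueRate_sub_score_le (τ : ℕ) (b : ℕ → ℕ → ℕ) (n : ℕ)
    {g : EuclideanSpace ℝ (Fin d) → ℝ} (hg : MemLp g 2 (covLaw P)) :
    MemLp (fun ω : ℕ → Obs d × Fin K => ∑ i ∈ Finset.range n,
      (queueRate P θ τ b n (ω i).2 - queueScore P θ τ b n (cov (ω i).1)) * g (cov (ω i).1)) 2
      (sampleLaw P θ) ∧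
    ∫ ω, (∑ i ∈ Finset.range n,
      (queueRate P θ τ b n (ω i).2 - queueScore P θ τ b n (cov (ω i).1)) * g (cov (ω i).1)) ^ 2
      ∂(sampleLaw P θ) ≤ n * ∫ x, g x ^ 2 ∂(covLaw P) := by
  set f : Obs d × Fin K → ℝ := fun y =>
    (queueRate P θ τ b n y.2 - queueScore P θ τ b n (cov y.1)) * g (cov y.1) with hf
  have hcy : MeasurePreserving (fun y : Obs d × Fin K => cov y.1) (unitLaw P θ) (covLaw P) :=
    (MeasurePreserving.mk (μb := covLaw P) measurable_cov rfl).comp (measurePreserving_fst_unitLaw θ)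
  have hgy : MemLp (fun y : Obs d × Fin K => g (cov y.1)) 2 (unitLaw P θ) :=
    hg.comp_measurePreserving hcy
  have hle : ∀ y, |f y| ≤ |g (cov y.1)| := fun y => by
    rw [hf, abs_mul]
    refine mul_le_of_le_one_left (abs_nonneg _) ?_
    have h1 := queueRate_nonneg (P := P) (θ := θ) τ b n y.2
    have h2 := queueRate_le_one (P := P) (θ := θ) τ b n y.2
    have h3 := queueScore_nonneg (P := P) (θ := θ) τ b n (cov y.1)
    have h4 := queueScore_le_one (P := P) (θ := θ) τ b n (cov y.1)
    rw [abs_le]; constructor <;> linarith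
  have hfm : AEStronglyMeasurable f (unitLaw P θ) :=
    AEStronglyMeasurable.mul (((measurable_of_countable (queueRate P θ τ b n)).comp
      measurable_snd).sub ((measurable_queueScore τ b n).comp
        hcy.measurable)).aestronglyMeasurable hgy.aestronglyMeasurable
  have hfL : MemLp f 2 (unitLaw P θ) := hgy.mono hfm (Eventually.of_forall hle)
  have h0 : ∫ y, f y ∂(unitLaw P θ) = 0 := by
    rw [(integral_unitLaw (hfL.integrable (by norm_num))).2]
    refine integral_eq_zero_of_ae (Eventually.of_forall fun o => ?_)
    simp only [hf, Pi.zero_apply, ← mul_assoc, ← Finset.sum_mul, mul_sub, Finset.sum_sub_distrib,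
      sum_queueProb]
    simp [queueScore]
  refine ⟨memLp_finsetSum _ fun i _ => hfL.comp_measurePreserving
    (measurePreserving_eval_sampleLaw i), ?_⟩
  refine (integral_sq_sum_iid hfL h0 n).trans_le (mul_le_mul_of_nonneg_left ?_ (Nat.cast_nonneg n))
  rw [← integral_comp_of_measurePreserving hcy (g := fun x => g x ^ 2)
    (hg.aestronglyMeasurable.pow 2)]
  exact integral_mono hfL.integrable_sq hgy.integrable_sq fun y => sq_le_sq.2 (hle y)

/-- The first factors are dependent across units, but they are functions of the arrivals and queues.
The second factors are centred given these, which kills all cross terms. -/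
lemma integral_sq_sum_status_sub_queueMean_le
    (hA : IndepFun (arr (d := d)) (fun o : Obs d => o.2) P) (τ : ℕ) (b : ℕ → ℕ → ℕ) (n : ℕ)
    {g : EuclideanSpace ℝ (Fin d) → ℝ} (hg : MemLp g 2 (covLaw P)) :
    MemLp (fun ω : ℕ → Obs d × Fin K => ∑ i ∈ Finset.range n,
      (status τ b n true i (arrivals ω) - queueRate P θ τ b n (ω i).2)
        * (g (cov (ω i).1) - queueMean P θ (fun v => g v.1) (ω i).2)) 2 (sampleLaw P θ) ∧
    ∫ ω, (∑ i ∈ Finset.range n,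
      (status τ b n true i (arrivals ω) - queueRate P θ τ b n (ω i).2)
        * (g (cov (ω i).1) - queueMean P θ (fun v => g v.1) (ω i).2)) ^ 2
      ∂(sampleLaw P θ) ≤ n * ((2 + 2 * queueMeanConst P θ) * ∫ x, g x ^ 2 ∂(covLaw P)) := by
  set G : EuclideanSpace ℝ (Fin d) × (Bool → ℝ) → ℝ := fun v => g v.1
  set c : ℕ → (ℕ → ℝ × Fin K) → ℝ := fun i u =>
    status τ b n true i u - queueRate P θ τ b n (u i).2
  set ξ : Obs d × Fin K → ℝ := fun y => G y.1.2 - queueMean P θ G y.2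
  have hcm : ∀ i, Measurable (c i) := fun i =>
    (measurable_status ..).sub (measurable_fin_snd _ i)
  have hcb : ∀ i u, |c i u| ≤ 1 := fun i u => by
    have h1 := queueRate_nonneg (P := P) (θ := θ) τ b n (u i).2
    have h2 := queueRate_le_one (P := P) (θ := θ) τ b n (u i).2
    have h3 := status_nonneg τ b n true i u
    have h4 := status_le_one τ b n true i u
    rw [abs_le]; constructor <;> simp only [c] <;> linarith
  have hgP := memLp_cov hg
  have hξ : Centred P θ ξ := centred_sub_queueMean hA (hgP.integrable (by norm_num))
  have hcy : MeasurePreserving (fun y : Obs d × Fin K => cov y.1) (unitLaw P θ) (covLaw P) :=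
    (MeasurePreserving.mk (μb := covLaw P) measurable_cov rfl).comp (measurePreserving_fst_unitLaw θ)
  have hgy : MemLp (fun y : Obs d × Fin K => g (cov y.1)) 2 (unitLaw P θ) :=
    hg.comp_measurePreserving hcy
  set M := queueMeanConst P θ * ∫ x, g x ^ 2 ∂(covLaw P)
  have hqm : Measurable fun y : Obs d × Fin K => queueMean P θ G y.2 :=
    (measurable_of_countable (queueMean P θ G)).comp measurable_snd
  have hξL : MemLp ξ 2 (unitLaw P θ) := by
    refine hgy.sub (MemLp.of_bound hqm.aestronglyMeasurable (Real.sqrt M)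
      (Eventually.of_forall fun y => ?_))
    exact Real.abs_le_sqrt (sq_queueMean_le' hg y.2)
  have hξi : ∀ i, MemLp (fun ω : ℕ → Obs d × Fin K => ξ (ω i)) 2 (sampleLaw P θ) := fun i =>
    hξL.comp_measurePreserving (measurePreserving_eval_sampleLaw i)
  have hξ2 : ∫ y, ξ y ^ 2 ∂(unitLaw P θ)
      ≤ (2 + 2 * queueMeanConst P θ) * ∫ x, g x ^ 2 ∂(covLaw P) := by
    have := integral_mono hξL.integrable_sq
      ((hgy.integrable_sq.const_mul 2).add (integrable_const (2 * M))) fun y => by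
        have h1 := sq_queueMean_le' (θ := θ) hg y.2
        change (g (cov y.1) - queueMean P θ G y.2) ^ 2 ≤ 2 * g (cov y.1) ^ 2 + 2 * M
        nlinarith [sq_nonneg (g (cov y.1) + queueMean P θ G y.2)]
    refine this.trans_eq ?_
    rw [integral_add' (hgy.integrable_sq.const_mul 2) (integrable_const _), integral_const_mul]
    rw [integral_comp_of_measurePreserving hcy (g := fun x => g x ^ 2)
      (hg.aestronglyMeasurable.pow 2)]
    simp only [integral_const, probReal_univ, smul_eq_mul, one_mul, M]
    ring
  refine ⟨memLp_finsetSum _ fun i _ => memLp_bounded_arrivals_mul (hcm i) (hcb i) (hξi i), ?_⟩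
  refine (integral_sq_sum_of_orthogonal (Finset.range n)
    (fun i ω => c i (arrivals ω) * ξ (ω i))
    (fun i _ => memLp_bounded_arrivals_mul (hcm i) (hcb i) (hξi i)) ?_).trans_le ?_
  · intro i _ j _ hij
    have := integral_mul_centred_mul (θ := θ) (c := fun u => c i u * c j u)
      ((hcm i).mul (hcm j)) ⟨1, fun u => by
        rw [abs_mul]; exact mul_le_one₀ (hcb i u) (abs_nonneg _) (hcb j u)⟩ hξ i
      (H := fun ω => ξ (ω j)) (fun ω y => by simp [Function.update_of_ne hij.symm])
    rw [← this]
    exact integral_congr_ae (Eventually.of_forall fun ω => by simp only; ring)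
  · refine (Finset.sum_le_sum fun i _ =>
      (integral_sq_bounded_arrivals_mul_le (hcm i) (hcb i) (hξi i)).trans_eq
      (integral_comp_of_measurePreserving (measurePreserving_eval_sampleLaw i)
        (g := fun y => ξ y ^ 2) (hξL.aestronglyMeasurable.pow 2))).trans ?_
    rw [Finset.sum_const, Finset.card_range, nsmul_eq_mul]
    exact mul_le_mul_of_nonneg_left hξ2 (Nat.cast_nonneg n)

/-- This is the part where dependence of the statuses really matters: orthogonality is unavailable,
and the concentration of treated counts relative to queue sizes replaces it. Cauchy–Schwarz over the
queues costs the factor `K`. -/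
lemma integral_sq_sum_queueMean_le
    (hA : IndepFun (arr (d := d)) (fun o : Obs d => o.2) P)
    (hA_cont : ∀ s : ℝ, P {o | arr o = s} = 0) (τ : ℕ) (b : ℕ → ℕ → ℕ) (n : ℕ)
    {g : EuclideanSpace ℝ (Fin d) → ℝ} (hg : MemLp g 2 (covLaw P)) :
    MemLp (fun ω : ℕ → Obs d × Fin K => ∑ k, queueMean P θ (fun v => g v.1) k *
      (queueTreated τ b n k (arrivals ω) - queueRate P θ τ b n k * queueSize n k (arrivals ω))) 2
      (sampleLaw P θ) ∧
    ∫ ω, (∑ k, queueMean P θ (fun v => g v.1) k *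
      (queueTreated τ b n k (arrivals ω) - queueRate P θ τ b n k * queueSize n k (arrivals ω))) ^ 2
      ∂(sampleLaw P θ)
      ≤ n * ((K * queueMeanConst P θ * (24 * τ + 3)) * ∫ x, g x ^ 2 ∂(covLaw P)) := by
  have hL : ∀ k, MemLp (fun ω : ℕ → Obs d × Fin K => queueTreated τ b n k (arrivals ω)
      - queueRate P θ τ b n k * queueSize n k (arrivals ω)) 2 (sampleLaw P θ) := fun k =>
    (memLp_queueTreated τ b n k).sub ((memLp_queueSize n k).const_mul _)
  refine ⟨memLp_finsetSum _ fun k _ => (hL k).const_mul _, ?_⟩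
  refine (integral_mono_of_nonneg (Eventually.of_forall fun ω => sq_nonneg _)
    ((integrable_finsetSum Finset.univ fun k _ =>
      ((hL k).const_mul (queueMean P θ (fun v => g v.1) k)).integrable_sq).const_mul (K : ℝ))
    (Eventually.of_forall fun ω => ?_)).trans ?_
  · have := sq_sum_le_card_mul_sum_sq (s := (Finset.univ : Finset (Fin K)))
      (f := fun k => queueMean P θ (fun v => g v.1) k * (queueTreated τ b n k (arrivals ω)
        - queueRate P θ τ b n k * queueSize n k (arrivals ω)))
    simpa using this
  · rw [integral_const_mul, integral_finsetSum _ fun k _ => ((hL k).const_mul _).integrable_sq]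
    simp_rw [mul_pow, integral_const_mul]
    have h1 : ∀ k : Fin K, queueMean P θ (fun v => g v.1) k ^ 2 * ∫ ω,
        (queueTreated τ b n k (arrivals ω) - queueRate P θ τ b n k * queueSize n k (arrivals ω)) ^ 2
          ∂(sampleLaw P θ)
        ≤ ((1 / queueProb P θ k) ^ 2 * ∫ x, g x ^ 2 ∂(covLaw P)) * ((24 * τ + 3) * n) := fun k =>
      mul_le_mul (sq_queueMean_le hg k)
        (integral_sq_queueTreated_sub_queueSize_le hA hA_cont τ b n k)
        (integral_nonneg fun _ => sq_nonneg _)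
        (mul_nonneg (sq_nonneg _) (integral_nonneg fun _ => sq_nonneg _))
    refine (mul_le_mul_of_nonneg_left (Finset.sum_le_sum fun k _ => h1 k)
      (Nat.cast_nonneg K)).trans_eq ?_
    rw [← Finset.sum_mul, ← Finset.sum_mul, queueMeanConst]
    ring

variable (P θ) in
/-- The constant in the bound for the contribution of the regression errors. -/
noncomputable def errorConst (τ : ℕ) : ℝ :=
  3 * (1 + (2 + 2 * queueMeanConst P θ) + K * queueMeanConst P θ * (24 * τ + 3))

lemma errorConst_nonneg (τ : ℕ) : 0 ≤ errorConst P θ τ := by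
  have := queueMeanConst_nonneg (P := P) (θ := θ)
  unfold errorConst
  positivity

/-- Insert `r(Q)` between `Z` and the score, and `h(Q)` into `g`; the terms with `h(Q)` are then
grouped by queue. In the application `h` is the mean of `g` in the queue. -/
lemma sum_status_sub_score_eq (τ : ℕ) (b : ℕ → ℕ → ℕ) (n : ℕ)
    (g : EuclideanSpace ℝ (Fin d) → ℝ) (h : Fin K → ℝ) (ω : ℕ → Obs d × Fin K) :
    ∑ i ∈ Finset.range n, (status τ b n true i (arrivals ω) - queueScore P θ τ b n (cov (ω i).1))
        * g (cov (ω i).1)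
      = (∑ i ∈ Finset.range n,
        (queueRate P θ τ b n (ω i).2 - queueScore P θ τ b n (cov (ω i).1)) * g (cov (ω i).1))
      + (∑ i ∈ Finset.range n, (status τ b n true i (arrivals ω) - queueRate P θ τ b n (ω i).2)
        * (g (cov (ω i).1) - h (ω i).2))
      + ∑ k, h k * (queueTreated τ b n k (arrivals ω)
          - queueRate P θ τ b n k * queueSize n k (arrivals ω)) := by
  have e : ∑ k, h k * (queueTreated τ b n k (arrivals ω)
          - queueRate P θ τ b n k * queueSize n k (arrivals ω))
      = ∑ i ∈ Finset.range n, (status τ b n true i (arrivals ω) - queueRate P θ τ b n (ω i).2)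
        * h (ω i).2 := by
    simp_rw [queueTreated, queueSize, Finset.mul_sum, ← Finset.sum_sub_distrib, Finset.mul_sum]
    rw [Finset.sum_comm]
    refine Finset.sum_congr rfl fun i _ => ?_
    rw [Finset.sum_eq_single (ω i).2]
    · simp [arrivals]; ring
    · intro k _ hk; simp [arrivals, hk.symm]
    · simp
  rw [e, ← Finset.sum_add_distrib, ← Finset.sum_add_distrib]
  exact Finset.sum_congr rfl fun i _ => by ring

/-- The sum of the products of the centred status and a function of the covariates is of the order
of the square root of the sample size. -/
lemma integral_sq_sum_status_sub_score_le
    (hA : IndepFun (arr (d := d)) (fun o : Obs d => o.2) P)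
    (hA_cont : ∀ s : ℝ, P {o | arr o = s} = 0) (τ : ℕ) (b : ℕ → ℕ → ℕ) (n : ℕ)
    {g : EuclideanSpace ℝ (Fin d) → ℝ} (hg : MemLp g 2 (covLaw P)) :
    MemLp (fun ω : ℕ → Obs d × Fin K => ∑ i ∈ Finset.range n,
      (status τ b n true i (arrivals ω) - queueScore P θ τ b n (cov (ω i).1)) * g (cov (ω i).1)) 2
      (sampleLaw P θ) ∧
    ∫ ω, (∑ i ∈ Finset.range n,
      (status τ b n true i (arrivals ω) - queueScore P θ τ b n (cov (ω i).1))
        * g (cov (ω i).1)) ^ 2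
      ∂(sampleLaw P θ) ≤ n * (errorConst P θ τ * ∫ x, g x ^ 2 ∂(covLaw P)) := by
  obtain ⟨l1, h1⟩ := integral_sq_sum_queueRate_sub_score_le (θ := θ) τ b n hg
  obtain ⟨l2, h2⟩ := integral_sq_sum_status_sub_queueMean_le (θ := θ) hA τ b n hg
  obtain ⟨l3, h3⟩ := integral_sq_sum_queueMean_le (θ := θ) hA hA_cont τ b n hg
  simp_rw [sum_status_sub_score_eq τ b n g (queueMean P θ fun v => g v.1)]
  refine ⟨(l1.add l2).add l3, ?_⟩
  refine (integral_mono_of_nonneg (Eventually.of_forall fun ω => sq_nonneg _)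
    (((l1.integrable_sq.const_mul 3).add (l2.integrable_sq.const_mul 3)).add
      (l3.integrable_sq.const_mul 3)) (Eventually.of_forall fun ω => ?_)).trans ?_
  · simp only [Pi.add_apply]
    set x := ∑ i ∈ Finset.range n,
        (queueRate P θ τ b n (ω i).2 - queueScore P θ τ b n (cov (ω i).1)) * g (cov (ω i).1)
    set y := ∑ i ∈ Finset.range n, (status τ b n true i (arrivals ω) - queueRate P θ τ b n (ω i).2)
        * (g (cov (ω i).1) - queueMean P θ (fun v => g v.1) (ω i).2)
    set w := ∑ k, queueMean P θ (fun v => g v.1) k * (queueTreated τ b n k (arrivals ω)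
          - queueRate P θ τ b n k * queueSize n k (arrivals ω))
    nlinarith [sq_nonneg (x - y), sq_nonneg (x - w), sq_nonneg (y - w)]
  · rw [integral_add' ((l1.integrable_sq.const_mul 3).add (l2.integrable_sq.const_mul 3))
      (l3.integrable_sq.const_mul 3), integral_add' (l1.integrable_sq.const_mul 3)
      (l2.integrable_sq.const_mul 3), integral_const_mul, integral_const_mul, integral_const_mul,
      errorConst]
    linarith

/-- Exchangeability moves each unit to unit `0`, whose status has the score as conditional mean
given `X`. -/
lemma integral_sum_status_sub_score (hA : IndepFun (arr (d := d)) (fun o : Obs d => o.2) P)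
    (hA_cont : ∀ s : ℝ, P {o | arr o = s} = 0) (τ : ℕ) (b : ℕ → ℕ → ℕ) (n : ℕ)
    {g : EuclideanSpace ℝ (Fin d) → ℝ} (hg : MemLp g 2 (covLaw P)) :
    ∫ ω, (∑ i ∈ Finset.range n,
      (status τ b n true i (arrivals ω) - queueScore P θ τ b n (cov (ω i).1))
        * g (cov (ω i).1)) ∂(sampleLaw P θ) = 0 := by
  have hgi := hg.integrable (by norm_num)
  have hgP := (memLp_cov hg).integrable (by norm_num)
  have hX := fun i => measurePreserving_cov_sampleLaw (P := P) (θ := θ) i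
  have hqg : Integrable (fun x => queueScore P θ τ b n x * g x) (covLaw P) :=
    hgi.bdd_mul (c := 1) (measurable_queueScore τ b n).aestronglyMeasurable
      (Eventually.of_forall (abs_queueScore_le_one τ b n))
  have i1 : ∀ i, Integrable (fun ω : ℕ → Obs d × Fin K =>
      status τ b n true i (arrivals ω) * g (cov (ω i).1)) (sampleLaw P θ) := fun i =>
    integrable_bounded_mul (measurable_status ..) ⟨1, abs_status_le_one τ b n true i⟩
      ((hX i).integrable_comp_of_integrable hgi)
  have i2 : ∀ i, Integrable (fun ω : ℕ → Obs d × Fin K =>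
      queueScore P θ τ b n (cov (ω i).1) * g (cov (ω i).1)) (sampleLaw P θ) := fun i =>
    (hX i).integrable_comp_of_integrable hqg
  have i3 : ∀ i, Integrable (fun ω : ℕ → Obs d × Fin K =>
      status τ b n true i (arrivals ω) * g (cov (ω i).1)
        - queueScore P θ τ b n (cov (ω i).1) * g (cov (ω i).1)) (sampleLaw P θ) := fun i =>
    (i1 i).sub (i2 i)
  simp_rw [sub_mul]
  rw [integral_finsetSum _ fun i _ => i3 i]
  refine Finset.sum_eq_zero fun i hi => ?_
  rw [integral_sub (i1 i) (i2 i), sub_eq_zero]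
  have e1 := integral_status_exchange (θ := θ) hA_cont τ b (Finset.mem_range.1 hi) true
    (fun y => g (cov y.1))
  have e2 := integral_status_mul (θ := θ) hA τ b n (G := fun v => g v.1) hgP
  have e3 := integral_comp_of_measurePreserving (hX i) hqg.aestronglyMeasurable
  have e4 := integral_comp_of_measurePreserving
    (MeasurePreserving.mk (μb := covLaw P) measurable_cov rfl) hqg.aestronglyMeasurable
  exact e1.trans (e2.trans (e4.trans e3.symm))

/-! ### The leading term -/

/-- The weighted residual of the potential outcome `z`. -/
noncomputable def weightedResidual (P : Measure (Obs d)) [IsProbabilityMeasure P]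
    (w : EuclideanSpace ℝ (Fin d) → ℝ) (z : Bool) (o : Obs d) : ℝ :=
  w (cov o) * (pot o z - potMean P z (cov o))

lemma memLp_weightedResidual {z : Bool} (hz : MemLp (fun o => pot o z) 2 P)
    {w : EuclideanSpace ℝ (Fin d) → ℝ} (hw : Measurable w) {C : ℝ}
    (hC : ∀ᵐ x ∂(covLaw P), |w x| ≤ C) : MemLp (weightedResidual P w z) 2 P := by
  have hC' : ∀ᵐ o ∂P, |w (cov o)| ≤ C := ae_of_ae_map measurable_cov.aemeasurable hC
  refine (memLp_residual hz).of_le_mul (c := C)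
    ((hw.comp measurable_cov).aestronglyMeasurable.mul (memLp_residual hz).aestronglyMeasurable) ?_
  filter_upwards [hC'] with o ho
  rw [weightedResidual, norm_mul]
  exact mul_le_mul_of_nonneg_right ho (norm_nonneg _)

/-- Conditioning on the queue only inserts the weight `θ_k(X)`, a function of the covariates, to
which the residual is orthogonal. -/
lemma centred_mul_residual (hA : IndepFun (arr (d := d)) (fun o : Obs d => o.2) P) {z : Bool}
    (hz : MemLp (fun o => pot o z) 2 P) {f : EuclideanSpace ℝ (Fin d) → ℝ} (hf : Measurable f)
    (hi : Integrable (weightedResidual P f z) P) :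
    Centred P θ fun y => weightedResidual P f z y.1 := by
  refine centred_of_queue hA (η := fun _ v => f v.1 * (v.2 z - potMean P z v.1)) (fun _ => hi)
    fun k => ?_
  have := integral_mul_residual hz (f := fun x => (θ x).real {k} * f x)
    ((measurable_queueProb θ k).mul hf)
  rw [← this]
  exact integral_congr_ae (Eventually.of_forall fun o => by
    change _ * (f (cov o) * (pot o z - potMean P z (cov o))) = _; ring)

/-- The orthogonal components of the estimator: the centred effect, and the weighted residuals of
the observed potential outcomes. -/
noncomputable def component (P : Measure (Obs d)) [IsProbabilityMeasure P] (τ : ℕ)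
    (b : ℕ → ℕ → ℕ) (n : ℕ) (δ : EuclideanSpace ℝ (Fin d) → ℝ)
    (w : Bool → EuclideanSpace ℝ (Fin d) → ℝ) (l : ℕ × Option Bool)
    (ω : ℕ → Obs d × Fin K) : ℝ :=
  match l.2 with
  | none => δ (cov (ω l.1).1)
  | some z => status τ b n z l.1 (arrivals ω) * weightedResidual P (w z) z (ω l.1).1

variable {δ : EuclideanSpace ℝ (Fin d) → ℝ} {w : Bool → EuclideanSpace ℝ (Fin d) → ℝ}

lemma memLp_component (hz : ∀ z, MemLp (fun o => pot o z) 2 P) (τ : ℕ)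
    (b : ℕ → ℕ → ℕ) (n : ℕ) (hδL : MemLp δ 2 (covLaw P)) (hw : ∀ z, Measurable (w z)) {C : ℝ}
    (hC : ∀ z, ∀ᵐ x ∂(covLaw P), |w z x| ≤ C) (l : ℕ × Option Bool) :
    MemLp (component P τ b n δ w l) 2 (sampleLaw P θ) := by
  obtain ⟨i, z⟩ := l
  cases z with
  | none => exact hδL.comp_measurePreserving (measurePreserving_cov_sampleLaw i)
  | some z =>
    exact memLp_bounded_arrivals_mul (measurable_status ..) (abs_status_le_one τ b n z i)
      ((memLp_weightedResidual (hz z) (hw z) (hC z)).comp_measurePreserving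
        (measurePreserving_obs_sampleLaw i))

lemma integral_component (hA : IndepFun (arr (d := d)) (fun o : Obs d => o.2) P)
    (hz : ∀ z, MemLp (fun o => pot o z) 2 P) (τ : ℕ)
    (b : ℕ → ℕ → ℕ) (n : ℕ) (hδL : MemLp δ 2 (covLaw P)) (hδ0 : ∫ x, δ x ∂(covLaw P) = 0)
    (hw : ∀ z, Measurable (w z)) {C : ℝ}
    (hC : ∀ z, ∀ᵐ x ∂(covLaw P), |w z x| ≤ C) (l : ℕ × Option Bool) :
    ∫ ω, component P τ b n δ w l ω ∂(sampleLaw P θ) = 0 := by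
  obtain ⟨i, z⟩ := l
  cases z with
  | none =>
    exact (integral_comp_of_measurePreserving (measurePreserving_cov_sampleLaw i)
      hδL.aestronglyMeasurable).trans hδ0
  | some z =>
    exact integral_mul_centred (measurable_status ..) ⟨1, abs_status_le_one τ b n z i⟩
      (centred_mul_residual hA (hz z) (hw z)
        ((memLp_weightedResidual (hz z) (hw z) (hC z)).integrable (by norm_num))) i

/-- A residual times the effect of the same unit is a residual with weight `w δ`, again centred. The
two residuals of one unit cannot both be observed. For different units, a residual, or the centred
effect if there is none, integrates to zero when its unit is resampled. -/
lemma integral_component_mul (hA : IndepFun (arr (d := d)) (fun o : Obs d => o.2) P)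
    (hz : ∀ z, MemLp (fun o => pot o z) 2 P) (τ : ℕ)
    (b : ℕ → ℕ → ℕ) (n : ℕ) (hδ : Measurable δ) (hδL : MemLp δ 2 (covLaw P))
    (hδ0 : ∫ x, δ x ∂(covLaw P) = 0) (hw : ∀ z, Measurable (w z)) {C : ℝ}
    (hC : ∀ z, ∀ᵐ x ∂(covLaw P), |w z x| ≤ C) {l l' : ℕ × Option Bool} (hl : l ≠ l') :
    ∫ ω, component P τ b n δ w l ω * component P τ b n δ w l' ω ∂(sampleLaw P θ) = 0 := by
  have hLw := fun z => memLp_weightedResidual (hz z) (hw z) (hC z)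
  have hcen : ∀ z, Centred P θ fun y => weightedResidual P (w z) z y.1 := fun z =>
    centred_mul_residual hA (hz z) (hw z) ((hLw z).integrable (by norm_num))
  -- a residual and the centred effect
  have h1 : ∀ i j z, ∫ ω, component P τ b n δ w (i, some z) ω * component P τ b n δ w (j, none) ω
      ∂(sampleLaw P θ) = 0 := by
    intro i j z
    by_cases hij : i = j
    · subst hij
      have hi : Integrable (weightedResidual P (fun x => w z x * δ x) z) P := by
        have := (hLw z).integrable_mul (memLp_cov hδL)
        refine this.congr (Eventually.of_forall fun o => ?_)
        simp only [weightedResidual, Pi.mul_apply]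
        ring
      have := integral_mul_centred (θ := θ) (measurable_status τ b n z i)
        ⟨1, abs_status_le_one τ b n z i⟩
        (centred_mul_residual hA (hz z) ((hw z).mul hδ) hi) i
      rw [← this]
      refine integral_congr_ae (Eventually.of_forall fun ω => ?_)
      simp only [component, weightedResidual, Pi.mul_apply]
      ring
    · exact integral_mul_centred_mul (measurable_status ..) ⟨1, abs_status_le_one τ b n z i⟩
        (hcen z) i (H := fun ω => δ (cov (ω j).1))
        (fun ω y => by rw [Function.update_of_ne (Ne.symm hij)])
  obtain ⟨i, z⟩ := l
  obtain ⟨j, z'⟩ := l'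
  match z, z' with
  | some z, none => exact h1 i j z
  | none, some z => simpa only [mul_comm] using h1 j i z
  | none, none =>
    have hij : i ≠ j := fun h => hl (by rw [h])
    have hδu : ∫ y, δ (cov y.1) ∂(unitLaw P θ) = 0 :=
      (integral_comp_of_measurePreserving ((MeasurePreserving.mk (μb := covLaw P)
        measurable_cov rfl).comp (measurePreserving_fst_unitLaw θ))
        hδL.aestronglyMeasurable).trans hδ0
    refine integral_infinitePi_eq_zero (unitLaw P θ) i fun ω => ?_
    simp only [component, Function.update_self, Function.update_of_ne hij.symm]
    rw [integral_mul_const, hδu, zero_mul]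
  | some z, some z' =>
    by_cases hij : i = j
    · subst hij
      have hzz : z ≠ z' := fun h => hl (by rw [h])
      refine integral_eq_zero_of_ae (Eventually.of_forall fun ω => ?_)
      simp only [component, Pi.zero_apply]
      rw [mul_mul_mul_comm, status_mul_status_of_ne τ b n hzz, zero_mul]
    · have := integral_mul_centred_mul (θ := θ)
        (c := fun u => status τ b n z i u * status τ b n z' j u)
        ((measurable_status ..).mul (measurable_status ..)) ⟨1, fun u => by
          rw [abs_mul]
          exact mul_le_one₀ (abs_status_le_one ..) (abs_nonneg _) (abs_status_le_one ..)⟩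
        (hcen z) i (H := fun ω => weightedResidual P (w z') z' (ω j).1)
        (fun ω y => by rw [Function.update_of_ne (Ne.symm hij)])
      rw [← this]
      exact integral_congr_ae (Eventually.of_forall fun ω => by simp only [component]; ring)

/-- The status is its own square, so it enters linearly and may be replaced by its conditional
probability; the squared residual then averages to the conditional variance. -/
lemma integral_sq_component (hA : IndepFun (arr (d := d)) (fun o : Obs d => o.2) P)
    (hA_cont : ∀ s : ℝ, P {o | arr o = s} = 0)
    (hz : ∀ z, MemLp (fun o => pot o z) 2 P) (τ : ℕ)
    (b : ℕ → ℕ → ℕ) (n : ℕ) (hw : ∀ z, Measurable (w z)) {C : ℝ}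
    (hC : ∀ z, ∀ᵐ x ∂(covLaw P), |w z x| ≤ C) (i : ℕ) (hi : i < n) (z : Bool) :
    ∫ ω, component P τ b n δ w (i, some z) ω ^ 2 ∂(sampleLaw P θ)
      = ∫ x, statusScore P θ τ b n z x * w z x ^ 2 * potVar P z x ∂(covLaw P) := by
  have hLw := memLp_weightedResidual (hz z) (hw z) (hC z)
  have e1 : ∀ ω : ℕ → Obs d × Fin K, component P τ b n δ w (i, some z) ω ^ 2
      = status τ b n z i (arrivals ω) * weightedResidual P (w z) z (ω i).1 ^ 2 := fun ω => by
    simp only [component]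
    rw [mul_pow, pow_two (status _ _ _ _ _ _), status_mul_self]
  simp_rw [e1]
  have e2 := integral_status_exchange (θ := θ) hA_cont τ b hi z
    (fun y => weightedResidual P (w z) z y.1 ^ 2)
  have e3 := integral_status_mul' (θ := θ) hA τ b n z
    (G := fun v => (w z v.1 * (v.2 z - potMean P z v.1)) ^ 2) hLw.integrable_sq
  have hC' : ∀ᵐ x ∂(covLaw P), |statusScore P θ τ b n z x * w z x ^ 2| ≤ C ^ 2 := by
    filter_upwards [hC z] with x hx
    rw [abs_mul, abs_pow]
    have h1 := abs_statusScore_le_one (P := P) (θ := θ) τ b n z x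
    have h2 := pow_le_pow_left₀ (abs_nonneg _) hx 2
    exact (mul_le_of_le_one_left (by positivity) h1).trans h2
  have e4 := integral_mul_residual_sq (hz z) (f := fun x => statusScore P θ τ b n z x * w z x ^ 2)
    ((measurable_statusScore τ b n z).mul ((hw z).pow_const 2)) hC'
  refine e2.trans (e3.trans (Eq.trans ?_ e4))
  refine integral_congr_ae (Eventually.of_forall fun o => ?_)
  change _ * (w z (cov o) * (pot o z - potMean P z (cov o))) ^ 2 = _
  simp only
  ring

/-- The second moment of the leading term. -/
lemma integral_sq_sum_component (hA : IndepFun (arr (d := d)) (fun o : Obs d => o.2) P)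
    (hA_cont : ∀ s : ℝ, P {o | arr o = s} = 0)
    (hz : ∀ z, MemLp (fun o => pot o z) 2 P) (τ : ℕ)
    (b : ℕ → ℕ → ℕ) (n : ℕ) (hδ : Measurable δ) (hδL : MemLp δ 2 (covLaw P))
    (hδ0 : ∫ x, δ x ∂(covLaw P) = 0) (hw : ∀ z, Measurable (w z)) {C : ℝ}
    (hC : ∀ z, ∀ᵐ x ∂(covLaw P), |w z x| ≤ C) :
    ∫ ω, (∑ l ∈ Finset.range n ×ˢ Finset.univ, component P τ b n δ w l ω) ^ 2 ∂(sampleLaw P θ)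
      = n * (∫ x, δ x ^ 2 ∂(covLaw P)
        + ∑ z, ∫ x, statusScore P θ τ b n z x * w z x ^ 2 * potVar P z x ∂(covLaw P)) := by
  rw [integral_sq_sum_of_orthogonal _ _ (fun l _ => memLp_component hz τ b n hδL hw hC l)
    (fun l _ l' _ h => integral_component_mul hA hz τ b n hδ hδL hδ0 hw hC h), Finset.sum_product]
  have h : ∀ i ∈ Finset.range n,
      ∑ z, ∫ ω, component P τ b n δ w (i, z) ω ^ 2 ∂(sampleLaw P θ)
      = ∫ x, δ x ^ 2 ∂(covLaw P)
        + ∑ z, ∫ x, statusScore P θ τ b n z x * w z x ^ 2 * potVar P z x ∂(covLaw P) := by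
    intro i hi
    rw [Fintype.sum_option]
    congr 1
    · exact integral_comp_of_measurePreserving (measurePreserving_cov_sampleLaw i)
        (g := fun x => δ x ^ 2) (hδL.aestronglyMeasurable.pow 2)
    · exact Finset.sum_congr rfl fun z _ =>
        integral_sq_component hA hA_cont hz τ b n hw hC i (Finset.mem_range.1 hi) z
  rw [Finset.sum_congr rfl h, Finset.sum_const, Finset.card_range, nsmul_eq_mul]

end SecondMoments

section Variance

variable {d K : ℕ} {P : Measure (Obs d)} [IsProbabilityMeasure P]
  {θ : Kernel (EuclideanSpace ℝ (Fin d)) (Fin K)} [IsMarkovKernel θ]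

/-! ### The variance of the estimator -/

lemma integral_sq_le_of_eLpNorm_le {Ω : Type*} [MeasurableSpace Ω] {μ : Measure Ω} {f : Ω → ℝ}
    (hf : MemLp f 2 μ) {δ : ℝ} (hδ : 0 ≤ δ) (h : eLpNorm f 2 μ ≤ ENNReal.ofReal δ) :
    ∫ ω, f ω ^ 2 ∂μ ≤ δ ^ 2 := by
  rw [hf.eLpNorm_eq_integral_rpow_norm (by norm_num) (by norm_num),
    ENNReal.ofReal_le_ofReal_iff hδ] at h
  have h0 : 0 ≤ ∫ ω, f ω ^ 2 ∂μ := integral_nonneg fun _ => sq_nonneg _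
  have e : ∫ ω, ‖f ω‖ ^ (2 : ENNReal).toReal ∂μ = ∫ ω, f ω ^ 2 ∂μ := by
    simp
  rw [e, ENNReal.toReal_ofNat, ← one_div, ← Real.sqrt_eq_rpow] at h
  exact (Real.sqrt_le_left hδ).1 h

/-- Perturbation of a second moment. -/
lemma abs_integral_sq_add_sub_le {Ω : Type*} [MeasurableSpace Ω] {μ : Measure Ω} {f g : Ω → ℝ}
    (hf : MemLp f 2 μ) (hg : MemLp g 2 μ) {η : ℝ} (hη : 0 < η) :
    |∫ ω, (f ω + g ω) ^ 2 ∂μ - ∫ ω, f ω ^ 2 ∂μ|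
      ≤ η * ∫ ω, f ω ^ 2 ∂μ + (1 + 1 / η) * ∫ ω, g ω ^ 2 ∂μ := by
  have hfg : Integrable (fun ω => (f ω + g ω) ^ 2) μ := (hf.add hg).integrable_sq
  rw [← integral_sub hfg hf.integrable_sq, ← integral_const_mul,
    ← integral_const_mul, ← integral_add (hf.integrable_sq.const_mul _)
      (hg.integrable_sq.const_mul _)]
  refine (abs_integral_le_integral_abs).trans (integral_mono
    (hfg.sub hf.integrable_sq).abs
    ((hf.integrable_sq.const_mul _).add (hg.integrable_sq.const_mul _)) fun ω => ?_)
  -- Young's inequality `2|fg| ≤ η f² + g²/η` for the cross term.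
  have h1 : η * f ω ^ 2 + 1 / η * g ω ^ 2 - 2 * (f ω * g ω) = η * (f ω - g ω / η) ^ 2 := by
    field_simp; ring
  have h2 : η * f ω ^ 2 + 1 / η * g ω ^ 2 + 2 * (f ω * g ω) = η * (f ω + g ω / η) ^ 2 := by
    field_simp; ring
  have h3 : 0 ≤ η * (f ω - g ω / η) ^ 2 := by positivity
  have h4 : 0 ≤ η * (f ω + g ω / η) ^ 2 := by positivity
  rw [abs_le]
  constructor <;> nlinarith [sq_nonneg (g ω)]

/-! ### Decomposition of the estimator and its leading variance -/

/-- The conditional average effect. -/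
noncomputable def potEffect (P : Measure (Obs d)) [IsProbabilityMeasure P]
    (x : EuclideanSpace ℝ (Fin d)) : ℝ := potMean P true x - potMean P false x

variable (P θ) in
/-- The inverse probability weights. -/
noncomputable def scoreWeight (τ : ℕ) (b : ℕ → ℕ → ℕ) (n : ℕ) (z : Bool)
    (x : EuclideanSpace ℝ (Fin d)) : ℝ :=
  if z then 1 / queueScore P θ τ b n x else -(1 / (1 - queueScore P θ τ b n x))

variable (P θ) in
/-- The weighted errors of the outcome regressions. -/
noncomputable def regressionError (τ : ℕ) (b : ℕ → ℕ → ℕ) (n : ℕ)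
    (μh : Bool → EuclideanSpace ℝ (Fin d) → ℝ) (x : EuclideanSpace ℝ (Fin d)) : ℝ :=
  1 / queueScore P θ τ b n x * (potMean P true x - μh true x)
    + 1 / (1 - queueScore P θ τ b n x) * (potMean P false x - μh false x)

lemma measurable_scoreWeight (τ : ℕ) (b : ℕ → ℕ → ℕ) (n : ℕ) (z : Bool) :
    Measurable (scoreWeight P θ τ b n z) := by
  have h := measurable_queueScore (P := P) (θ := θ) τ b n
  cases z
  · exact (measurable_const.div (measurable_const.sub h)).neg
  · exact measurable_const.div h

lemma abs_scoreWeight_le {τ : ℕ} {b : ℕ → ℕ → ℕ} {n : ℕ} {γ : ℝ} (hγ : 0 < γ)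
    (hρ : ∀ᵐ x ∂(covLaw P), γ ≤ queueScore P θ τ b n x ∧ queueScore P θ τ b n x ≤ 1 - γ)
    (z : Bool) : ∀ᵐ x ∂(covLaw P), |scoreWeight P θ τ b n z x| ≤ 1 / γ := by
  filter_upwards [hρ] with x hx
  cases z
  · simp only [scoreWeight, Bool.false_eq_true, if_false, abs_neg]
    rw [abs_of_nonneg (one_div_nonneg.2 (by linarith))]
    exact one_div_le_one_div_of_le hγ (by linarith)
  · simp only [scoreWeight, if_true]
    rw [abs_of_nonneg (one_div_nonneg.2 (by linarith))]
    exact one_div_le_one_div_of_le hγ hx.1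

lemma memLp_potEffect (hz : ∀ z, MemLp (fun o => pot o z) 2 P) :
    MemLp (potEffect P) 2 (covLaw P) :=
  (memLp_potMean (hz true)).sub (memLp_potMean (hz false))

/-- The decomposition of the estimator. -/
lemma drEstimator_ae_eq (hA : IndepFun (arr (d := d)) (fun o : Obs d => o.2) P) {τ : ℕ}
    {b : ℕ → ℕ → ℕ} {n : ℕ} (hn : 0 < n) {γ : ℝ} (hγ : 0 < γ)
    (hρ : ∀ᵐ x ∂(covLaw P), γ ≤ queueScore P θ τ b n x ∧ queueScore P θ τ b n x ≤ 1 - γ)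
    (μh : Bool → EuclideanSpace ℝ (Fin d) → ℝ) (c : ℝ) :
    drEstimator P θ τ b n μh =ᵐ[sampleLaw P θ] fun ω => c + 1 / (n : ℝ) *
      (∑ l ∈ Finset.range n ×ˢ Finset.univ,
        component P τ b n (fun x => potEffect P x - c) (scoreWeight P θ τ b n) l ω
      + ∑ i ∈ Finset.range n, (status τ b n true i (arrivals ω)
          - queueScore P θ τ b n (cov (ω i).1)) * regressionError P θ τ b n μh (cov (ω i).1)) := by
  have h : ∀ᵐ ω ∂(sampleLaw P θ), ∀ i,
      (γ ≤ queueScore P θ τ b n (cov (ω i).1) ∧ queueScore P θ τ b n (cov (ω i).1) ≤ 1 - γ)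
      ∧ propensity P θ τ b n (cov (ω i).1) = queueScore P θ τ b n (cov (ω i).1) :=
    ae_all_iff.2 fun i => (measurePreserving_cov_sampleLaw i).quasiMeasurePreserving.ae
      (hρ.and (propensity_ae_eq hA τ b n))
  filter_upwards [h] with ω hω
  have hn' : (n : ℝ) ≠ 0 := by exact_mod_cast hn.ne'
  -- The constant is spread over the units, so that the identity can be checked unit by unit.
  have hc : c = 1 / (n : ℝ) * ∑ _i ∈ Finset.range n, c := by
    simp [hn']
  nth_rewrite 1 [hc]
  rw [drEstimator, ← mul_add, Finset.sum_product, ← Finset.sum_add_distrib,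
    ← Finset.sum_add_distrib]
  congr 1
  refine Finset.sum_congr rfl fun i _ => ?_
  obtain ⟨⟨h1, h2⟩, h3⟩ := hω i
  have hρ0 : queueScore P θ τ b n (cov (ω i).1) ≠ 0 := by linarith
  have hρ1 : 1 - queueScore P θ τ b n (cov (ω i).1) ≠ 0 := by linarith
  rw [Fintype.sum_option, Fintype.sum_bool]
  simp only [component, status_arrivals, h3, outcome, weightedResidual, scoreWeight,
    regressionError, potEffect]
  -- For each status the unobserved potential outcome drops out, and a rational identity in the
  -- score remains.
  cases treat τ b n i ω <;> simp <;> field_simp <;> ring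

variable (P θ) in
/-- The scaled variance of the leading term of the estimator. -/
noncomputable def leadingVar (τ : ℕ) (b : ℕ → ℕ → ℕ) (n : ℕ) : ℝ :=
  ∫ x, (potVar P true x / queueScore P θ τ b n x
    + potVar P false x / (1 - queueScore P θ τ b n x)) ∂(covLaw P) + Var[potEffect P; covLaw P]

lemma integrable_potVar_div {z : Bool} (hz : MemLp (fun o => pot o z) 2 P)
    {s : EuclideanSpace ℝ (Fin d) → ℝ} (hs : AEStronglyMeasurable s (covLaw P)) {γ : ℝ}
    (hγ : 0 < γ) (hs' : ∀ᵐ x ∂(covLaw P), γ ≤ s x) :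
    Integrable (fun x => potVar P z x / s x) (covLaw P) := by
  have h := (integrable_potVar hz).bdd_mul (c := 1 / γ) (f := fun x => (s x)⁻¹)
    hs.aemeasurable.inv.aestronglyMeasurable (by
      filter_upwards [hs'] with x hx
      rw [Real.norm_of_nonneg (inv_nonneg.2 (hγ.le.trans hx)), one_div]
      exact inv_anti₀ hγ hx)
  exact h.congr (Eventually.of_forall fun x => by
    change (s x)⁻¹ * _ = _ / _
    rw [div_eq_mul_inv, mul_comm])

lemma leadingVar_nonneg {τ : ℕ} {b : ℕ → ℕ → ℕ} {n : ℕ} : 0 ≤ leadingVar P θ τ b n := by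
  refine add_nonneg (integral_nonneg fun x => add_nonneg ?_ ?_) (variance_nonneg _ _)
  · exact div_nonneg (potVar_nonneg _ _) (queueScore_nonneg ..)
  · exact div_nonneg (potVar_nonneg _ _) (sub_nonneg.2 (queueScore_le_one ..))

/-- Probability of a status times squared inverse weight is the inverse probability, which produces
the form of the bound exactly, at finite `n`. -/
lemma integral_sq_sum_component_eq (hA : IndepFun (arr (d := d)) (fun o : Obs d => o.2) P)
    (hA_cont : ∀ s : ℝ, P {o | arr o = s} = 0)
    (hz : ∀ z, MemLp (fun o => pot o z) 2 P) {τ : ℕ}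
    {b : ℕ → ℕ → ℕ} {n : ℕ} {γ : ℝ} (hγ : 0 < γ)
    (hρ : ∀ᵐ x ∂(covLaw P), γ ≤ queueScore P θ τ b n x ∧ queueScore P θ τ b n x ≤ 1 - γ) :
    ∫ ω, (∑ l ∈ Finset.range n ×ˢ Finset.univ, component P τ b n
      (fun x => potEffect P x - ∫ x, potEffect P x ∂(covLaw P)) (scoreWeight P θ τ b n) l ω) ^ 2
      ∂(sampleLaw P θ) = n * leadingVar P θ τ b n := by
  have hE := memLp_potEffect hz
  have hEm : Measurable (potEffect P) := (measurable_potMean true).sub (measurable_potMean false)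
  have hρm := measurable_queueScore (P := P) (θ := θ) τ b n
  rw [integral_sq_sum_component hA hA_cont hz τ b n (hEm.sub_const _)
    (hE.sub (memLp_const _)) ?_ (measurable_scoreWeight τ b n) (abs_scoreWeight_le hγ hρ)]
  · rw [leadingVar, variance_eq_integral hEm.aemeasurable, Fintype.sum_bool,
      integral_add (integrable_potVar_div (hz true) hρm.aestronglyMeasurable hγ
        (hρ.mono fun x hx => hx.1)) (integrable_potVar_div (hz false)
        (s := fun x => 1 - queueScore P θ τ b n x) (measurable_const.sub hρm).aestronglyMeasurable hγ
        (hρ.mono fun x hx => by linarith [hx.2]))]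
    have e1 : ∫ x, statusScore P θ τ b n true x * scoreWeight P θ τ b n true x ^ 2
        * potVar P true x ∂(covLaw P)
        = ∫ x, potVar P true x / queueScore P θ τ b n x ∂(covLaw P) := by
      refine integral_congr_ae ?_
      filter_upwards [hρ] with x hx
      have : queueScore P θ τ b n x ≠ 0 := by linarith
      simp only [statusScore, scoreWeight, if_true]
      field_simp
    have e2 : ∫ x, statusScore P θ τ b n false x * scoreWeight P θ τ b n false x ^ 2
        * potVar P false x ∂(covLaw P)
        = ∫ x, potVar P false x / (1 - queueScore P θ τ b n x) ∂(covLaw P) := by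
      refine integral_congr_ae ?_
      filter_upwards [hρ] with x hx
      have : 1 - queueScore P θ τ b n x ≠ 0 := by linarith
      simp only [statusScore, scoreWeight, Bool.false_eq_true, if_false]
      field_simp
    rw [e1, e2]
    ring
  · rw [integral_sub (hE.integrable (by norm_num)) (integrable_const _)]
    simp

/-- The inverse weights are at most `1/γ`, and the factor two comes from the square of a sum of two
errors. -/
lemma memLp_regressionError {τ : ℕ} {b : ℕ → ℕ → ℕ} {n : ℕ} {γ : ℝ} (hγ : 0 < γ)
    (hρ : ∀ᵐ x ∂(covLaw P), γ ≤ queueScore P θ τ b n x ∧ queueScore P θ τ b n x ≤ 1 - γ)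
    {μh : Bool → EuclideanSpace ℝ (Fin d) → ℝ}
    (hL : ∀ z, MemLp (fun x => potMean P z x - μh z x) 2 (covLaw P)) :
    MemLp (regressionError P θ τ b n μh) 2 (covLaw P) ∧
    ∫ x, regressionError P θ τ b n μh x ^ 2 ∂(covLaw P)
      ≤ 2 / γ ^ 2 * (∫ x, (potMean P true x - μh true x) ^ 2 ∂(covLaw P)
        + ∫ x, (potMean P false x - μh false x) ^ 2 ∂(covLaw P)) := by
  have hb1 := abs_scoreWeight_le hγ hρ true
  have hb0 := abs_scoreWeight_le hγ hρ false
  have hw1 := measurable_scoreWeight (P := P) (θ := θ) τ b n true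
  have hw0 := measurable_scoreWeight (P := P) (θ := θ) τ b n false
  have l1 : MemLp (fun x => scoreWeight P θ τ b n true x * (potMean P true x - μh true x)) 2
      (covLaw P) := by
    refine (hL true).of_le_mul (c := 1 / γ)
      (hw1.aestronglyMeasurable.mul (hL true).aestronglyMeasurable) ?_
    filter_upwards [hb1] with x hx
    rw [norm_mul]
    exact mul_le_mul_of_nonneg_right hx (norm_nonneg _)
  have l0 : MemLp (fun x => scoreWeight P θ τ b n false x * (potMean P false x - μh false x)) 2
      (covLaw P) := by
    refine (hL false).of_le_mul (c := 1 / γ)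
      (hw0.aestronglyMeasurable.mul (hL false).aestronglyMeasurable) ?_
    filter_upwards [hb0] with x hx
    rw [norm_mul]
    exact mul_le_mul_of_nonneg_right hx (norm_nonneg _)
  have e : regressionError P θ τ b n μh = fun x =>
      scoreWeight P θ τ b n true x * (potMean P true x - μh true x)
      - scoreWeight P θ τ b n false x * (potMean P false x - μh false x) := by
    funext x
    simp only [regressionError, scoreWeight, if_true, Bool.false_eq_true, if_false]
    ring
  rw [e]
  refine ⟨l1.sub l0, ?_⟩
  rw [← integral_add (hL true).integrable_sq (hL false).integrable_sq, ← integral_const_mul]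
  refine integral_mono_ae (l1.sub l0).integrable_sq
    (((hL true).integrable_sq.add (hL false).integrable_sq).const_mul _) ?_
  filter_upwards [hb1, hb0] with x h1 h0
  set u := potMean P true x - μh true x
  set v := potMean P false x - μh false x
  have h1' : scoreWeight P θ τ b n true x ^ 2 ≤ 1 / γ ^ 2 := by
    rw [← sq_abs, ← one_div_pow]; exact pow_le_pow_left₀ (abs_nonneg _) h1 2
  have h0' : scoreWeight P θ τ b n false x ^ 2 ≤ 1 / γ ^ 2 := by
    rw [← sq_abs, ← one_div_pow]; exact pow_le_pow_left₀ (abs_nonneg _) h0 2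
  have h2 := mul_le_mul_of_nonneg_right h1' (sq_nonneg u)
  have h3 := mul_le_mul_of_nonneg_right h0' (sq_nonneg v)
  have h4 : 2 / γ ^ 2 * (u ^ 2 + v ^ 2) = 2 * (1 / γ ^ 2 * u ^ 2) + 2 * (1 / γ ^ 2 * v ^ 2) := by
    ring
  rw [h4]
  nlinarith [sq_nonneg (scoreWeight P θ τ b n true x * u + scoreWeight P θ τ b n false x * v)]

/-- The scaled variance of the estimator differs from that of its leading term by an amount
controlled by the errors of the outcome regressions. -/
lemma abs_variance_drEstimator_sub_le (hA : IndepFun (arr (d := d)) (fun o : Obs d => o.2) P)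
    (hA_cont : ∀ s : ℝ, P {o | arr o = s} = 0)
    (hz : ∀ z, MemLp (fun o => pot o z) 2 P) {τ : ℕ}
    {b : ℕ → ℕ → ℕ} {n : ℕ} (hn : 0 < n) {γ : ℝ} (hγ : 0 < γ)
    (hρ : ∀ᵐ x ∂(covLaw P), γ ≤ queueScore P θ τ b n x ∧ queueScore P θ τ b n x ≤ 1 - γ)
    {μh : Bool → EuclideanSpace ℝ (Fin d) → ℝ}
    (hL : ∀ z, MemLp (fun x => potMean P z x - μh z x) 2 (covLaw P)) {η : ℝ} (hη : 0 < η) :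
    MemLp (drEstimator P θ τ b n μh) 2 (sampleLaw P θ) ∧
    |n * Var[drEstimator P θ τ b n μh; sampleLaw P θ] - leadingVar P θ τ b n|
      ≤ η * leadingVar P θ τ b n + (1 + 1 / η) * (errorConst P θ τ * (2 / γ ^ 2 *
        (∫ x, (potMean P true x - μh true x) ^ 2 ∂(covLaw P)
        + ∫ x, (potMean P false x - μh false x) ^ 2 ∂(covLaw P)))) := by
  set c := ∫ x, potEffect P x ∂(covLaw P)
  have hE := memLp_potEffect hz
  have hδL : MemLp (fun x => potEffect P x - c) 2 (covLaw P) := hE.sub (memLp_const _)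
  have hδ0 : ∫ x, (potEffect P x - c) ∂(covLaw P) = 0 := by
    rw [integral_sub (hE.integrable (by norm_num)) (integrable_const _)]
    simp [c]
  have hw := measurable_scoreWeight (P := P) (θ := θ) τ b n
  have hwb := fun z => abs_scoreWeight_le hγ hρ z
  obtain ⟨hgL, hg2⟩ := memLp_regressionError hγ hρ hL
  set g := regressionError P θ τ b n μh
  set L : (ℕ → Obs d × Fin K) → ℝ := fun ω => ∑ l ∈ Finset.range n ×ˢ Finset.univ,
    component P τ b n (fun x => potEffect P x - c) (scoreWeight P θ τ b n) l ω
  set D : (ℕ → Obs d × Fin K) → ℝ := fun ω => ∑ i ∈ Finset.range n,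
    (status τ b n true i (arrivals ω) - queueScore P θ τ b n (cov (ω i).1)) * g (cov (ω i).1)
  have hLc := memLp_component (θ := θ) hz τ b n hδL hw hwb
  have hLL : MemLp L 2 (sampleLaw P θ) := memLp_finsetSum _ fun l _ => hLc l
  obtain ⟨hDL, hD2⟩ := integral_sq_sum_status_sub_score_le (θ := θ) hA hA_cont τ b n hgL
  have hW : MemLp (fun ω => L ω + D ω) 2 (sampleLaw P θ) := hLL.add hDL
  have hW0 : ∫ ω, (L ω + D ω) ∂(sampleLaw P θ) = 0 := by
    rw [integral_add (hLL.integrable (by norm_num)) (hDL.integrable (by norm_num)),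
      integral_sum_status_sub_score hA hA_cont τ b n hgL, add_zero,
      integral_finsetSum _ fun l _ => (hLc l).integrable (by norm_num)]
    exact Finset.sum_eq_zero fun l _ => integral_component hA hz τ b n hδL hδ0 hw hwb l
  have hae := drEstimator_ae_eq hA hn hγ hρ μh c
  have hn' : (0 : ℝ) < n := by exact_mod_cast hn
  refine ⟨(memLp_congr_ae hae).2 ((memLp_const c).add (hW.const_mul _)), ?_⟩
  -- `L + D` has mean zero, so its variance is its second moment; `n · n⁻² = n⁻¹`.
  have hVar : n * Var[drEstimator P θ τ b n μh; sampleLaw P θ]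
      = 1 / n * ∫ ω, (L ω + D ω) ^ 2 ∂(sampleLaw P θ) := by
    rw [variance_congr hae, variance_const_add (hW.const_mul _).aestronglyMeasurable,
      variance_const_mul, variance_eq_sub hW, hW0]
    simp only [Pi.pow_apply]
    field_simp
    ring
  have hL2 := integral_sq_sum_component_eq (θ := θ) hA hA_cont hz hγ hρ
  have hpert := abs_integral_sq_add_sub_le hLL hDL hη
  rw [hL2] at hpert
  have e1 : n * Var[drEstimator P θ τ b n μh; sampleLaw P θ] - leadingVar P θ τ b n
      = 1 / n * (∫ ω, (L ω + D ω) ^ 2 ∂(sampleLaw P θ) - n * leadingVar P θ τ b n) := by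
    rw [hVar]; field_simp
  rw [e1, abs_mul, abs_of_pos (one_div_pos.2 hn'), one_div_mul_eq_div, div_le_iff₀ hn']
  refine hpert.trans ?_
  have h5 := mul_le_mul_of_nonneg_left hg2 (errorConst_nonneg (P := P) (θ := θ) τ)
  have h6 := hD2.trans (mul_le_mul_of_nonneg_left h5 hn'.le)
  have h7 := mul_le_mul_of_nonneg_left h6 (show (0 : ℝ) ≤ 1 + 1 / η by positivity)
  refine (add_le_add_right h7 _).trans_eq ?_
  ring

/-- Dominated convergence: positivity bounds the integrand by the integrable conditional variances
divided by `γ`, once `n ≥ n₀`. -/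
lemma tendsto_leadingVar (hz : ∀ z, MemLp (fun o => pot o z) 2 P) {τ : ℕ} {b : ℕ → ℕ → ℕ}
    {γ : ℝ} (hγ : 0 < γ) {n₀ : ℕ}
    (hρ : ∀ n ≥ n₀, ∀ᵐ x ∂(covLaw P),
      γ ≤ queueScore P θ τ b n x ∧ queueScore P θ τ b n x ≤ 1 - γ)
    {s : EuclideanSpace ℝ (Fin d) → ℝ}
    (hs : ∀ᵐ x ∂(covLaw P), Tendsto (fun n => queueScore P θ τ b n x) atTop (𝓝 (s x)))
    (hs' : ∀ᵐ x ∂(covLaw P), γ ≤ s x ∧ s x ≤ 1 - γ) :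
    Tendsto (leadingVar P θ τ b) atTop (𝓝
      (∫ x, (potVar P true x / s x + potVar P false x / (1 - s x)) ∂(covLaw P)
        + Var[potEffect P; covLaw P])) := by
  refine Tendsto.add_const _ ?_
  refine tendsto_integral_filter_of_dominated_convergence
    (fun x => potVar P true x / γ + potVar P false x / γ) ?_ ?_ ?_ ?_
  · refine Eventually.of_forall fun n => Measurable.aestronglyMeasurable ?_
    exact ((measurable_potVar true).div (measurable_queueScore τ b n)).add
      ((measurable_potVar false).div (measurable_const.sub (measurable_queueScore τ b n)))
  · filter_upwards [eventually_ge_atTop n₀] with n hn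
    filter_upwards [hρ n hn] with x hx
    have h1 := potVar_nonneg (P := P) true x
    have h0 := potVar_nonneg (P := P) false x
    rw [Real.norm_of_nonneg (add_nonneg (div_nonneg h1 (by linarith))
      (div_nonneg h0 (by linarith)))]
    exact add_le_add (div_le_div_of_nonneg_left h1 hγ hx.1)
      (div_le_div_of_nonneg_left h0 hγ (by linarith))
  · exact ((integrable_potVar (hz true)).div_const _).add ((integrable_potVar (hz false)).div_const _)
  · filter_upwards [hs, hs'] with x hx hx'
    exact (tendsto_const_nhds.div hx (by linarith)).add
      (tendsto_const_nhds.div (tendsto_const_nhds.sub hx) (by linarith))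

end Variance

end QueueDesign

/-! ### Assembly of the theorem -/

theorem theorem5 {d K : ℕ} (τ : ℕ)
    -- the law of `(A, X, Y⁰, Y¹)`, with continuously distributed arrival times in `[0, τ]`
    (P : Measure (Obs d)) [IsProbabilityMeasure P]
    (hA_range : ∀ᵐ o ∂P, arr o ∈ Set.Icc (0 : ℝ) τ)
    (hA_cont : ∀ s : ℝ, P {o | arr o = s} = 0)
    -- the queue assignment policy, and the budget `b n t` of period `t` in the experiment of size `n`
    (θ : Kernel (EuclideanSpace ℝ (Fin d)) (Fin K)) [IsMarkovKernel θ]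
    (b : ℕ → ℕ → ℕ)
    -- exogenous arrivals
    (h_exo : CondIndepFun (MeasurableSpace.comap cov inferInstance) measurable_cov.comap_le
      arr pot P)
    -- positivity
    (γ : ℝ) (hγ : 0 < γ) (n₀ : ℕ)
    (h_pos : ∀ n ≥ n₀, ∀ᵐ x ∂(covLaw P),
      γ ≤ propensity P θ τ b n x ∧ propensity P θ τ b n x ≤ 1 - γ)
    -- fixed queue proportions
    (p : Fin K → ℝ) (hp : p ∈ stdSimplex ℝ (Fin K))
    (h_queue : ∀ k, ∫ x, (θ x).real {k} ∂(covLaw P) = p k)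
    -- stable and non-negligible budget
    (β : ℝ) (hβ : β ∈ Set.Ioo (0 : ℝ) 1)
    (h_budget : Tendsto
      (fun n : ℕ => ⨆ t : Set.Icc 1 τ,
        |1 / (n : ℝ) * ∑ s ∈ Finset.Icc 1 (t : ℕ), (b n s : ℝ) - β * P.real {o | arr o ≤ (t : ℕ)}|)
      atTop (𝓝 0))
    -- arrivals independent of the covariates
    (h_indep : IndepFun arr cov P)
    -- potential outcomes with finite second moments
    (hY : ∃ m : ℝ, ∫⁻ o, ENNReal.ofReal (pot o true ^ 2 + pot o false ^ 2) ∂P ≤ ENNReal.ofReal m)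
    -- outcome regressions fitted on an auxiliary sample `D`, with values in `𝒟` and law `ν`, which is
    -- independent of the experiment, and consistent in `L²`
    {𝒟 : Type*} [MeasurableSpace 𝒟] (ν : Measure 𝒟) [IsProbabilityMeasure ν]
    (μhat : ℕ → 𝒟 → Bool → EuclideanSpace ℝ (Fin d) → ℝ)
    (hμ_meas : ∀ n z, Measurable fun y : 𝒟 × EuclideanSpace ℝ (Fin d) => μhat n y.1 z y.2)
    (hμ : ∀ z, ∀ ε : ENNReal, 0 < ε → Tendsto
      (fun n => ν {D | ε ≤ eLpNorm (fun x => μhat n D z x - outcomeMean P θ τ b n z x) 2 (covLaw P)})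
      atTop (𝓝 0)) :
    -- the asymptotic propensity score exists
    (∀ᵐ x ∂(covLaw P),
      Tendsto (fun n => propensity P θ τ b n x) atTop (𝓝 (asympPropensity P θ τ b x))) ∧
    -- the efficiency bound is well defined and, for `m ≥ n₀`, does not depend on the size `m` of the
    -- experiment that defines the law of `(X, Z, Y)`; conditionally on `D`, the scaled variance of the
    -- estimator converges to it in probability
    ∀ m ≥ n₀,
      Integrable (weightedVar P θ τ b m) (covLaw P) ∧
      MemLp (condEffect P θ τ b m) 2 (covLaw P) ∧
      ∀ ε : ℝ, 0 < ε → Tendsto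
        (fun n : ℕ => ν {D | ¬ (MemLp (drEstimator P θ τ b n (μhat n D)) 2 (sampleLaw P θ) ∧
          |(n : ℝ) * Var[drEstimator P θ τ b n (μhat n D); sampleLaw P θ]
            - efficiencyBound P θ τ b m| < ε)})
        atTop (𝓝 0) := by
  have hA := indepFun_arr_cov_pot h_exo h_indep
  have hz := memLp_pot hY
  have hlim := tendsto_propensity (θ := θ) hA hA_cont hA_range h_budget
  refine ⟨hlim, fun m hm => ?_⟩
  have hρ : ∀ n ≥ n₀, ∀ᵐ x ∂(covLaw P),
      γ ≤ queueScore P θ τ b n x ∧ queueScore P θ τ b n x ≤ 1 - γ := fun n hn => by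
    filter_upwards [h_pos n hn, propensity_ae_eq (θ := θ) hA τ b n] with x hx hx2
    rwa [hx2] at hx
  have hs : ∀ᵐ x ∂(covLaw P),
      Tendsto (fun n => queueScore P θ τ b n x) atTop (𝓝 (asympPropensity P θ τ b x)) := by
    filter_upwards [hlim, ae_all_iff.2 fun n => propensity_ae_eq (θ := θ) hA τ b n] with x hx hx2
    simpa only [hx2] using hx
  have hs' : ∀ᵐ x ∂(covLaw P),
      γ ≤ asympPropensity P θ τ b x ∧ asympPropensity P θ τ b x ≤ 1 - γ := by
    have h : ∀ᵐ x ∂(covLaw P), ∀ n ≥ n₀,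
        γ ≤ queueScore P θ τ b n x ∧ queueScore P θ τ b n x ≤ 1 - γ :=
      ae_all_iff.2 fun n => eventually_imp_distrib_left.2 (hρ n)
    filter_upwards [hs, h] with x hx hx2
    exact ⟨ge_of_tendsto hx ((eventually_ge_atTop n₀).mono fun n hn => (hx2 n hn).1),
      le_of_tendsto hx ((eventually_ge_atTop n₀).mono fun n hn => (hx2 n hn).2)⟩
  have hsm : AEStronglyMeasurable (asympPropensity P θ τ b) (covLaw P) :=
    aestronglyMeasurable_of_tendsto_ae atTop
      (fun n => (measurable_queueScore τ b n).aestronglyMeasurable) hs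
  -- The right side is free of `n`: the targets of the fitted regressions at size `n` and the
  -- moments at size `m` are those of the same conditional laws.
  have hlaw : ∀ n ≥ n₀, ∀ z, ∀ᵐ x ∂(covLaw P), outcomeLaw P θ τ b n z x = potLaw P z x :=
    fun n hn z => outcomeLaw_eq_potLaw hA hγ (h_pos n hn) z
  have hwv : weightedVar P θ τ b m =ᵐ[covLaw P] fun x =>
      potVar P true x / asympPropensity P θ τ b x
        + potVar P false x / (1 - asympPropensity P θ τ b x) := by
    filter_upwards [hlaw m hm true, hlaw m hm false] with x h1 h0
    simp only [weightedVar, outcomeVar, h1, h0, potVar]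
  have hce : condEffect P θ τ b m =ᵐ[covLaw P] potEffect P := by
    filter_upwards [hlaw m hm true, hlaw m hm false] with x h1 h0
    simp only [condEffect, outcomeMean, h1, h0, potEffect, potMean]
  have hint : Integrable (weightedVar P θ τ b m) (covLaw P) :=
    ((integrable_potVar_div (hz true) hsm hγ (hs'.mono fun x hx => hx.1)).add
      (integrable_potVar_div (hz false) (s := fun x => 1 - asympPropensity P θ τ b x)
        (aestronglyMeasurable_const.sub hsm) hγ
        (hs'.mono fun x hx => by linarith [hx.2]))).congr hwv.symm
  refine ⟨hint, (memLp_congr_ae hce).2 (memLp_potEffect hz), fun ε hε => ?_⟩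
  set B := efficiencyBound P θ τ b m with hB
  have hlead : Tendsto (leadingVar P θ τ b) atTop (𝓝 B) := by
    rw [hB, efficiencyBound, integral_congr_ae hwv, variance_congr hce]
    exact tendsto_leadingVar hz hγ hρ hs hs'
  have hB0 : 0 ≤ B := ge_of_tendsto' hlead fun n => leadingVar_nonneg
  -- `B + 1` bounds `leadingVar` for large `n`, and is positive even when `B = 0`.
  obtain ⟨η, hη, hηB⟩ : ∃ η > 0, η * (B + 1) ≤ ε / 4 :=
    ⟨ε / 4 / (B + 1), by positivity, (div_mul_cancel₀ _ (by positivity)).le⟩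
  set C := (1 + 1 / η) * (errorConst P θ τ * (2 / γ ^ 2)) with hC
  have hC0 : 0 ≤ C := by
    have := errorConst_nonneg (P := P) (θ := θ) τ
    positivity
  -- `δ` is the accuracy demanded of both regressions, after `η` has fixed `C`.
  obtain ⟨δ, hδ, hδC⟩ : ∃ δ > 0, C * (δ ^ 2 + δ ^ 2) ≤ ε / 4 := by
    refine ⟨Real.sqrt (ε / (8 * (C + 1))), Real.sqrt_pos.2 (by positivity), ?_⟩
    rw [Real.sq_sqrt (by positivity)]
    have : (C + 1) * (ε / (8 * (C + 1)) + ε / (8 * (C + 1))) = ε / 4 := by field_simp; ring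
    rw [← this]
    exact mul_le_mul_of_nonneg_right (by linarith) (by positivity)
  have hsum := (hμ true (ENNReal.ofReal δ) (ENNReal.ofReal_pos.2 hδ)).add
    (hμ false (ENNReal.ofReal δ) (ENNReal.ofReal_pos.2 hδ))
  rw [add_zero] at hsum
  refine tendsto_of_tendsto_of_tendsto_of_le_of_le' tendsto_const_nhds hsum
    (Eventually.of_forall fun n => zero_le) ?_
  filter_upwards [eventually_ge_atTop n₀, eventually_gt_atTop 0,
    hlead.eventually (Metric.ball_mem_nhds B (show 0 < min (ε / 4) 1 by positivity))]
    with n hn hn0 hnB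
  -- The bad event lies in the union of the two events that a regression error reaches `δ`. Only
  -- monotonicity and subadditivity of `ν` enter, so the bad event need not be measurable.
  refine le_trans (measure_mono fun D hD => ?_) (measure_union_le _ _)
  by_contra hcon
  simp only [Set.mem_union, Set.mem_ofPred_eq, not_or, not_le] at hcon
  apply hD
  have hmeas : ∀ z, Measurable (μhat n D z) := fun z => (hμ_meas n z).comp measurable_prodMk_left
  have hsmall : ∀ z, eLpNorm (fun x => μhat n D z x - outcomeMean P θ τ b n z x) 2 (covLaw P)
      < ENNReal.ofReal δ := fun z => by cases z; exacts [hcon.2, hcon.1]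
  have hsmall' : ∀ z, eLpNorm (fun x => potMean P z x - μhat n D z x) 2 (covLaw P)
      < ENNReal.ofReal δ := fun z => by
    refine lt_of_eq_of_lt ?_ (hsmall z)
    refine eLpNorm_congr_norm_ae ?_
    filter_upwards [hlaw n hn z] with x hx
    rw [norm_sub_rev, outcomeMean, hx, potMean]
  have hL : ∀ z, MemLp (fun x => potMean P z x - μhat n D z x) 2 (covLaw P) := fun z =>
    ⟨((measurable_potMean z).sub (hmeas z)).aestronglyMeasurable,
      (hsmall' z).trans ENNReal.ofReal_lt_top⟩
  have hL2 : ∀ z, ∫ x, (potMean P z x - μhat n D z x) ^ 2 ∂(covLaw P) ≤ δ ^ 2 := fun z =>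
    integral_sq_le_of_eLpNorm_le (hL z) hδ.le (hsmall' z).le
  obtain ⟨hmem, hbound⟩ := abs_variance_drEstimator_sub_le hA hA_cont hz hn0 hγ (hρ n hn) hL hη
  refine ⟨hmem, ?_⟩
  rw [Real.dist_eq, lt_min_iff] at hnB
  have h1 : leadingVar P θ τ b n ≤ B + 1 := by
    have := (abs_lt.1 hnB.2).2
    linarith
  have h2 := mul_le_mul_of_nonneg_left h1 hη.le
  have h3 : (1 + 1 / η) * (errorConst P θ τ * (2 / γ ^ 2 *
      (∫ x, (potMean P true x - μhat n D true x) ^ 2 ∂(covLaw P)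
        + ∫ x, (potMean P false x - μhat n D false x) ^ 2 ∂(covLaw P)))) ≤ ε / 4 := by
    refine le_trans (le_of_eq ?_) ((mul_le_mul_of_nonneg_left
      (add_le_add (hL2 true) (hL2 false)) hC0).trans hδC)
    rw [hC]; ring
  -- Three contributions of at most `ε/4`: the factor `η`, the regression errors, and the distance
  -- of `leadingVar` from its limit.
  refine (abs_sub_le _ (leadingVar P θ τ b n) _).trans_lt ?_
  linarith [hnB.1]
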